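/- **Setting.** Let $d\ge 1$ and $0<r<R$. A set $\mathcal L\subset\mathbb R^d$ is $(r,R)$-Delone if every open ball of radius $r$ contains at most one point of $\mathcal L$ and every closed ball of radius $R$ contains at least one. The $(r,R)$-Delone sets carry the (compact metrizable) local Hausdorff topology: a basic neighbourhood of $\mathcal L$ consists of those $\mathcal L'$ such that each point of $\mathcal L\cap B(0;M)$ is at distance $<\epsilon$ from $\mathcal L'$, and each point of $\mathcal L'\cap B(0;M)$ is at distance $<\epsilon$ from $\mathcal L$. Fix a Delone set $\mathcal L_0$; let $\Omega$ (the hull) be the closure of $\{\mathcal L_0-a: a\in\mathbb R^d\}$ and $\Xi=\{\mathcal L\in\Omega: 0\in\mathcal L\}$. Let $\mu$ be a translation-invariant ergodic Borel probability measure on $\Omega$, and let $\mathbf P$ be the measure that it induces on $\Xi$, $$\mathbf P(A)=\int_\Omega \#\{x\in\mathcal L\cap[0,1)^d:\ \mathcal L-x\in A\}\,d\mu(\mathcal L),$$ so that $\mathbf P(\Xi)$ is the mean number of points per unit volume ($\mathbf P$ is a probability measure when the unit of length is chosen so that this density is $1$). Let $\mathcal G=\{(\mathcal L,x):\mathcal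 L\in\Xi,\ x\in\mathcal L\}$ be the transversal groupoid, let $B$ be a real antisymmetric $d\times d$ matrix (constant magnetic field), and let $\Gamma\langle 0,y,z\rangle=\tfrac12\sum_{j,k}B^{jk}y_jz_k$ be its flux through the triangle $\langle 0,y,z\rangle$. On $C_c(\mathcal G)$ one has the twisted convolution $$(f_1*f_2)(\mathcal L,x)=\sum_{y\in\mathcal L}e^{-i\Gamma\langle0,y,x\rangle}f_1(\mathcal L,y)f_2(\mathcal L-y,x-y),$$ the involution $f^*(\mathcal L,x)=\overline{f(\mathcal L-x,-x)}$, the derivations $(\partial_jf)(\mathcal L,x)=x_jf(\mathcal L,x)$, the trace $\mathcal T(f)=\int_\Xi f(\mathcal L,0)\,d\mathbf P(\mathcal L)$, and the representations on $\ell^2(\mathcal L)$ $$(\pi_{\mathcal L}(f)\psi)(x)=\sum_{y\in\mathcal L}e^{-i\Gamma\langle 0,y-x,-x\rangle}f(\mathcal L-x,y-x)\psi(y).$$ Let $L^2(\mathcal G,\mathcal T)$ be the GNS space of $\mathcal T$, that is, the $L^2$ space of the measure $\int_\Xi\sum_{x\in\mathcal L}\delta_{(\mathcal L,x)}\,d\mathbf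 P(\mathcal L)$ on $\mathcal G$, and let $L^\infty(\mathcal G,\mathcal T)$ be the weak operator closure of the left convolution operators by elements of $C_c(\mathcal G)$ on it; its elements are identified with functions on $\mathcal G$ by $T\mapsto T1$, where $1(\mathcal L,x)=\delta_{x,0}$. The Sobolev algebra $\mathcal A_{\rm Sob}$ is the intersection of $L^\infty(\mathcal G,\mathcal T)$ with the completion (inside $L^2(\mathcal G,\mathcal T)$) of $C_c(\mathcal G)$ for the norms $\|f\|_{m,p}=\sum_{|\alpha|\le m}\mathcal T(|\partial^\alpha f|^p)^{1/p}$, $m\in\mathbb N$, $p\in\mathbb N_{\ge1}$. For $f\in\mathcal A_{\rm Sob}$, $\pi_{\mathcal L}(f)$ is given by the same formula. Finally $X$ is the position operator on $\ell^2(\mathcal L)$, so that $(1+|X|^2)^{-s/2}$ is multiplication by $(1+|x|^2)^{-s/2}$. **Statement.** Let $f\in\mathcal A_{\rm Sob}$. Then $\mathcal L\mapsto f(\mathcal L,0)$ is $\mathbf P$-integrable and, for $\mathbf P$-almost every $\mathcal L\in\Xi$, $\pi_{\mathcal L}(f)$ is a bounded operator on $\ell^2(\mathcal L)$, the operator $\pi_{\mathcal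 L}(f)(1+|X|^2)^{-s/2}$ is trace class for all $s\in\mathbb C$ with $\operatorname{Re}s>d$, and $$\mathcal T(f)=\operatorname{Tr}_{\rm Vol}(\pi_{\mathcal L}(f))=\frac1{\operatorname{Vol}_{d-1}(S^{d-1})}\ \operatorname{res}_{s=d}\operatorname{Tr}\big(\pi_{\mathcal L}(f)(1+|X|^2)^{-s/2}\big).$$ Here $\operatorname{Tr}_{\rm Vol}(T)=\lim_{\rho\to\infty}\frac{1}{\operatorname{vol}(\rho K)}\sum_{x\in\mathcal L\cap\rho K}\langle e_x,Te_x\rangle$, where the limit exists and is the same for every bounded convex $K\subset\mathbb R^d$ with non-empty interior. If the sums are normalised by the number of points of $\mathcal L\cap\rho K$ instead of $\operatorname{vol}(\rho K)$, the limit is $\mathcal T(f)/\mathbf P(\Xi)$. The residue is that of a function $G$ holomorphic on $\operatorname{Re}s>d$ at the boundary point $d$: $\operatorname{res}_{s=d}G=\lim(s-d)G(s)$, where $s\to d$ within any sector $|s-d|\le\kappa(\operatorname{Re}s-d)$ (the limit exists; if $G$ continues meromorphically to a neighbourhood of $d$, the continuation has at most a simple pole there and this is its usual residue). -/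

import Mathlib

open MeasureTheory Filter Topology Set
open scoped Pointwise ENNReal CompactlySupported

noncomputable section

namespace Aperiodic

/-- Physical space `ℝᵈ` with its Euclidean norm. -/
abbrev E (d : ℕ) : Type := EuclideanSpace ℝ (Fin d)

/-! ### Delone sets, hull, transversal -/

/-- `L` is `r`-uniformly discrete and `R`-relatively dense. Relative density is tested on closed
balls, so that the condition passes to limits of point patterns. -/
def IsDelone {d : ℕ} (r R : ℝ) (L : Set (E d)) : Prop :=
  (∀ x, (Metric.ball x r ∩ L).encard ≤ 1) ∧ (∀ x, (Metric.closedBall x R ∩ L).Nonempty)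

/-- The space of `(r,R)`-Delone subsets of `ℝᵈ`. -/
def Del (d : ℕ) (r R : ℝ) : Type := {L : Set (E d) // IsDelone r R L}

namespace Del

variable {d : ℕ} {r R : ℝ}

/-- The translated pattern `L - a`. -/
def shift (a : E d) (L : Del d r R) : Del d r R :=
  ⟨{x | x + a ∈ L.1}, by
    constructor
    · intro x
      have hmaps : Set.MapsTo (fun y : E d => y + a)
          (Metric.ball x r ∩ {x | x + a ∈ L.1}) (Metric.ball (x + a) r ∩ L.1) := by
        rintro y ⟨hy, hyL⟩
        refine ⟨?_, hyL⟩
        simpa [Metric.mem_ball, dist_add_right] using hy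
      have hinj : Function.Injective (fun y : E d => y + a) := add_left_injective a
      calc (Metric.ball x r ∩ {x | x + a ∈ L.1}).encard
          = ((fun y : E d => y + a) '' (Metric.ball x r ∩ {x | x + a ∈ L.1})).encard :=
            (hinj.encard_image _).symm
        _ ≤ (Metric.ball (x + a) r ∩ L.1).encard := Set.encard_le_encard hmaps.image_subset
        _ ≤ 1 := L.2.1 _
    · intro x
      obtain ⟨y, hy, hyL⟩ := L.2.2 (x + a)
      refine ⟨y - a, ?_, ?_⟩
      · have : dist (y - a) x = dist y (x + a) := by
          rw [dist_eq_norm, dist_eq_norm]; congr 1; abel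
        simpa [Metric.mem_closedBall, this] using hy
      · simpa using hyL⟩

/-- `L` and `L'` agree up to `ε` inside the ball `B(0;M)` (local Hausdorff closeness). -/
def LocallyClose (M ε : ℝ) (L L' : Del d r R) : Prop :=
  L.1 ∩ Metric.ball 0 M ⊆ Metric.thickening ε L'.1 ∧
    L'.1 ∩ Metric.ball 0 M ⊆ Metric.thickening ε L.1

/-- The local Hausdorff topology: the sets `{L' | LocallyClose M ε L L'}`, `M, ε > 0`, are a
basis of neighbourhoods of `L`. -/
instance : TopologicalSpace (Del d r R) where
  IsOpen S := ∀ L ∈ S, ∃ M > 0, ∃ ε > 0, ∀ L', LocallyClose M ε L L' → L' ∈ S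
  isOpen_univ := fun _ _ => ⟨1, one_pos, 1, one_pos, fun _ _ => trivial⟩
  isOpen_inter := by
    rintro S T hS hT L ⟨hLS, hLT⟩
    obtain ⟨M₁, hM₁, ε₁, hε₁, h₁⟩ := hS L hLS
    obtain ⟨M₂, hM₂, ε₂, hε₂, h₂⟩ := hT L hLT
    refine ⟨max M₁ M₂, lt_max_of_lt_left hM₁, min ε₁ ε₂, lt_min hε₁ hε₂, fun L' h => ⟨?_, ?_⟩⟩
    · refine h₁ L' ⟨?_, ?_⟩
      · exact fun x hx => Metric.thickening_mono (min_le_left _ _) _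
          (h.1 ⟨hx.1, Metric.ball_subset_ball (le_max_left _ _) hx.2⟩)
      · exact fun x hx => Metric.thickening_mono (min_le_left _ _) _
          (h.2 ⟨hx.1, Metric.ball_subset_ball (le_max_left _ _) hx.2⟩)
    · refine h₂ L' ⟨?_, ?_⟩
      · exact fun x hx => Metric.thickening_mono (min_le_right _ _) _
          (h.1 ⟨hx.1, Metric.ball_subset_ball (le_max_right _ _) hx.2⟩)
      · exact fun x hx => Metric.thickening_mono (min_le_right _ _) _
          (h.2 ⟨hx.1, Metric.ball_subset_ball (le_max_right _ _) hx.2⟩)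
  isOpen_sUnion := by
    rintro 𝒮 h𝒮 L ⟨S, hS, hLS⟩
    obtain ⟨M, hM, ε, hε, h⟩ := h𝒮 S hS L hLS
    exact ⟨M, hM, ε, hε, fun L' hL' => ⟨S, hS, h L' hL'⟩⟩

instance : MeasurableSpace (Del d r R) := borel _

instance : BorelSpace (Del d r R) := ⟨rfl⟩

end Del

section Groupoid

variable {d : ℕ} {r R : ℝ}

/-- The hull `Ω` of `L₀`: the closure of its translation orbit. -/
def hull (L₀ : Del d r R) : Set (Del d r R) := closure (Set.range fun a : E d => L₀.shift a)

/-- The transversal `Ξ` of `L₀`: the patterns in the hull that contain the origin. -/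
def transversal (L₀ : Del d r R) : Set (Del d r R) := {L | L ∈ hull L₀ ∧ (0 : E d) ∈ L.1}

/-- `μ` is a translation invariant, ergodic Borel probability measure on the hull of `L₀`. -/
structure IsErgodicOnHull (L₀ : Del d r R) (μ : Measure (Del d r R)) : Prop where
  prob : μ Set.univ = 1
  carried : μ (hull L₀)ᶜ = 0
  invariant : ∀ a : E d, MeasurePreserving (Del.shift a) μ μ
  ergodic : ∀ S : Set (Del d r R), MeasurableSet S →
    (∀ a : E d, Del.shift a ⁻¹' S = S) → μ S = 0 ∨ μ Sᶜ = 0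

/-- The measure `𝐏` on the transversal induced by an invariant measure `μ` on the hull:
`𝐏(A) = ∫ #{x ∈ L ∩ [0,1)ᵈ | L - x ∈ A} dμ(L)`. Its total mass is the mean number of points of
the pattern per unit volume. -/
def transverseMeasure (μ : Measure (Del d r R)) : Measure (Del d r R) :=
  μ.bind fun L =>
    Measure.sum fun x : {x : E d // x ∈ L.1 ∧ ∀ i, x i ∈ Set.Ico (0 : ℝ) 1} =>
      Measure.dirac (L.shift x.1)

/-- The transversal groupoid `𝒢 = {(L, x) | L ∈ Ξ, x ∈ L}`; the range of `(L, x)` is `L`. -/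
def Gpd (L₀ : Del d r R) : Type := {γ : Del d r R × E d // γ.1 ∈ transversal L₀ ∧ γ.2 ∈ γ.1.1}

instance (L₀ : Del d r R) : TopologicalSpace (Gpd L₀) := instTopologicalSpaceSubtype

instance (L₀ : Del d r R) : MeasurableSpace (Gpd L₀) := borel _

instance (L₀ : Del d r R) : BorelSpace (Gpd L₀) := ⟨rfl⟩

variable {L₀ : Del d r R}

/-- The value `f(L, x)` of a function on the groupoid (zero for pairs outside the groupoid). -/
def ev (f : Gpd L₀ → ℂ) (L : Del d r R) (x : E d) : ℂ :=
  open Classical in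
  if h : L ∈ transversal L₀ ∧ x ∈ L.1 then f ⟨(L, x), h⟩ else 0

/-- The measure `∫_Ξ ∑_{γ, range γ = L} δ_γ d𝐏(L)` on the groupoid. -/
def gpdMeasure (L₀ : Del d r R) (μ : Measure (Del d r R)) : Measure (Gpd L₀) :=
  (transverseMeasure μ).bind fun L =>
    Measure.sum fun γ : {γ : Gpd L₀ // γ.1.1 = L} => Measure.dirac γ.1

/-- Flux of the constant field `½ ∑ B j k dx_j ∧ dx_k` through the oriented triangle
`⟨x, y, z⟩`. -/
def flux (B : Matrix (Fin d) (Fin d) ℝ) (x y z : E d) : ℝ :=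
  (1 / 2) * ∑ j, ∑ k, B j k * (y j - x j) * (z k - x k)

/-- The magnetic phase `exp(-i Γ⟨0, y, z⟩)`. -/
def phase (B : Matrix (Fin d) (Fin d) ℝ) (y z : E d) : ℂ :=
  Complex.exp (-Complex.I * (flux B 0 y z : ℝ))

/-- Twisted convolution
`(f₁ ∗ f₂)(L,x) = ∑_{y ∈ L} exp(-iΓ⟨0,y,x⟩) f₁(L,y) f₂(L-y,x-y)`. -/
def conv (B : Matrix (Fin d) (Fin d) ℝ) (f₁ f₂ : Gpd L₀ → ℂ) (γ : Gpd L₀) : ℂ :=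
  ∑' y : γ.1.1.1, phase B y.1 γ.1.2 * ev f₁ γ.1.1 y.1 * ev f₂ (γ.1.1.shift y.1) (γ.1.2 - y.1)

/-- The unit `1(L,x) = δ_{x,0}` of the convolution algebra. -/
def unitFun (L₀ : Del d r R) (γ : Gpd L₀) : ℂ :=
  open Classical in
  if γ.1.2 = 0 then 1 else 0

/-- `(∂^α f)(L,x) = x^α f(L,x)`. -/
def monomialDeriv (α : Fin d → ℕ) (f : Gpd L₀ → ℂ) (γ : Gpd L₀) : ℂ :=
  ((∏ j, γ.1.2 j ^ α j : ℝ) : ℂ) * f γ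

/-- The trace `𝒯(f) = ∫_Ξ f(L,0) d𝐏(L)`. -/
def trT (μ : Measure (Del d r R)) (f : Gpd L₀ → ℂ) : ℂ := ∫ L, ev f L 0 ∂(transverseMeasure μ)

end Groupoid

/-! ### Operators on `ℓ²` of a set -/

section Operators

/-- The absolute value `|T| = (T*T)^{1/2}` of a bounded operator on a Hilbert space. -/
def absOp {H : Type} [NormedAddCommGroup H] [InnerProductSpace ℂ H] [CompleteSpace H]
    (T : H →L[ℂ] H) : H →L[ℂ] H :=
  CFC.abs T

/-- The Hilbert space `ℓ²(ι)`. -/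
abbrev ell2 (ι : Type) : Type := lp (fun _ : ι => ℂ) 2

variable {ι : Type}

/-- The canonical basis vector at `x`. -/
def e (x : ι) : ell2 ι :=
  open Classical in
  lp.single 2 x (1 : ℂ)

/-- `T` is the bounded operator `(Tψ)(x) = ∑_y k(x,y) ψ(y)`. -/
def IsOpOfKernel (k : ι → ι → ℂ) (T : ell2 ι →L[ℂ] ell2 ι) : Prop :=
  ∀ (ψ : ell2 ι) (x : ι), HasSum (fun y => k x y * ψ y) (T ψ x)

/-- The bounded operator with integral kernel `k` (zero if `k` defines no bounded operator). -/
def opOfKernel (k : ι → ι → ℂ) : ell2 ι →L[ℂ] ell2 ι :=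
  open Classical in
  if h : ∃ T, IsOpOfKernel k T then h.choose else 0

/-- `T` is trace class: `|T|` has finite trace. -/
def IsTraceClass (T : ell2 ι →L[ℂ] ell2 ι) : Prop :=
  Summable fun x => (inner ℂ (e x) (absOp T (e x))).re

/-- The trace (meaningful for trace class operators). -/
def opTrace (T : ell2 ι →L[ℂ] ell2 ι) : ℂ := ∑' x, inner ℂ (e x) (T (e x))

end Operators

section Representation

variable {d : ℕ} {r R : ℝ} {L₀ : Del d r R}

/-- The kernel `exp(-iΓ⟨0,y-x,-x⟩) f(L-x,y-x)`, `x, y ∈ L`, of `π_L(f)`. -/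
def repKernel (B : Matrix (Fin d) (Fin d) ℝ) (f : Gpd L₀ → ℂ) (L : Del d r R) (x y : L.1) : ℂ :=
  phase B (y.1 - x.1) (-x.1) * ev f (L.shift x.1) (y.1 - x.1)

/-- The operator `π_L(f)` on `ℓ²(L)`. -/
def rep (B : Matrix (Fin d) (Fin d) ℝ) (f : Gpd L₀ → ℂ) (L : Del d r R) :
    ell2 L.1 →L[ℂ] ell2 L.1 :=
  opOfKernel (repKernel B f L)

/-- The operator `(1+|X|²)^{-s/2}` on `ℓ²(L)`. -/
def weight (L : Del d r R) (s : ℂ) : ell2 L.1 →L[ℂ] ell2 L.1 :=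
  open Classical in
  opOfKernel fun x y => if x = y then ((1 + ‖x.1‖ ^ 2 : ℝ) : ℂ) ^ (-s / 2) else 0

/-- The trace `Tr_Λ(T) = ∑_{x ∈ L ∩ Λ} ⟨e_x, T e_x⟩` over a bounded region `Λ`. -/
def localTrace (L : Del d r R) (T : ell2 L.1 →L[ℂ] ell2 L.1) (Λ : Set (E d)) : ℂ :=
  open Classical in
  ∑' x : L.1, if x.1 ∈ Λ then inner ℂ (e x) (T (e x)) else 0

/-- The trace per unit volume of `T` exists and equals `τ`: for every bounded convex body `K`,
`Tr_{ρK}(T) / vol(ρK) → τ` as `ρ → ∞`. -/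
def HasTracePerVolume (L : Del d r R) (T : ell2 L.1 →L[ℂ] ell2 L.1) (τ : ℂ) : Prop :=
  ∀ K : Set (E d), Convex ℝ K → Bornology.IsBounded K → (interior K).Nonempty →
    Tendsto (fun ρ : ℝ => localTrace L T (ρ • K) / ((volume.real (ρ • K) : ℝ) : ℂ)) atTop (𝓝 τ)

/-- The trace per site of `T` exists and equals `τ`: as above, with `vol(ρK)` replaced by the
number of points of `L` in `ρK`. -/
def HasTracePerSite (L : Del d r R) (T : ell2 L.1 →L[ℂ] ell2 L.1) (τ : ℂ) : Prop :=
  ∀ K : Set (E d), Convex ℝ K → Bornology.IsBounded K → (interior K).Nonempty →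
    Tendsto (fun ρ : ℝ => localTrace L T (ρ • K) / ((L.1 ∩ ρ • K).ncard : ℂ)) atTop (𝓝 τ)

end Representation

/-- `G` is holomorphic on the half plane `Re s > a` and has residue `c` at the boundary point
`a`: `(s - a) G(s) → c` as `s → a` inside each sector `|s - a| ≤ κ (Re s - a)`. If `G` continues
meromorphically to a neighbourhood of `a`, this says that the continuation has at most a simple
pole at `a`, with residue `c`. -/
def HasResidueAt (G : ℂ → ℂ) (a : ℝ) (c : ℂ) : Prop :=
  DifferentiableOn ℂ G {s | a < s.re} ∧
    ∀ κ : ℝ, Tendsto (fun s : ℂ => (s - a) * G s)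
      (𝓝[{s : ℂ | a < s.re ∧ ‖s - a‖ ≤ κ * (s.re - a)}] (a : ℂ)) (𝓝 c)

/-! ### The Sobolev algebra -/

section Sobolev

variable {d : ℕ} {r R : ℝ} {L₀ : Del d r R}

/-- `𝒯(|g|^p)`, the integral over `L` of the matrix element at the origin of `|π_L(g)|^p`. -/
def trPow (B : Matrix (Fin d) (Fin d) ℝ) (μ : Measure (Del d r R)) (p : ℕ) (g : Gpd L₀ → ℂ) : ℝ :=
  open Classical in
  ∫ L : Del d r R, (if h : (0 : E d) ∈ L.1 then
    (inner ℂ (e (⟨0, h⟩ : L.1)) ((absOp (rep B g L) ^ p) (e (⟨0, h⟩ : L.1)))).re else 0)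
    ∂(transverseMeasure μ)

/-- The Sobolev norm `‖g‖_{m,p} = ∑_{|α| ≤ m} 𝒯(|∂^α g|^p)^{1/p}`. -/
def sobNorm (B : Matrix (Fin d) (Fin d) ℝ) (μ : Measure (Del d r R)) (m p : ℕ)
    (g : Gpd L₀ → ℂ) : ℝ :=
  ∑ α ∈ (Fintype.piFinset fun _ : Fin d => Finset.range (m + 1)).filter (fun α => ∑ j, α j ≤ m),
    trPow B μ p (monomialDeriv α g) ^ (1 / (p : ℝ))

/-- The GNS space `L²(𝒢,𝒯)`: since `𝒯(f* ∗ f) = ∫ |f|²` over the groupoid, it is the `L²` space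
of the groupoid measure, with `C_c(𝒢)` as a dense subspace. -/
abbrev GNS (L₀ : Del d r R) (μ : Measure (Del d r R)) : Type := Lp ℂ 2 (gpdMeasure L₀ μ)

/-- The operators `π_GNS(f)`, `f ∈ C_c(𝒢)`, of left convolution on `L²(𝒢,𝒯)`. -/
def gnsImage (L₀ : Del d r R) (B : Matrix (Fin d) (Fin d) ℝ) (μ : Measure (Del d r R)) :
    Set (GNS L₀ μ →WOT[ℂ] GNS L₀ μ) :=
  {T | ∃ f : C_c(Gpd L₀, ℂ), ∀ (g : C_c(Gpd L₀, ℂ)) (ξ : GNS L₀ μ),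
    ξ =ᵐ[gpdMeasure L₀ μ] g → T ξ =ᵐ[gpdMeasure L₀ μ] conv B f g}

/-- The von Neumann algebra `L^∞(𝒢,𝒯)`: the weak closure of the GNS representation. -/
def vonNeumann (L₀ : Del d r R) (B : Matrix (Fin d) (Fin d) ℝ) (μ : Measure (Del d r R)) :
    Set (GNS L₀ μ →WOT[ℂ] GNS L₀ μ) :=
  closure (gnsImage L₀ B μ)

/-- The function `f` represents an element of `L^∞(𝒢,𝒯)`, namely the `T` with `T 1 = f`. -/
def IsLinfty (B : Matrix (Fin d) (Fin d) ℝ) (μ : Measure (Del d r R)) (f : Gpd L₀ → ℂ) : Prop :=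
  ∃ T ∈ vonNeumann L₀ B μ, ∃ η : GNS L₀ μ,
    η =ᵐ[gpdMeasure L₀ μ] unitFun L₀ ∧ T η =ᵐ[gpdMeasure L₀ μ] f

/-- The function `f` represents an element of the Sobolev algebra: it lies in `L^∞(𝒢,𝒯)` and in
the completion of `C_c(𝒢)` for the norms `‖·‖_{m,p}`, `m ∈ ℕ`, `p ∈ ℕ₊`. The completion is
realised inside `L²(𝒢,𝒯)`, whose norm is `‖·‖_{0,2}`. -/
def IsSobolev (B : Matrix (Fin d) (Fin d) ℝ) (μ : Measure (Del d r R)) (f : Gpd L₀ → ℂ) : Prop :=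
  IsLinfty B μ f ∧
    ∃ F : ℕ → C_c(Gpd L₀, ℂ),
      (∀ m p : ℕ, 1 ≤ p → ∀ ε > 0, ∃ N, ∀ i ≥ N, ∀ j ≥ N,
        sobNorm B μ m p (fun γ => F i γ - F j γ) < ε) ∧
      Tendsto (fun n => eLpNorm (fun γ => F n γ - f γ) 2 (gpdMeasure L₀ μ)) atTop (𝓝 0)

end Sobolev

end Aperiodic

end

noncomputable section

namespace Aperiodic

/-! ### Topology of the space of Delone sets -/

namespace Del

variable {d : ℕ} {r R : ℝ}

/-! The magnetic phase is trivial on the diagonal, so the diagonal entry of `π_L(f)` at `x` is `f(L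
- x, 0)`. The trace over a region is therefore the sum of one function on the transversal over the
points of `L` in that region, and its density is an ergodic average.

Boundedness of `π_L(f)` has to be extracted from an operator `T` that is only a weak limit of left
convolutions. Matrix elements of `T` between functions `χ(x) ψ(L - x)` are pairings of the symbol `T
1` with a fixed square integrable function (`inner_vonNeumann`). Left convolution commutes with
multiplication by functions of the source `L - x`, and inversion preserves the measure by the mass
transport principle (`lintegral_transverse_inv`). The bound of `⟨u, T v⟩` by `‖T‖` thus becomes an
integral inequality with weight `ψ(L)²`. As `ψ` is arbitrary, it holds for almost every `L`
(`ae_re_fibreSum_le`), where it bounds the form of `π_L(f)`. A countable family of test functions,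
dense enough on every pattern, leaves a single null set (`IsLinfty.exists_isFormBound`). In
particular `|f(L, 0)| ≤ ‖T‖` almost surely.

It remains to average bounded functions. On the hull, a function of mean zero is an `L²` limit of
coboundaries, whose averages over dilated convex bodies vanish by a boundary estimate. A maximal
inequality, obtained from Vitali's covering lemma by transference, and Borel-Cantelli give
convergence along almost every orbit for all convex bodies at once (`ae_avgTendsto`). Sums over
points become volume integrals by smoothing over balls of radius `r`, and Campbell's formula
identifies the mean as an integral against `𝐏` (`ae_tendsto_tsum`).

The residue follows by Abel summation: the growth of the sums over balls determines the behaviour of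
`∑ a(x) (1+|x|²)^(-s/2)` at `s = d` (`hasResidueAt_tsum`), and `Vol(S^{d-1}) = d Vol(B)` fixes the
constant. -/

lemma nonempty (L : Del d r R) : L.1.Nonempty := by
  obtain ⟨y, -, hy⟩ := L.2.2 0
  exact ⟨y, hy⟩

/-- Closer points would share the ball of radius `r` about their midpoint. -/
lemma two_mul_le_dist (L : Del d r R) {x y : E d} (hx : x ∈ L.1) (hy : y ∈ L.1) (hxy : x ≠ y) :
    2 * r ≤ dist x y := by
  by_contra! h
  have hmid : ∀ z ∈ ({x, y} : Set (E d)), z ∈ Metric.ball (midpoint ℝ x y) r ∩ L.1 := by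
    rintro z (rfl | rfl)
    · refine ⟨?_, hx⟩
      rw [Metric.mem_ball, dist_left_midpoint (𝕜 := ℝ)]
      norm_num
      linarith
    · refine ⟨?_, hy⟩
      rw [Metric.mem_ball, dist_right_midpoint (𝕜 := ℝ)]
      norm_num
      linarith
  have := Set.encard_le_one_iff.1 (L.2.1 (midpoint ℝ x y)) x y (hmid x (by simp)) (hmid y (by simp))
  exact hxy this

lemma mem_shift {a x : E d} {L : Del d r R} : x ∈ (L.shift a).1 ↔ x + a ∈ L.1 := Iff.rfl

lemma shift_shift (a b : E d) (L : Del d r R) : (L.shift a).shift b = L.shift (a + b) := by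
  apply Subtype.ext
  ext x
  change x + b + a ∈ L.1 ↔ x + (a + b) ∈ L.1
  rw [add_assoc, add_comm b a]

lemma shift_zero (L : Del d r R) : L.shift 0 = L := by
  apply Subtype.ext
  ext x
  change x + 0 ∈ L.1 ↔ x ∈ L.1
  rw [add_zero]

/-- A ball of radius at most `r` contains at most one point of the pattern. -/
lemma eq_of_mem_ball (L : Del d r R) {c x y : E d} (hx : x ∈ L.1) (hy : y ∈ L.1)
    (hxc : dist x c < r) (hyc : dist y c < r) : x = y := by
  by_contra h
  have := L.two_mul_le_dist hx hy h
  have := dist_triangle_right x y c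
  linarith

lemma infDist_lt_iff (L : Del d r R) (x : E d) (c : ℝ) :
    Metric.infDist x L.1 < c ↔ (L.1 ∩ Metric.ball x c).Nonempty := by
  rw [Metric.infDist_lt_iff L.nonempty]
  constructor
  · rintro ⟨y, hy, h⟩
    exact ⟨y, hy, by rwa [Metric.mem_ball, dist_comm]⟩
  · rintro ⟨y, hy, h⟩
    exact ⟨y, hy, by rwa [Metric.mem_ball, dist_comm] at h⟩

lemma isOpen_inter_nonempty {U : Set (E d)} (hU : IsOpen U) :
    IsOpen {L : Del d r R | (L.1 ∩ U).Nonempty} := by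
  rintro L ⟨x, hx, hxU⟩
  obtain ⟨ε, hε, hεU⟩ := Metric.isOpen_iff.1 hU x hxU
  refine ⟨‖x‖ + 1, by positivity, ε, hε, fun L' h => ?_⟩
  have := h.1 ⟨hx, by simp⟩
  obtain ⟨y, hy, hxy⟩ := Metric.mem_thickening_iff.1 this
  exact ⟨y, hy, hεU (by rwa [Metric.mem_ball, dist_comm])⟩

lemma isOpen_lt_infDist (x : E d) (c : ℝ) : IsOpen {L : Del d r R | c < Metric.infDist x L.1} := by
  intro L hL
  simp only [mem_ofPred_eq] at hL
  set δ := Metric.infDist x L.1 - c with hδ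
  have hδ0 : 0 < δ := by linarith
  -- A point of `L'` within `c + δ / 2` of `x` lies in the ball of this radius, where a point of `L`
  -- shadows it up to `δ / 2`; the latter would be closer to `x` than `c + δ`.
  refine ⟨‖x‖ + |c| + δ, by positivity, δ / 2, by positivity, fun L' h => ?_⟩
  have hle : c + δ / 2 ≤ Metric.infDist x L'.1 := by
    by_contra! hlt
    obtain ⟨y, hy, hxy⟩ := (infDist_lt_iff L' x _).1 hlt
    rw [Metric.mem_ball] at hxy
    have hyM : y ∈ Metric.ball (0 : E d) (‖x‖ + |c| + δ) := by
      rw [mem_ball_zero_iff]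
      have := norm_le_norm_add_norm_sub' y x
      rw [dist_eq_norm] at hxy
      have := le_abs_self c
      linarith
    obtain ⟨z, hz, hyz⟩ := Metric.mem_thickening_iff.1 (h.2 ⟨hy, hyM⟩)
    have h1 := Metric.infDist_le_dist_of_mem (x := x) hz
    have := dist_triangle x y z
    rw [dist_comm x y] at this
    linarith
  simp only [mem_ofPred_eq]
  linarith

/-- Lower semicontinuity is openness of keeping away from `x`, upper semicontinuity is openness of
meeting a ball about `x`. These functions serve as coordinates on the space of patterns. -/
lemma continuous_infDist (x : E d) : Continuous fun L : Del d r R => Metric.infDist x L.1 := by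
  rw [continuous_iff_lower_upperSemicontinuous]
  constructor
  · rw [lowerSemicontinuous_iff_isOpen_preimage]
    exact fun c => isOpen_lt_infDist x c
  · rw [upperSemicontinuous_iff_isOpen_preimage]
    intro c
    have : (fun L : Del d r R => Metric.infDist x L.1) ⁻¹' Iio c
        = {L | (L.1 ∩ Metric.ball x c).Nonempty} := by
      ext L
      exact infDist_lt_iff L x c
    rw [this]
    exact isOpen_inter_nonempty Metric.isOpen_ball

variable [hr : Fact (0 < r)]

lemma isClosed (L : Del d r R) : IsClosed L.1 := by
  refine Metric.isClosed_of_pairwise_le_dist (ε := 2 * r) (by linarith [hr.out]) ?_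
  intro x hx y hy h
  exact L.two_mul_le_dist hx hy h

lemma mem_iff_infDist (L : Del d r R) (x : E d) : x ∈ L.1 ↔ Metric.infDist x L.1 = 0 :=
  L.isClosed.mem_iff_infDist_zero L.nonempty

omit hr in
lemma pairwise_disjoint_ball (L : Del d r R) :
    L.1.PairwiseDisjoint fun x => Metric.ball x r := by
  intro x hx y hy hxy
  exact Metric.ball_disjoint_ball (by linarith [L.two_mul_le_dist hx hy hxy])

lemma finite_inter (L : Del d r R) {S : Set (E d)} (hS : Bornology.IsBounded S) :
    (L.1 ∩ S).Finite := by
  have hc : IsCompact (closure S) := hS.isCompact_closure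
  have hd : (L.1 ∩ closure S).Finite := by
    have hcc : IsCompact (L.1 ∩ closure S) := hc.inter_left L.isClosed
    refine hcc.finite ?_
    rw [isDiscrete_iff_forall_mem_exists_isOpen]
    intro x hx
    refine ⟨Metric.ball x r, Metric.isOpen_ball, ?_⟩
    ext y
    constructor
    · rintro ⟨hy1, hy2⟩
      exact L.eq_of_mem_ball hy2.1 hx.1 hy1 (by simpa using hr.out)
    · rintro rfl
      exact ⟨Metric.mem_ball_self hr.out, hx⟩
  exact hd.subset (inter_subset_inter_right _ subset_closure)

/-- The limit of an ultrafilter consists of the points all of whose neighbourhoods meet almost every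
pattern. Two such points are approximated within one pattern, which gives discreteness; relative
density passes to the limit because closed balls are compact. -/
instance : CompactSpace (Del d r R) := by
  rw [← isCompact_univ_iff, isCompact_iff_ultrafilter_le_nhds]
  intro 𝒰 _
  set S : Set (E d) := {x | ∀ ε > 0, ∀ᶠ L' : Del d r R in 𝒰, (L'.1 ∩ Metric.ball x ε).Nonempty}
    with hS
  -- A choice of one point in each pattern, confined to a compact set, converges along the
  -- ultrafilter, and its limit belongs to `S`.
  have key : ∀ (p : Del d r R → E d) (C : Set (E d)), IsCompact C →
      (∀ᶠ L' in (𝒰 : Filter (Del d r R)), p L' ∈ L'.1 ∧ p L' ∈ C) →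
      ∃ y ∈ C, y ∈ S ∧ Tendsto p 𝒰 (𝓝 y) := by
    intro p C hC hp
    obtain ⟨y, hyC, hy⟩ := hC.ultrafilter_le_nhds (𝒰.map p) (by
      rw [Filter.le_principal_iff]
      exact hp.mono fun _ h => h.2)
    refine ⟨y, hyC, fun ε hε => ?_, hy⟩
    have : Tendsto p 𝒰 (𝓝 y) := hy
    filter_upwards [hp, this (Metric.ball_mem_nhds y hε)] with L' h1 h2
    exact ⟨p L', h1.1, h2⟩
  have hDel : IsDelone r R S := by
    constructor
    · intro x
      rw [Set.encard_le_one_iff]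
      rintro p q ⟨hpx, hp⟩ ⟨hqx, hq⟩
      by_contra hpq
      rw [Metric.mem_ball] at hpx hqx
      set ε := min (dist p q / 2) (min (r - dist p x) (r - dist q x)) with hε
      have hε0 : 0 < ε := by
        refine lt_min (by have := dist_pos.2 hpq; positivity) (lt_min ?_ ?_) <;> linarith
      obtain ⟨L', ⟨p', hp', hpp⟩, ⟨q', hq', hqq⟩⟩ := ((hp ε hε0).and (hq ε hε0)).exists
      rw [Metric.mem_ball] at hpp hqq
      have e1 : ε ≤ dist p q / 2 := min_le_left _ _
      have e2 : ε ≤ r - dist p x := (min_le_right _ _).trans (min_le_left _ _)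
      have e3 : ε ≤ r - dist q x := (min_le_right _ _).trans (min_le_right _ _)
      have : p' = q' := by
        refine L'.eq_of_mem_ball (c := x) hp' hq' ?_ ?_
        · have := dist_triangle p' p x; linarith
        · have := dist_triangle q' q x; linarith
      subst this
      have := dist_triangle_left p q p'
      linarith
    · intro x
      choose p hp using fun L' : Del d r R => L'.2.2 x
      obtain ⟨y, hy, hyS, -⟩ := key p _ (isCompact_closedBall x R)
        (Eventually.of_forall fun L' => ⟨(hp L').2, (hp L').1⟩)
      exact ⟨y, hy, hyS⟩
  refine ⟨⟨S, hDel⟩, mem_univ _, ?_⟩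
  set L : Del d r R := ⟨S, hDel⟩
  rw [le_nhds_iff]
  intro T hLT hT
  obtain ⟨M, hM, ε, hε, h⟩ := hT L hLT
  suffices ∀ᶠ L' in (𝒰 : Filter (Del d r R)), LocallyClose M ε L L' from
    this.mono h
  refine Filter.Eventually.and ?_ ?_
  · have hfin := L.finite_inter (Metric.isBounded_ball (x := (0 : E d)) (r := M))
    have := (Filter.eventually_all_finite hfin (l := (𝒰 : Filter (Del d r R)))
      (p := fun x L' => (L'.1 ∩ Metric.ball x ε).Nonempty)).2 fun x hx => hx.1 ε hε
    filter_upwards [this] with L' hL' x hx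
    obtain ⟨y, hy, hyx⟩ := hL' x hx
    exact Metric.mem_thickening_iff.2 ⟨y, hy, by rwa [dist_comm]⟩
  -- Otherwise almost every pattern has a point in the ball of radius `M` at distance at least `ε`
  -- from `S`, while these points converge to a point of `S`.
  · by_contra hcon
    rw [Ultrafilter.eventually_not.symm] at hcon
    have hex : ∀ L' : Del d r R, ∃ p : E d,
        ¬ L'.1 ∩ Metric.ball 0 M ⊆ Metric.thickening ε L.1 →
          (p ∈ L'.1 ∩ Metric.ball 0 M ∧ p ∉ Metric.thickening ε L.1) := by
      intro L'
      by_cases hc : L'.1 ∩ Metric.ball 0 M ⊆ Metric.thickening ε L.1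
      · exact ⟨0, fun h => absurd hc h⟩
      · obtain ⟨p, hp, hp'⟩ := Set.not_subset.1 hc
        exact ⟨p, fun _ => ⟨hp, hp'⟩⟩
    choose p hp using hex
    obtain ⟨y, -, hyS, hy⟩ := key p _ (isCompact_closedBall 0 M) (hcon.mono fun L' hL' =>
      ⟨(hp L' hL').1.1, Metric.ball_subset_closedBall (hp L' hL').1.2⟩)
    obtain ⟨L', h1, h2⟩ := (hcon.and (hy (Metric.ball_mem_nhds y hε))).exists
    exact (hp L' h1).2 (Metric.mem_thickening_iff.2 ⟨y, hyS, h2⟩)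

lemma injective_infDist : Function.Injective fun (L : Del d r R) (n : ℕ) =>
    Metric.infDist (TopologicalSpace.denseSeq (E d) n) L.1 := by
  intro L L' h
  have heq : (fun x => Metric.infDist x L.1) = fun x => Metric.infDist x L'.1 := by
    refine Continuous.ext_on (TopologicalSpace.denseRange_denseSeq (E d))
      (Metric.continuous_infDist_pt _) (Metric.continuous_infDist_pt _) ?_
    rintro _ ⟨n, rfl⟩
    exact congrFun h n
  apply Subtype.ext
  ext x
  rw [mem_iff_infDist, mem_iff_infDist]
  exact Eq.congr_left (congrFun heq x)

/-- A continuous injection from a compact space to a Hausdorff space. The target is a countable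
product of lines, whence metrizability and second countability. -/
lemma isClosedEmbedding_infDist : IsClosedEmbedding fun (L : Del d r R) (n : ℕ) =>
    Metric.infDist (TopologicalSpace.denseSeq (E d) n) L.1 :=
  Continuous.isClosedEmbedding (continuous_pi fun _ => continuous_infDist _) injective_infDist

instance : TopologicalSpace.MetrizableSpace (Del d r R) :=
  isClosedEmbedding_infDist.isEmbedding.metrizableSpace

instance : SecondCountableTopology (Del d r R) :=
  isClosedEmbedding_infDist.isEmbedding.secondCountableTopology

omit hr in
lemma continuous_infDist_prod : Continuous fun p : Del d r R × E d => Metric.infDist p.2 p.1.1 :=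
  continuous_prod_of_continuous_lipschitzWith'
    (fun p : Del d r R × E d => Metric.infDist p.2 p.1.1) 1
    (fun L => Metric.lipschitz_infDist_pt L.1) (fun x => continuous_infDist x)

omit hr in
lemma infDist_shift (a x : E d) (L : Del d r R) :
    Metric.infDist x (L.shift a).1 = Metric.infDist (x + a) L.1 := by
  have : (fun y => y + a) '' (L.shift a).1 = L.1 := by
    ext y
    constructor
    · rintro ⟨z, hz, rfl⟩
      exact hz
    · intro hy
      exact ⟨y - a, by rw [mem_shift, sub_add_cancel]; exact hy, by simp⟩
  conv_rhs => rw [← this]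
  exact (Metric.infDist_image (Isometry.of_dist_eq fun x y => by simp)).symm

/-- In distance coordinates, translating the pattern amounts to moving the test point. -/
lemma continuous_shift : Continuous fun p : Del d r R × E d => p.1.shift p.2 := by
  rw [isClosedEmbedding_infDist.isEmbedding.continuous_iff]
  refine continuous_pi fun n => ?_
  have h : Continuous fun p : Del d r R × E d =>
      (p.1, TopologicalSpace.denseSeq (E d) n + p.2) := by fun_prop
  have h' := continuous_infDist_prod.comp h
  refine h'.congr fun p => ?_
  exact (infDist_shift _ _ _).symm

lemma isClosed_mem : IsClosed {p : Del d r R × E d | p.2 ∈ p.1.1} := by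
  simp_rw [mem_iff_infDist]
  exact isClosed_eq continuous_infDist_prod continuous_const

end Del

/-! ### The transversal and the groupoid as closed sets -/

variable {d : ℕ} {r R : ℝ} [hr : Fact (0 < r)]

lemma isClosed_transversal (L₀ : Del d r R) : IsClosed (transversal L₀) :=
  isClosed_closure.inter (Del.isClosed_mem.preimage (Continuous.prodMk_left (0 : E d)))

lemma shift_mem_hull {L₀ L : Del d r R} (hL : L ∈ hull L₀) (a : E d) : L.shift a ∈ hull L₀ := by
  have hc : Continuous fun L : Del d r R => L.shift a :=
    Del.continuous_shift.comp (Continuous.prodMk_left a)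
  refine map_mem_closure hc hL ?_
  rintro _ ⟨b, rfl⟩
  exact ⟨b + a, (Del.shift_shift b a L₀).symm⟩

lemma shift_mem_transversal {L₀ L : Del d r R} (hL : L ∈ hull L₀) {x : E d} (hx : x ∈ L.1) :
    L.shift x ∈ transversal L₀ :=
  ⟨shift_mem_hull hL x, by rw [Del.mem_shift, zero_add]; exact hx⟩

lemma isClosed_gpd (L₀ : Del d r R) :
    IsClosed {γ : Del d r R × E d | γ.1 ∈ transversal L₀ ∧ γ.2 ∈ γ.1.1} :=
  ((isClosed_transversal L₀).preimage continuous_fst).inter Del.isClosed_mem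

end Aperiodic
end

noncomputable section

namespace Aperiodic

open ProbabilityTheory

/-! ### The counting measure of a Delone set as a kernel -/

variable {d : ℕ} {r R : ℝ}

/-- The counting measure `∑_{x ∈ L} δ_x`. -/
def ptsMeasure (L : Del d r R) : Measure (E d) := Measure.sum fun x : L.1 => Measure.dirac x.1

lemma lintegral_ptsMeasure (L : Del d r R) (f : E d → ℝ≥0∞) :
    ∫⁻ x, f x ∂(ptsMeasure L) = ∑' x : L.1, f x := by
  rw [ptsMeasure, lintegral_sum_measure]
  simp

lemma ptsMeasure_apply (L : Del d r R) {A : Set (E d)} (hA : MeasurableSet A) :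
    ptsMeasure L A = ∑' x : L.1, A.indicator 1 x.1 := by
  rw [← lintegral_indicator_one hA, lintegral_ptsMeasure]

lemma lintegral_ptsMeasure_shift (L : Del d r R) (a : E d) (f : E d → ℝ≥0∞) :
    ∫⁻ x, f x ∂(ptsMeasure (L.shift a)) = ∫⁻ x, f (x - a) ∂(ptsMeasure L) := by
  rw [lintegral_ptsMeasure, lintegral_ptsMeasure]
  let φ : (L.shift a).1 ≃ L.1 :=
    { toFun := fun x => ⟨x.1 + a, x.2⟩
      invFun := fun x => ⟨x.1 - a, by rw [Del.mem_shift, sub_add_cancel]; exact x.2⟩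
      left_inv := fun x => by simp
      right_inv := fun x => by simp }
  rw [← φ.tsum_eq]
  simp [φ]

variable [hr : Fact (0 < r)]

lemma Del.countable (L : Del d r R) : L.1.Countable :=
  L.pairwise_disjoint_ball.countable_of_isOpen (fun _ _ => Metric.isOpen_ball)
    fun _ _ => ⟨_, Metric.mem_ball_self hr.out⟩

instance (L : Del d r R) : Countable L.1 := L.countable

lemma ae_ptsMeasure_iff (L : Del d r R) {p : E d → Prop} :
    (∀ᵐ x ∂(ptsMeasure L), p x) ↔ ∀ x ∈ L.1, p x := by
  rw [ptsMeasure, Measure.ae_sum_iff]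
  simp [ae_dirac_eq]

/-- A packing bound: the disjoint balls of radius `r` about the points in `S` lie in the thickening.
-/
lemma ptsMeasure_mul_le (L : Del d r R) {S : Set (E d)} (hS : MeasurableSet S) :
    ptsMeasure L S * volume (Metric.ball (0 : E d) r) ≤ volume (Metric.thickening r S) := by
  classical
  rw [ptsMeasure_apply L hS, ← ENNReal.tsum_mul_right]
  calc ∑' x : L.1, S.indicator 1 x.1 * volume (Metric.ball (0 : E d) r)
      = ∑' x : L.1, volume (if x.1 ∈ S then Metric.ball x.1 r else ∅) := by
        refine tsum_congr fun x => ?_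
        by_cases h : x.1 ∈ S
        · simp [h, Measure.addHaar_ball_center]
        · simp [h]
    _ = volume (⋃ x : L.1, if x.1 ∈ S then Metric.ball x.1 r else ∅) := by
        rw [measure_iUnion]
        · intro x y hxy
          simp only [Function.onFun]
          split_ifs with h1 h2
          · exact L.pairwise_disjoint_ball x.2 y.2 (fun h => hxy (Subtype.ext h))
          all_goals simp
        · intro x
          split_ifs
          · exact measurableSet_ball
          · exact MeasurableSet.empty
    _ ≤ _ := by
        refine measure_mono (iUnion_subset fun x => ?_)
        split_ifs with h
        · exact Metric.ball_subset_thickening h r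
        · simp

lemma ptsMeasure_le (L : Del d r R) {S : Set (E d)} (hS : MeasurableSet S) :
    ptsMeasure L S ≤ volume (Metric.thickening r S) / volume (Metric.ball (0 : E d) r) :=
  (ENNReal.le_div_iff_mul_le (Or.inl (Metric.measure_ball_pos _ _ hr.out).ne')
    (Or.inl measure_ball_lt_top.ne)).2 (ptsMeasure_mul_le L hS)

omit hr in
-- A ball of radius `r` holds at most one point, so counting there reduces to hitting, an open
-- condition on `L` when `V` is open. Measurability of the counting measures in `L` rests on this.
lemma ptsMeasure_inter_ball (V : Set (E d)) (hV : MeasurableSet V) (c : E d) (L : Del d r R) :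
    ptsMeasure L (V ∩ Metric.ball c r)
      = {L : Del d r R | (L.1 ∩ (V ∩ Metric.ball c r)).Nonempty}.indicator 1 L := by
  rw [ptsMeasure_apply L (hV.inter measurableSet_ball)]
  by_cases h : (L.1 ∩ (V ∩ Metric.ball c r)).Nonempty
  · rw [indicator_of_mem (by exact h)]
    obtain ⟨x, hxL, hxV, hxc⟩ := h
    rw [tsum_eq_single ⟨x, hxL⟩]
    · simp [hxV, Metric.mem_ball.1 hxc]
    · intro y hy
      refine indicator_of_notMem (fun hyV => hy (Subtype.ext ?_)) _
      exact L.eq_of_mem_ball y.2 hxL hyV.2 hxc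
  · rw [indicator_of_notMem (by exact h)]
    refine ENNReal.tsum_eq_zero.2 fun y => indicator_of_notMem (fun hy => h ⟨y, y.2, hy⟩) _

omit hr in
lemma measurable_ptsMeasure_restrict (c : E d) :
    Measurable fun L : Del d r R => (ptsMeasure L).restrict (Metric.ball c r) := by
  have h1 : ∀ V : Set (E d), IsOpen V →
      Measurable fun L : Del d r R => (ptsMeasure L).restrict (Metric.ball c r) V := by
    intro V hV
    simp_rw [Measure.restrict_apply hV.measurableSet, ptsMeasure_inter_ball V hV.measurableSet c]
    exact measurable_one.indicator
      (Del.isOpen_inter_nonempty (hV.inter Metric.isOpen_ball)).measurableSet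
  have hfin : ∀ L : Del d r R, IsFiniteMeasure ((ptsMeasure L).restrict (Metric.ball c r)) := by
    refine fun L => ⟨?_⟩
    rw [Measure.restrict_apply_univ]
    have := ptsMeasure_inter_ball univ MeasurableSet.univ c L
    rw [univ_inter] at this
    rw [this]
    exact (indicator_le_self' (by simp) L).trans_lt ENNReal.one_lt_top
  refine Measurable.measure_of_isPiSystem (S := {V | IsOpen V}) ?_ isPiSystem_isOpen h1
    (h1 univ isOpen_univ)
  exact BorelSpace.measurable_eq

/-- A disjoint measurable cover of space by pieces of balls of radius `r`. -/
def cell (d : ℕ) (r : ℝ) (n : ℕ) : Set (E d) :=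
  disjointed (fun n => Metric.ball (TopologicalSpace.denseSeq (E d) n) r) n

omit hr in
lemma measurableSet_cell (n : ℕ) : MeasurableSet (cell d r n) :=
  MeasurableSet.disjointed (fun _ => measurableSet_ball) n

lemma iUnion_cell : ⋃ n, cell d r n = univ := by
  rw [show (⋃ n, cell d r n) = _ from iUnion_disjointed, eq_univ_iff_forall]
  intro x
  obtain ⟨n, hn⟩ := (TopologicalSpace.denseRange_denseSeq (E d)).exists_dist_lt x hr.out
  exact mem_iUnion.2 ⟨n, by simpa using hn⟩

omit hr in
lemma restrict_cell (L : Del d r R) (n : ℕ) : (ptsMeasure L).restrict (cell d r n)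
    = ((ptsMeasure L).restrict (Metric.ball (TopologicalSpace.denseSeq (E d) n) r)).restrict
      (cell d r n) := by
  rw [Measure.restrict_restrict (measurableSet_cell n),
    inter_eq_self_of_subset_left (show cell d r n ⊆ _ from disjointed_subset _ _)]

lemma sum_restrict_cell (L : Del d r R) :
    Measure.sum (fun n => (ptsMeasure L).restrict (cell d r n)) = ptsMeasure L := by
  have h : Pairwise (Function.onFun Disjoint (cell d r)) := disjoint_disjointed _
  rw [← Measure.restrict_iUnion h measurableSet_cell, iUnion_cell, Measure.restrict_univ]

/-- The counting measure of the part of a pattern in one cell. -/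
def ptsCell (d : ℕ) (r R : ℝ) (n : ℕ) : Kernel (Del d r R) (E d) where
  toFun L := (ptsMeasure L).restrict (cell d r n)
  measurable' := by
    refine Measure.measurable_of_measurable_coe _ fun A hA => ?_
    simp_rw [restrict_cell, Measure.restrict_apply hA]
    exact Measure.measurable_coe (hA.inter (measurableSet_cell n)) |>.comp
      (measurable_ptsMeasure_restrict _)

instance (n : ℕ) : IsFiniteKernel (ptsCell d r R n) := by
  refine ⟨1, ENNReal.one_lt_top, fun L => ?_⟩
  change (ptsMeasure L).restrict (cell d r n) univ ≤ 1
  rw [Measure.restrict_apply_univ]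
  refine (measure_mono (disjointed_subset _ _)).trans ?_
  have := ptsMeasure_inter_ball univ MeasurableSet.univ (TopologicalSpace.denseSeq (E d) n) L
  rw [univ_inter] at this
  rw [this]
  exact indicator_le_self' (by simp) L

/-- The counting measures `∑_{x ∈ L} δ_x` as a kernel. -/
def pts (d : ℕ) (r R : ℝ) [Fact (0 < r)] : Kernel (Del d r R) (E d) := Kernel.sum (ptsCell d r R)

lemma pts_apply (L : Del d r R) : pts d r R L = ptsMeasure L := by
  rw [pts, Kernel.sum_apply]
  exact sum_restrict_cell L

instance : IsSFiniteKernel (pts d r R) := Kernel.isSFiniteKernel_sum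

instance (L : Del d r R) : SFinite (ptsMeasure L) := by
  rw [← pts_apply]
  infer_instance

lemma measurable_lintegral_pts {f : Del d r R × E d → ℝ≥0∞} (hf : Measurable f) :
    Measurable fun L => ∫⁻ x, f (L, x) ∂(ptsMeasure L) := by
  simp_rw [← pts_apply]
  exact hf.lintegral_kernel_prod_right'

lemma measurable_lintegral_pts_param {γ : Type*} [MeasurableSpace γ]
    {f : (Del d r R × γ) × E d → ℝ≥0∞} (hf : Measurable f) :
    Measurable fun p : Del d r R × γ => ∫⁻ x, f (p, x) ∂(ptsMeasure p.1) := by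
  have := hf.lintegral_kernel_prod_right' (κ := (pts d r R).comap Prod.fst measurable_fst)
  simpa only [Kernel.comap_apply, pts_apply] using this

lemma measurable_shift : Measurable fun p : Del d r R × E d => p.1.shift p.2 :=
  Del.continuous_shift.measurable

/-! ### The transverse measure -/

/-- The half-open unit cube. -/
def unitCube (d : ℕ) : Set (E d) := {x | ∀ i, x i ∈ Set.Ico (0 : ℝ) 1}

lemma measurableSet_unitCube : MeasurableSet (unitCube d) := by
  rw [unitCube, ofPred_forall]
  exact MeasurableSet.iInter fun i => measurableSet_Ico.preimage (by fun_prop)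

lemma volume_unitCube : volume (unitCube d) = 1 := by
  have h := (EuclideanSpace.volume_preserving_symm_measurableEquiv_toLp (Fin d)).measure_preimage
    (MeasurableSet.univ_pi fun _ : Fin d =>
      (measurableSet_Ico (a := (0 : ℝ)) (b := 1))).nullMeasurableSet
  rw [Real.volume_pi_Ico] at h
  simp only [sub_zero, ENNReal.ofReal_one, Finset.prod_const_one] at h
  rw [← h]
  congr 1
  ext x
  simp [unitCube]

lemma isBounded_unitCube : Bornology.IsBounded (unitCube d) := by
  rw [isBounded_iff_forall_norm_le]
  refine ⟨√(∑ _ : Fin d, 1), fun x hx => ?_⟩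
  rw [EuclideanSpace.norm_eq]
  refine Real.sqrt_le_sqrt (Finset.sum_le_sum fun i _ => ?_)
  have := hx i
  rw [Real.norm_eq_abs, sq_abs]
  nlinarith [this.1, this.2]

lemma ptsMeasure_unitCube_le (L : Del d r R) : ptsMeasure L (unitCube d)
    ≤ volume (Metric.thickening r (unitCube d)) / volume (Metric.ball (0 : E d) r) :=
  ptsMeasure_le L measurableSet_unitCube

omit hr in
lemma lintegral_transverse_kernel (L : Del d r R) (F : Del d r R → ℝ≥0∞) (hF : Measurable F) :
    ∫⁻ L', F L' ∂(Measure.sum fun x : {x : E d // x ∈ L.1 ∧ ∀ i, x i ∈ Set.Ico (0 : ℝ) 1} =>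
      Measure.dirac (L.shift x.1))
      = ∫⁻ x, (unitCube d).indicator 1 x * F (L.shift x) ∂(ptsMeasure L) := by
  rw [lintegral_sum_measure, lintegral_ptsMeasure]
  simp_rw [lintegral_dirac' _ hF]
  have hinj : Function.Injective
      fun x : {x : E d // x ∈ L.1 ∧ ∀ i, x i ∈ Set.Ico (0 : ℝ) 1} => (⟨x.1, x.2.1⟩ : L.1) := by
    intro x y h
    exact Subtype.ext (by simpa using h)
  rw [← hinj.tsum_eq]
  · refine tsum_congr fun x => ?_
    have : x.1 ∈ unitCube d := x.2.2
    simp [this]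
  · intro x hx
    have : x.1 ∈ unitCube d := by
      by_contra h
      simp [h] at hx
    exact ⟨⟨x.1, x.2, this⟩, rfl⟩

lemma measurable_transverse_kernel : Measurable fun L : Del d r R =>
    Measure.sum fun x : {x : E d // x ∈ L.1 ∧ ∀ i, x i ∈ Set.Ico (0 : ℝ) 1} =>
      Measure.dirac (L.shift x.1) := by
  refine Measure.measurable_of_measurable_coe _ fun A hA => ?_
  have hA1 : Measurable (A.indicator (1 : Del d r R → ℝ≥0∞)) := measurable_one.indicator hA
  simp_rw [← lintegral_indicator_one hA, lintegral_transverse_kernel _ _ hA1]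
  refine measurable_lintegral_pts (f := fun p : Del d r R × E d => (unitCube d).indicator 1 p.2 *
    A.indicator 1 (p.1.shift p.2)) ?_
  exact ((measurable_one.indicator measurableSet_unitCube).fun_comp measurable_snd).mul
    (hA1.fun_comp measurable_shift)

variable {μ : Measure (Del d r R)}

lemma lintegral_transverse (F : Del d r R → ℝ≥0∞) (hF : Measurable F) :
    ∫⁻ L, F L ∂(transverseMeasure μ)
      = ∫⁻ L, ∫⁻ x, (unitCube d).indicator 1 x * F (L.shift x) ∂(ptsMeasure L) ∂μ := by
  rw [transverseMeasure, Measure.lintegral_bind measurable_transverse_kernel.aemeasurable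
    hF.aemeasurable]
  simp_rw [lintegral_transverse_kernel _ F hF]

instance [IsFiniteMeasure μ] : IsFiniteMeasure (transverseMeasure μ) := by
  refine ⟨?_⟩
  rw [← lintegral_one, lintegral_transverse _ measurable_const]
  simp_rw [mul_one, lintegral_indicator_one measurableSet_unitCube]
  refine (lintegral_mono fun L => ptsMeasure_unitCube_le L).trans_lt ?_
  rw [lintegral_const]
  refine ENNReal.mul_lt_top (ENNReal.div_lt_top ?_ ?_) (measure_lt_top _ _)
  · exact (isBounded_unitCube.thickening).measure_lt_top.ne
  · exact (Metric.measure_ball_pos _ _ hr.out).ne'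

/-- Serves to insert a factor `1` that brings in an average over translations. -/
lemma lintegral_indicator_unitCube_sub (z : E d) :
    ∫⁻ a, (unitCube d).indicator (1 : E d → ℝ≥0∞) (z - a) = 1 := by
  rw [lintegral_sub_left_eq_self (fun a => (unitCube d).indicator (1 : E d → ℝ≥0∞) a) z,
    lintegral_indicator_one measurableSet_unitCube, volume_unitCube]

lemma lintegral_indicator_unitCube_add (z : E d) :
    ∫⁻ a, (unitCube d).indicator (1 : E d → ℝ≥0∞) (z + a) = 1 := by
  rw [lintegral_add_left_eq_self (fun a => (unitCube d).indicator (1 : E d → ℝ≥0∞) a) z,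
    lintegral_indicator_one measurableSet_unitCube, volume_unitCube]

@[fun_prop]
lemma measurable_indicator_unitCube :
    Measurable ((unitCube d).indicator (1 : E d → ℝ≥0∞)) :=
  measurable_one.indicator measurableSet_unitCube

/-- **Campbell's formula** for a translation invariant measure. -/
theorem lintegral_campbell [IsFiniteMeasure μ]
    (hμ : ∀ a : E d, MeasurePreserving (Del.shift (r := r) (R := R) a) μ μ)
    {H : Del d r R × E d → ℝ≥0∞} (hH : Measurable H) :
    ∫⁻ L, ∫⁻ z, H (L.shift z, z) ∂(ptsMeasure L) ∂μ
      = ∫⁻ L, (∫⁻ a, H (L, a)) ∂(transverseMeasure μ) := by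
  have hI := measurable_indicator_unitCube (d := d)
  have hs := measurable_shift (d := d) (r := r) (R := R)
  have m1 : Measurable fun p : (Del d r R × E d) × E d =>
      H (p.1.1.shift p.2, p.2) * (unitCube d).indicator 1 (p.2 - p.1.2) :=
    (hH.fun_comp ((hs.fun_comp (by fun_prop : Measurable fun p : (Del d r R × E d) × E d =>
      (p.1.1, p.2))).prodMk measurable_snd)).mul (hI.fun_comp (by fun_prop))
  have m2 : Measurable fun p : (Del d r R × E d) × E d =>
      (unitCube d).indicator 1 p.2 * H (p.1.1.shift p.2, p.2 + p.1.2) :=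
    (hI.fun_comp (by fun_prop)).mul (hH.fun_comp ((hs.fun_comp (by fun_prop :
      Measurable fun p : (Del d r R × E d) × E d => (p.1.1, p.2))).prodMk (by fun_prop)))
  -- After inserting `1 = ∫ 1_cube(z - a) da`, invariance of `μ` moves the cube back to the origin
  -- for each fixed `a`, at the price of shifting the second argument of `H` by `a`. The integral
  -- over `a` absorbs the point `z`.
  calc ∫⁻ L, ∫⁻ z, H (L.shift z, z) ∂(ptsMeasure L) ∂μ
      = ∫⁻ L, ∫⁻ z, (∫⁻ a, H (L.shift z, z) * (unitCube d).indicator 1 (z - a))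
          ∂(ptsMeasure L) ∂μ := by
        refine lintegral_congr fun L => lintegral_congr fun z => ?_
        rw [lintegral_const_mul _ (hI.fun_comp (by fun_prop)), lintegral_indicator_unitCube_sub,
          mul_one]
    _ = ∫⁻ L, (∫⁻ a, ∫⁻ z, H (L.shift z, z) * (unitCube d).indicator 1 (z - a)
          ∂(ptsMeasure L)) ∂μ := by
        refine lintegral_congr fun L => lintegral_lintegral_swap ?_
        exact (m1.fun_comp (by fun_prop :
          Measurable fun p : E d × E d => ((L, p.2), p.1))).aemeasurable
    _ = ∫⁻ a, ∫⁻ L, ∫⁻ z, H (L.shift z, z) * (unitCube d).indicator 1 (z - a)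
          ∂(ptsMeasure L) ∂μ :=
        lintegral_lintegral_swap (measurable_lintegral_pts_param m1).aemeasurable
    _ = ∫⁻ a, ∫⁻ L, ∫⁻ z, (unitCube d).indicator 1 z * H (L.shift z, z + a)
          ∂(ptsMeasure L) ∂μ := by
        refine lintegral_congr fun a => ?_
        have hm := (measurable_lintegral_pts_param m1).fun_comp
          (measurable_prodMk_right (y := a) (α := Del d r R))
        simp only [] at hm
        rw [← (hμ (-a)).lintegral_comp hm]
        refine lintegral_congr fun L => ?_
        rw [lintegral_ptsMeasure_shift L (-a)]
        refine lintegral_congr fun z => ?_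
        rw [Del.shift_shift, sub_neg_eq_add, show -a + (z + a) = z by abel, add_sub_cancel_right,
          mul_comm]
    _ = ∫⁻ L, (∫⁻ a, ∫⁻ z, (unitCube d).indicator 1 z * H (L.shift z, z + a)
          ∂(ptsMeasure L)) ∂μ :=
        (lintegral_lintegral_swap (measurable_lintegral_pts_param m2).aemeasurable).symm
    _ = ∫⁻ L, ∫⁻ z, (∫⁻ a, (unitCube d).indicator 1 z * H (L.shift z, z + a))
          ∂(ptsMeasure L) ∂μ := by
        refine lintegral_congr fun L => (lintegral_lintegral_swap ?_).symm
        exact (m2.fun_comp (by fun_prop :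
          Measurable fun p : E d × E d => ((L, p.2), p.1))).aemeasurable
    _ = ∫⁻ L, (∫⁻ a, H (L, a)) ∂(transverseMeasure μ) := by
        rw [lintegral_transverse _ hH.lintegral_prod_right']
        refine lintegral_congr fun L => lintegral_congr fun z => ?_
        rw [lintegral_const_mul _ (hH.fun_comp (by fun_prop)),
          lintegral_add_left_eq_self (fun a => H (L.shift z, a)) z]

/-- The mass transport principle. -/
theorem lintegral_transverse_inv [IsFiniteMeasure μ]
    (hμ : ∀ a : E d, MeasurePreserving (Del.shift (r := r) (R := R) a) μ μ)
    {G : Del d r R × E d → ℝ≥0∞} (hG : Measurable G) :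
    ∫⁻ L, ∫⁻ x, G (L.shift x, -x) ∂(ptsMeasure L) ∂(transverseMeasure μ)
      = ∫⁻ L, ∫⁻ x, G (L, x) ∂(ptsMeasure L) ∂(transverseMeasure μ) := by
  have hI := measurable_indicator_unitCube (d := d)
  have hs := measurable_shift (d := d) (r := r) (R := R)
  have m0 : Measurable fun p : Del d r R × E d => G (p.1.shift p.2, -p.2) :=
    hG.fun_comp (hs.prodMk (by fun_prop))
  have m1 : Measurable fun p : (Del d r R × E d) × E d =>
      (unitCube d).indicator 1 (p.2 + p.1.2) * G (p.1.1, p.2) :=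
    (hI.fun_comp (by fun_prop)).mul (hG.fun_comp (by fun_prop))
  have m2 : ∀ L : Del d r R, Measurable fun p : E d × E d =>
      (unitCube d).indicator 1 p.1 * G (L.shift p.2, p.1 - p.2) := fun L =>
    (hI.fun_comp (by fun_prop)).mul (hG.fun_comp ((hs.fun_comp (by fun_prop :
      Measurable fun p : E d × E d => (L, p.2))).prodMk (by fun_prop)))
  rw [lintegral_transverse _ (measurable_lintegral_pts m0)]
  -- With `z = x + y` the integrand depends on two points `y`, `z` of `L`. Exchanging them and
  -- recentring at `z` makes Campbell's formula applicable; the cube then contributes mass `1`.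
  calc ∫⁻ L, ∫⁻ y, (unitCube d).indicator 1 y *
        (∫⁻ x, G ((L.shift y).shift x, -x) ∂(ptsMeasure (L.shift y))) ∂(ptsMeasure L) ∂μ
      = ∫⁻ L, ∫⁻ y, (∫⁻ z, (unitCube d).indicator 1 y * G (L.shift z, y - z) ∂(ptsMeasure L))
          ∂(ptsMeasure L) ∂μ := by
        refine lintegral_congr fun L => lintegral_congr fun y => ?_
        rw [lintegral_ptsMeasure_shift, lintegral_const_mul]
        · congr 1
          refine lintegral_congr fun z => ?_
          rw [Del.shift_shift]
          simp
        · exact hG.fun_comp ((hs.fun_comp (by fun_prop : Measurable fun z : E d => (L, z))).prodMk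
            (by fun_prop))
    _ = ∫⁻ L, ∫⁻ z, (∫⁻ y, (unitCube d).indicator 1 y * G (L.shift z, y - z) ∂(ptsMeasure L))
          ∂(ptsMeasure L) ∂μ :=
        lintegral_congr fun L => lintegral_lintegral_swap (m2 L).aemeasurable
    _ = ∫⁻ L, ∫⁻ z, (∫⁻ x, (unitCube d).indicator 1 (x + z) * G (L.shift z, x)
          ∂(ptsMeasure (L.shift z))) ∂(ptsMeasure L) ∂μ := by
        refine lintegral_congr fun L => lintegral_congr fun z => ?_
        rw [lintegral_ptsMeasure_shift]
        simp
    _ = ∫⁻ L, (∫⁻ a, ∫⁻ x, (unitCube d).indicator 1 (x + a) * G (L, x) ∂(ptsMeasure L))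
          ∂(transverseMeasure μ) :=
        lintegral_campbell hμ (measurable_lintegral_pts_param m1)
    _ = ∫⁻ L, ∫⁻ x, (∫⁻ a, (unitCube d).indicator 1 (x + a) * G (L, x)) ∂(ptsMeasure L)
          ∂(transverseMeasure μ) := by
        refine lintegral_congr fun L => lintegral_lintegral_swap ?_
        exact (m1.fun_comp (by fun_prop :
          Measurable fun p : E d × E d => ((L, p.1), p.2))).aemeasurable
    _ = _ := by
        refine lintegral_congr fun L => lintegral_congr fun x => ?_
        rw [lintegral_mul_const _ (hI.fun_comp (by fun_prop)), lintegral_indicator_unitCube_add,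
          one_mul]

/-- The inversion `(L, x) ↦ (L - x, -x)`. -/
def inv (p : Del d r R × E d) : Del d r R × E d := (p.1.shift p.2, -p.2)

lemma measurable_inv : Measurable (inv (d := d) (r := r) (R := R)) :=
  measurable_shift.prodMk (by fun_prop)

/-- The transverse measure together with the counting measure along its fibres. -/
def fibreMeasure (μ : Measure (Del d r R)) : Measure (Del d r R × E d) :=
  transverseMeasure μ ⊗ₘ pts d r R

lemma lintegral_fibreMeasure [IsFiniteMeasure μ] {G : Del d r R × E d → ℝ≥0∞}
    (hG : Measurable G) : ∫⁻ p, G p ∂(fibreMeasure μ)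
      = ∫⁻ L, ∫⁻ x, G (L, x) ∂(ptsMeasure L) ∂(transverseMeasure μ) := by
  rw [fibreMeasure, Measure.lintegral_compProd hG]
  simp_rw [pts_apply]

lemma measurePreserving_inv [IsFiniteMeasure μ]
    (hμ : ∀ a : E d, MeasurePreserving (Del.shift (r := r) (R := R) a) μ μ) :
    MeasurePreserving inv (fibreMeasure μ) (fibreMeasure μ) := by
  refine ⟨measurable_inv, Measure.ext_of_lintegral _ fun G hG => ?_⟩
  rw [lintegral_map hG measurable_inv, lintegral_fibreMeasure (hG.fun_comp measurable_inv),
    lintegral_fibreMeasure hG]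
  exact lintegral_transverse_inv hμ hG

/-- Campbell's formula as an identity of measures, so that it applies to complex integrands. -/
lemma map_campbell [IsFiniteMeasure μ]
    (hμ : ∀ a : E d, MeasurePreserving (Del.shift (r := r) (R := R) a) μ μ) :
    (μ ⊗ₘ pts d r R).map (fun p => (p.1.shift p.2, p.2))
      = (transverseMeasure μ).prod volume := by
  have hm : Measurable fun p : Del d r R × E d => (p.1.shift p.2, p.2) :=
    measurable_shift.prodMk measurable_snd
  refine Measure.ext_of_lintegral _ fun G hG => ?_
  rw [lintegral_map hG hm, Measure.lintegral_compProd (hG.fun_comp hm),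
    lintegral_prod _ hG.aemeasurable]
  simp_rw [pts_apply]
  exact lintegral_campbell hμ hG

/-- Almost sure properties for `𝐏` hold along whole fibres. -/
lemma ae_forall_shift [IsFiniteMeasure μ]
    (hμ : ∀ a : E d, MeasurePreserving (Del.shift (r := r) (R := R) a) μ μ)
    {p : Del d r R → Prop} (hp : ∀ᵐ L ∂(transverseMeasure μ), p L) :
    ∀ᵐ L ∂(transverseMeasure μ), ∀ x ∈ L.1, p (L.shift x) := by
  obtain ⟨N, hpN, hN, hN0⟩ := exists_measurable_superset_of_null (ae_iff.1 hp)
  have hI : Measurable (N.indicator (1 : Del d r R → ℝ≥0∞)) := measurable_one.indicator hN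
  -- Mass transport for a function of the pattern alone: the mean number of `x ∈ L` with `L - x ∈ N`
  -- equals the integral over `N` of the number of points, hence vanishes.
  have h := lintegral_transverse_inv hμ (G := fun p => N.indicator 1 p.1)
    (hI.fun_comp measurable_fst)
  have h0 : ∫⁻ L, ∫⁻ _x : E d, N.indicator (1 : Del d r R → ℝ≥0∞) L ∂(ptsMeasure L)
      ∂(transverseMeasure μ) = 0 := by
    rw [lintegral_congr_ae (g := 0) ?_, lintegral_zero_fun]
    filter_upwards [measure_eq_zero_iff_ae_notMem.1 hN0] with L hL
    simp [hL]
  rw [h0, lintegral_eq_zero_iff (measurable_lintegral_pts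
    (f := fun p : Del d r R × E d => N.indicator 1 (p.1.shift p.2))
    (hI.fun_comp measurable_shift))] at h
  filter_upwards [h] with L hL x hx
  rw [lintegral_ptsMeasure] at hL
  have := ENNReal.tsum_eq_zero.1 hL ⟨x, hx⟩
  by_contra hc
  simp [show L.shift x ∈ N from hpN hc] at this

/-- Almost sure properties for `μ` hold for some translate of `𝐏`-almost every pattern. -/
lemma ae_exists_shift_of_ae [IsFiniteMeasure μ]
    (hμ : ∀ a : E d, MeasurePreserving (Del.shift (r := r) (R := R) a) μ μ)
    {p : Del d r R → Prop} (hp : ∀ᵐ L ∂μ, p L) :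
    ∀ᵐ L ∂(transverseMeasure μ), ∃ a, p (L.shift a) := by
  obtain ⟨N, hpN, hN, hN0⟩ := exists_measurable_superset_of_null (ae_iff.1 hp)
  have hI : Measurable (N.indicator (1 : Del d r R → ℝ≥0∞)) := measurable_one.indicator hN
  -- In Campbell's formula this integrand undoes the shift on the left, leaving `1_N(L)`; on the
  -- right it tests all translates of `L`.
  have hm : Measurable fun p : Del d r R × E d => N.indicator (1 : Del d r R → ℝ≥0∞)
      (p.1.shift (-p.2)) :=
    hI.fun_comp (measurable_shift.fun_comp (by fun_prop : Measurable fun p : Del d r R × E d =>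
      (p.1, -p.2)))
  have h := lintegral_campbell hμ hm
  have h0 : ∫⁻ L, ∫⁻ z : E d, N.indicator (1 : Del d r R → ℝ≥0∞) ((L.shift z).shift (-z))
      ∂(ptsMeasure L) ∂μ = 0 := by
    simp_rw [Del.shift_shift, add_neg_cancel, Del.shift_zero]
    rw [lintegral_congr_ae (g := 0) ?_, lintegral_zero_fun]
    filter_upwards [measure_eq_zero_iff_ae_notMem.1 hN0] with L hL
    simp [hL]
  simp only [] at h
  rw [h0, eq_comm, lintegral_eq_zero_iff hm.lintegral_prod_right'] at h
  filter_upwards [h] with L hL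
  have hL' := (lintegral_eq_zero_iff (hm.fun_comp (by fun_prop : Measurable fun a : E d =>
    (L, a)))).1 hL
  obtain ⟨a, ha⟩ := hL'.exists
  refine ⟨-a, ?_⟩
  by_contra hc
  simp [show L.shift (-a) ∈ N from hpN hc] at ha

end Aperiodic
end

noncomputable section

namespace Aperiodic

/-! ### Averages over dilated convex bodies -/

section Averages

variable {d : ℕ}

/-- The segment from `x` to `y` is connected, so it meets the frontier, and no point of it is
farther than `δ` from an endpoint. -/
lemma mem_cthickening_frontier_of_mem_of_notMem {S : Set (E d)} {x y : E d} (hx : x ∈ S)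
    (hy : y ∉ S) {δ : ℝ} (h : dist x y ≤ δ) :
    x ∈ Metric.cthickening δ (frontier S) ∧ y ∈ Metric.cthickening δ (frontier S) := by
  have hc : IsPreconnected (segment ℝ x y) := (convex_segment x y).isPreconnected
  have hne : (segment ℝ x y ∩ frontier S).Nonempty := by
    by_contra hemp
    rw [not_nonempty_iff_eq_empty, ← disjoint_iff_inter_eq_empty] at hemp
    have hsub := hemp.subset_compl_right
    rw [compl_frontier_eq_union_interior] at hsub
    have hx' : x ∈ interior S := (hsub (left_mem_segment ℝ x y)).resolve_right
      fun h => interior_subset h hx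
    have hy' : y ∈ interior Sᶜ := (hsub (right_mem_segment ℝ x y)).resolve_left
      fun h => hy (interior_subset h)
    obtain ⟨z, -, hz, hz'⟩ := hc _ _ isOpen_interior isOpen_interior hsub
      ⟨x, left_mem_segment ℝ x y, hx'⟩ ⟨y, right_mem_segment ℝ x y, hy'⟩
    exact interior_subset hz' (interior_subset hz)
  obtain ⟨z, hz, hzS⟩ := hne
  have h1 : dist x z + dist z y = dist x y := dist_add_dist_of_mem_segment hz
  have := dist_nonneg (x := x) (y := z)
  have := dist_nonneg (x := z) (y := y)
  refine ⟨Metric.mem_cthickening_of_dist_le x z δ _ hzS (by linarith),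
    Metric.mem_cthickening_of_dist_le y z δ _ hzS (by rw [dist_comm]; linarith)⟩

lemma frontier_smul_eq (S : Set (E d)) {ρ : ℝ} (hρ : 0 < ρ) :
    frontier (ρ • S) = ρ • frontier S := by
  have := (Homeomorph.smulOfNeZero ρ hρ.ne' (α := E d)).image_frontier S
  exact this.symm

lemma cthickening_smul_subset {F : Set (E d)} (hF : IsCompact F) {ρ δ : ℝ} (hρ : 0 < ρ)
    (hδ : 0 ≤ δ) :
    Metric.cthickening δ (ρ • F) ⊆ ρ • Metric.cthickening (δ / ρ) F := by
  intro x hx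
  rw [(hF.smul ρ).cthickening_eq_biUnion_closedBall hδ] at hx
  simp only [mem_iUnion, Metric.mem_closedBall, exists_prop] at hx
  obtain ⟨_, ⟨y, hy, rfl⟩, hxy⟩ := hx
  refine ⟨ρ⁻¹ • x, Metric.mem_cthickening_of_dist_le _ y _ _ hy ?_, smul_inv_smul₀ hρ.ne' x⟩
  rw [le_div_iff₀ hρ, mul_comm]
  calc ρ * dist (ρ⁻¹ • x) y = dist (ρ • ρ⁻¹ • x) (ρ • y) := by
        rw [dist_smul₀, Real.norm_of_nonneg hρ.le]
    _ ≤ δ := by rwa [smul_inv_smul₀ hρ.ne']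

lemma volume_real_smul (S : Set (E d)) {ρ : ℝ} (hρ : 0 ≤ ρ) :
    volume.real (ρ • S) = ρ ^ d * volume.real S := by
  rw [Measure.real, Measure.addHaar_smul, ENNReal.toReal_mul, finrank_euclideanSpace_fin,
    abs_of_nonneg (by positivity), ENNReal.toReal_ofReal (by positivity)]
  rfl

variable {K : Set (E d)}

lemma isCompact_frontier_of_isBounded (hb : Bornology.IsBounded K) : IsCompact (frontier K) :=
  hb.isCompact_closure.of_isClosed_subset isClosed_frontier frontier_subset_closure

/-- The boundary layer of a dilated convex body has negligible volume. -/
lemma tendsto_volume_cthickening_frontier (hK : Convex ℝ K) (hb : Bornology.IsBounded K) {δ : ℝ}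
    (hδ : 0 ≤ δ) :
    Tendsto (fun ρ : ℝ => (ρ ^ d)⁻¹ * volume.real (Metric.cthickening δ (frontier (ρ • K))))
      atTop (𝓝 0) := by
  have hc := isCompact_frontier_of_isBounded hb
  -- The frontier of a convex set is null, so its thin layers have small volume; scaling by `ρ`
  -- compares a layer of width `δ` with one of width `δ / ρ` about the fixed frontier.
  have h1 : Tendsto (fun t => volume.real (Metric.cthickening t (frontier K))) (𝓝 0) (𝓝 0) := by
    have := tendsto_measure_cthickening_of_isCompact (μ := (volume : Measure (E d))) hc
    rw [hK.addHaar_frontier volume] at this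
    exact (ENNReal.tendsto_toReal ENNReal.zero_ne_top).comp this
  have h2 : Tendsto (fun ρ : ℝ => δ / ρ) atTop (𝓝 0) := tendsto_const_nhds.div_atTop tendsto_id
  refine squeeze_zero' ?_ ?_ (h1.comp h2)
  · filter_upwards [eventually_gt_atTop 0] with ρ hρ
    positivity
  · filter_upwards [eventually_gt_atTop 0] with ρ hρ
    rw [frontier_smul_eq K hρ, inv_mul_le_iff₀ (by positivity), Function.comp_apply,
      ← volume_real_smul _ hρ.le]
    refine measureReal_mono (cthickening_smul_subset hc hρ hδ) ?_
    have : Bornology.IsBounded (ρ • Metric.cthickening (δ / ρ) (frontier K)) :=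
      (hc.isBounded.cthickening).smul₀ ρ
    exact this.measure_lt_top.ne

lemma nullMeasurableSet_smul (hK : Convex ℝ K) (ρ : ℝ) :
    NullMeasurableSet (ρ • K) (volume : Measure (E d)) :=
  (hK.smul ρ).nullMeasurableSet _

/-- The averages of `φ` over the dilates of every bounded convex set converge to `c`. -/
def AvgTendsto (φ : E d → ℂ) (c : ℂ) : Prop :=
  ∀ K : Set (E d), Convex ℝ K → Bornology.IsBounded K →
    Tendsto (fun ρ : ℝ => ((ρ ^ d : ℝ) : ℂ)⁻¹ * ∫ b in ρ • K, φ b) atTop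
      (𝓝 (c * (volume.real K : ℂ)))

/-- A bounded measurable function. -/
structure IsBddMeas {α : Type*} [MeasurableSpace α] (φ : α → ℂ) : Prop where
  measurable : Measurable φ
  bdd : ∃ C, 0 ≤ C ∧ ∀ x, ‖φ x‖ ≤ C

namespace IsBddMeas

variable {α β : Type*} [MeasurableSpace α] [MeasurableSpace β] {φ ψ : α → ℂ}

lemma add (hφ : IsBddMeas φ) (hψ : IsBddMeas ψ) : IsBddMeas fun x => φ x + ψ x := by
  obtain ⟨C, hC0, hC⟩ := hφ.bdd
  obtain ⟨D, hD0, hD⟩ := hψ.bdd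
  exact ⟨hφ.1.add hψ.1, C + D, by positivity,
    fun x => (norm_add_le _ _).trans (add_le_add (hC x) (hD x))⟩

lemma const_mul (hφ : IsBddMeas φ) (c : ℂ) : IsBddMeas fun x => c * φ x := by
  obtain ⟨C, hC0, hC⟩ := hφ.bdd
  refine ⟨hφ.1.const_mul c, ‖c‖ * C, by positivity, fun x => ?_⟩
  rw [norm_mul]
  exact mul_le_mul_of_nonneg_left (hC x) (norm_nonneg _)

lemma const (c : ℂ) : IsBddMeas fun _ : α => c :=
  ⟨measurable_const, ‖c‖, norm_nonneg _, fun _ => le_rfl⟩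

lemma sub (hφ : IsBddMeas φ) (hψ : IsBddMeas ψ) : IsBddMeas fun x => φ x - ψ x := by
  obtain ⟨C, hC0, hC⟩ := hφ.bdd
  obtain ⟨D, hD0, hD⟩ := hψ.bdd
  exact ⟨hφ.1.sub hψ.1, C + D, by positivity,
    fun x => (norm_sub_le _ _).trans (add_le_add (hC x) (hD x))⟩

lemma comp (hφ : IsBddMeas φ) {f : β → α} (hf : Measurable f) : IsBddMeas fun x => φ (f x) := by
  obtain ⟨C, hC0, hC⟩ := hφ.bdd
  exact ⟨hφ.1.comp hf, C, hC0, fun x => hC _⟩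

lemma integrable (hφ : IsBddMeas φ) (ν : Measure α) [IsFiniteMeasure ν] : Integrable φ ν := by
  obtain ⟨C, -, hC⟩ := hφ.bdd
  exact Integrable.of_bound hφ.1.aestronglyMeasurable C (ae_of_all _ hC)

lemma memLp (hφ : IsBddMeas φ) (ν : Measure α) [IsFiniteMeasure ν] : MemLp φ 2 ν := by
  obtain ⟨C, -, hC⟩ := hφ.bdd
  exact MemLp.of_bound hφ.1.aestronglyMeasurable C (ae_of_all _ hC)

lemma integrableOn {φ : E d → ℂ} (hφ : IsBddMeas φ) {S : Set (E d)}
    (hS : Bornology.IsBounded S) : IntegrableOn φ S := by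
  obtain ⟨C, -, hC⟩ := hφ.bdd
  exact Measure.integrableOn_of_bounded hS.measure_lt_top.ne hφ.1.aestronglyMeasurable
    (ae_of_all _ hC)

end IsBddMeas

lemma AvgTendsto.add {φ ψ : E d → ℂ} {c c' : ℂ} (hφ : AvgTendsto φ c) (hψ : AvgTendsto ψ c')
    (h1 : IsBddMeas φ) (h2 : IsBddMeas ψ) : AvgTendsto (fun x => φ x + ψ x) (c + c') := by
  intro K hK hb
  have := (hφ K hK hb).add (hψ K hK hb)
  rw [← add_mul] at this
  refine this.congr fun ρ => ?_
  rw [integral_add (h1.integrableOn (hb.smul₀ ρ)) (h2.integrableOn (hb.smul₀ ρ)), mul_add]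

lemma AvgTendsto.const_mul {φ : E d → ℂ} {c : ℂ} (hφ : AvgTendsto φ c) (a : ℂ) :
    AvgTendsto (fun x => a * φ x) (a * c) := by
  intro K hK hb
  have := (hφ K hK hb).const_mul a
  rw [← mul_assoc] at this
  refine this.congr fun ρ => ?_
  rw [integral_const_mul]
  ring

lemma avgTendsto_const (c : ℂ) : AvgTendsto (fun _ : E d => c) c := by
  intro K hK hb
  refine tendsto_const_nhds.congr' ?_
  filter_upwards [eventually_gt_atTop 0] with ρ hρ
  rw [setIntegral_const, volume_real_smul K hρ.le, Complex.real_smul, Complex.ofReal_mul]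
  have : ((ρ ^ d : ℝ) : ℂ) ≠ 0 := by exact_mod_cast (pow_pos hρ d).ne'
  field_simp

/-- After a change of variables the two integrals differ only at points that translation by `a`
carries across the frontier. -/
lemma norm_setIntegral_translate_sub_le {φ : E d → ℂ} {C : ℝ} (hm : Measurable φ)
    (hC : ∀ x, ‖φ x‖ ≤ C) {S : Set (E d)} (hS : NullMeasurableSet S (volume : Measure (E d)))
    (hb : Bornology.IsBounded S) (a : E d) :
    ‖∫ b in S, (φ (b + a) - φ b)‖
      ≤ C * volume.real (Metric.cthickening ‖a‖ (frontier S)) := by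
  have hC0 : 0 ≤ C := (norm_nonneg _).trans (hC 0)
  have hφ : IsBddMeas φ := ⟨hm, C, hC0, hC⟩
  have hφa : IsBddMeas fun b => φ (b + a) := hφ.comp (by fun_prop)
  have e1 : ∫ b in S, φ (b + a) = ∫ b, S.indicator (fun b => φ (b + a)) (b - a) := by
    rw [integral_sub_right_eq_self (fun b => S.indicator (fun b => φ (b + a)) b),
      integral_indicator₀ hS]
  rw [integral_sub (hφa.integrableOn hb) (hφ.integrableOn hb), e1, ← integral_indicator₀ hS,
    ← integral_sub]
  · have hmeas : MeasurableSet (Metric.cthickening ‖a‖ (frontier S)) :=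
      Metric.isClosed_cthickening.measurableSet
    have hfin : volume (Metric.cthickening ‖a‖ (frontier S)) ≠ ∞ :=
      ((isCompact_frontier_of_isBounded hb).isBounded.cthickening).measure_lt_top.ne
    calc _ ≤ ∫ b, (Metric.cthickening ‖a‖ (frontier S)).indicator (fun _ => C) b := by
          refine norm_integral_le_of_norm_le
            ((integrable_indicator_iff hmeas).2 (integrableOn_const hfin)) (ae_of_all _ fun b => ?_)
          have hd : dist b (b - a) ≤ ‖a‖ := by simp
          by_cases h1 : b ∈ S <;> by_cases h2 : b - a ∈ S
          · simp [h1, h2]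
            exact indicator_nonneg (fun _ _ => hC0) _
          · rw [indicator_of_mem (mem_cthickening_frontier_of_mem_of_notMem h1 h2 hd).1]
            simpa [h1, h2] using hC b
          · rw [indicator_of_mem
              (mem_cthickening_frontier_of_mem_of_notMem h2 h1 (by rwa [dist_comm])).2]
            simpa [h1, h2] using hC b
          · simp [h1, h2]
            exact indicator_nonneg (fun _ _ => hC0) _
      _ = _ := by
          rw [integral_indicator_const _ hmeas, smul_eq_mul, mul_comm]
  · exact ((hφa.integrableOn hb).integrable_indicator₀ hS).comp_sub_right a
  · exact (hφ.integrableOn hb).integrable_indicator₀ hS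

/-- Coboundaries average to zero because the boundary layer of a dilated convex body is negligible
against its volume. -/
lemma avgTendsto_translate_sub {φ : E d → ℂ} (hφ : IsBddMeas φ) (a : E d) :
    AvgTendsto (fun b => φ (b + a) - φ b) 0 := by
  intro K hK hb
  obtain ⟨C, hC0, hC⟩ := hφ.bdd
  rw [zero_mul]
  have hl := (tendsto_volume_cthickening_frontier hK hb (norm_nonneg a)).const_mul C
  rw [mul_zero] at hl
  refine squeeze_zero_norm' ?_ hl
  filter_upwards [eventually_gt_atTop 0] with ρ hρ
  rw [norm_mul, norm_inv, Complex.norm_real, Real.norm_of_nonneg (by positivity),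
    mul_left_comm]
  exact mul_le_mul_of_nonneg_left (norm_setIntegral_translate_sub_le hφ.1 hC
    (nullMeasurableSet_smul hK ρ) (hb.smul₀ ρ) a) (by positivity)

/-- Averages do not depend on the base point; a limit known for one translate of a pattern thereby
holds for the pattern itself. -/
lemma AvgTendsto.translate {φ : E d → ℂ} (hφ : IsBddMeas φ) {c : ℂ} {a : E d}
    (h : AvgTendsto (fun b => φ (b + a)) c) : AvgTendsto φ c := by
  have h1 := (avgTendsto_translate_sub hφ a).const_mul (-1)
  have hφa : IsBddMeas fun b => φ (b + a) := hφ.comp (by fun_prop)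
  have := h.add h1 hφa ((hφa.sub hφ).const_mul _)
  simpa using this

end Averages

end Aperiodic
end

noncomputable section

namespace Aperiodic

/-! ### The pointwise ergodic theorem -/

variable {d : ℕ} {r R : ℝ} [hr : Fact (0 < r)] {μ : Measure (Del d r R)}

lemma measurable_shift_left (L : Del d r R) : Measurable fun b : E d => L.shift b :=
  measurable_shift.comp (measurable_const.prodMk measurable_id)

lemma measurable_shift_right (b : E d) : Measurable fun L : Del d r R => L.shift b :=
  measurable_shift.comp (measurable_id.prodMk measurable_const)

/-- An almost everywhere invariant function is almost everywhere constant. -/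
lemma ae_eq_const_of_invariant [SFinite μ]
    (herg : ∀ S : Set (Del d r R), MeasurableSet S →
      (∀ a : E d, Del.shift a ⁻¹' S = S) → μ S = 0 ∨ μ Sᶜ = 0)
    {w : Del d r R → ℂ} (hw : Measurable w) (hinv : ∀ a : E d, ∀ᵐ L ∂μ, w (L.shift a) = w L) :
    ∃ c, w =ᵐ[μ] Function.const _ c := by
  have hws : Measurable fun p : Del d r R × E d => w (p.1.shift p.2) := hw.comp measurable_shift
  have hcomm : ∀ᵐ L ∂μ, ∀ᵐ b : E d, w (L.shift b) = w L := by
    refine (Measure.ae_ae_comm ?_).2 (ae_of_all _ hinv)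
    exact measurableSet_eq_fun hws (hw.comp measurable_fst)
  refine Filter.exists_eventuallyEq_const_of_forall_separating MeasurableSet fun A hA => ?_
  -- The preimage of `A` under `w` is invariant only up to null sets that vary with the translation.
  -- Testing almost every translate gives a strictly invariant set, as ergodicity demands, which by
  -- Fubini agrees with the preimage almost everywhere.
  let S : Set (Del d r R) := {L | ∀ᵐ b : E d, w (L.shift b) ∈ A}
  have hS : MeasurableSet S := by
    have := measurable_measure_prodMk_left (ν := (volume : Measure (E d))) (hws hA.compl)
    exact this (measurableSet_singleton 0)
  have hSinv : ∀ a : E d, Del.shift a ⁻¹' S = S := by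
    intro a
    ext L
    change (∀ᵐ b : E d, w ((L.shift a).shift b) ∈ A) ↔ ∀ᵐ b : E d, w (L.shift b) ∈ A
    simp_rw [Del.shift_shift]
    exact eventually_add_left_iff volume a (p := fun b => w (L.shift b) ∈ A)
  rcases herg S hS hSinv with h | h
  · right
    filter_upwards [measure_eq_zero_iff_ae_notMem.1 h, hcomm] with L h1 h2 hLA
    exact h1 (h2.mono fun b hb => hb ▸ hLA)
  · left
    filter_upwards [measure_eq_zero_iff_ae_notMem.1 h, hcomm] with L h1 h2
    rw [notMem_compl_iff] at h1
    obtain ⟨b, hb, hbc⟩ := (Filter.Eventually.and (show ∀ᵐ b : E d, _ from h1) h2).exists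
    rwa [← hbc]

/-- The classes of the functions `L ↦ g (L - a) - g L` with `g` bounded. -/
def coboundaries (μ : Measure (Del d r R)) : Set (Lp ℂ 2 μ) :=
  {u | ∃ g : Del d r R → ℂ, IsBddMeas g ∧ ∃ a : E d, u =ᵐ[μ] fun L => g (L.shift a) - g L}

/-- The averages of the representative vanish along every orbit, so the approximants cost no null
set. -/
lemma exists_rep_of_mem_span {u : Lp ℂ 2 μ} (hu : u ∈ Submodule.span ℂ (coboundaries μ)) :
    ∃ v : Del d r R → ℂ, IsBddMeas v ∧ u =ᵐ[μ] v ∧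
      ∀ L : Del d r R, AvgTendsto (fun b => v (L.shift b)) 0 := by
  induction hu using Submodule.span_induction with
  | mem u hu =>
    obtain ⟨g, hg, a, hu⟩ := hu
    refine ⟨_, (hg.comp (measurable_shift_right a)).sub hg, hu, fun L => ?_⟩
    have := avgTendsto_translate_sub (hg.comp (measurable_shift_left L)) a
    simpa only [Del.shift_shift] using this
  | zero =>
    refine ⟨fun _ => 0, IsBddMeas.const 0, Lp.coeFn_zero _ _ _, fun L => avgTendsto_const 0⟩
  | add u u' _ _ h h' =>
    obtain ⟨v, h1, h2, h3⟩ := h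
    obtain ⟨v', h1', h2', h3'⟩ := h'
    refine ⟨_, h1.add h1', (Lp.coeFn_add u u').trans (h2.add h2'), fun L => ?_⟩
    have := (h3 L).add (h3' L) (h1.comp (measurable_shift_left L))
      (h1'.comp (measurable_shift_left L))
    rwa [add_zero] at this
  | smul c u _ h =>
    obtain ⟨v, h1, h2, h3⟩ := h
    refine ⟨_, h1.const_mul c, (Lp.coeFn_smul c u).trans (h2.const_smul c), fun L => ?_⟩
    have := (h3 L).const_mul c
    rwa [mul_zero] at this

/-- Functions orthogonal to the coboundaries are invariant, hence constant. -/
lemma ae_eq_const_of_mem_orthogonal [IsFiniteMeasure μ]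
    (hμ : ∀ a : E d, MeasurePreserving (Del.shift (r := r) (R := R) a) μ μ)
    (herg : ∀ S : Set (Del d r R), MeasurableSet S →
      (∀ a : E d, Del.shift a ⁻¹' S = S) → μ S = 0 ∨ μ Sᶜ = 0)
    {w : Lp ℂ 2 μ} (hw : w ∈ (Submodule.span ℂ (coboundaries μ))ᗮ) :
    ∃ c, w =ᵐ[μ] Function.const _ c := by
  let U : E d → Lp ℂ 2 μ →ₗᵢ[ℂ] Lp ℂ 2 μ := fun a => Lp.compMeasurePreservingₗᵢ ℂ _ (hμ a)
  have hU : ∀ a φ, U a φ =ᵐ[μ] fun L => φ (L.shift a) := fun a φ =>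
    Lp.coeFn_compMeasurePreserving φ (hμ a)
  have horth : ∀ a (φ : Lp ℂ 2 μ), inner ℂ (U a φ - φ) w = 0 := by
    intro a φ
    -- Coboundaries are formed from bounded functions only; orthogonality reaches all of `L²`, and
    -- so `w` itself, from indicators by linearity and continuity.
    refine Lp.induction (p := 2) ENNReal.ofNat_ne_top
      (motive := fun φ => inner ℂ (U a φ - φ) w = 0) ?_ ?_ ?_ φ
    · intro c s hs hμs
      refine hw _ (Submodule.subset_span ⟨s.indicator fun _ => c, ?_, a, ?_⟩)
      · refine ⟨measurable_const.indicator hs, ‖c‖, norm_nonneg _, fun x => ?_⟩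
        exact norm_indicator_le_norm_self (fun _ => c) x
      · have h1 : (Lp.simpleFunc.indicatorConst 2 hs hμs.ne c : Lp ℂ 2 μ)
            =ᵐ[μ] s.indicator fun _ => c := by
          rw [Lp.simpleFunc.coe_indicatorConst]
          exact indicatorConstLp_coeFn
        exact (Lp.coeFn_sub _ _).trans
          (((hU a _).trans ((hμ a).quasiMeasurePreserving.ae_eq_comp h1)).sub h1)
    · intro f g hf hg _ h1 h2
      rw [map_add, add_sub_add_comm, inner_add_left, h1, h2, add_zero]
    · refine isClosed_eq ?_ continuous_const
      exact (((U a).continuous.sub continuous_id).inner continuous_const)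
  have hinv : ∀ a, U a w = w := by
    intro a
    have h1 := horth a w
    rw [inner_sub_left, sub_eq_zero] at h1
    -- `U a` is isometric and `⟨U a w, w⟩ = ⟨w, w⟩`, so expanding `‖U a w - w‖²` gives zero.
    rw [← sub_eq_zero, ← norm_eq_zero, ← sq_eq_zero_iff, @norm_sub_sq ℂ, (U a).norm_map, h1,
      inner_self_eq_norm_sq]
    ring
  have hsm := (Lp.stronglyMeasurable w).measurable
  exact ae_eq_const_of_invariant herg hsm fun a => by
    have := hU a w
    rw [hinv a] at this
    exact this.symm

/-- A bounded function of mean zero is approximated by functions with vanishing averages. -/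
lemma exists_approx [IsProbabilityMeasure μ]
    (hμ : ∀ a : E d, MeasurePreserving (Del.shift (r := r) (R := R) a) μ μ)
    (herg : ∀ S : Set (Del d r R), MeasurableSet S →
      (∀ a : E d, Del.shift a ⁻¹' S = S) → μ S = 0 ∨ μ Sᶜ = 0)
    {z : Del d r R → ℂ} (hz : IsBddMeas z) (hz0 : ∫ L, z L ∂μ = 0) {ε : ℝ≥0∞} (hε : ε ≠ 0) :
    ∃ v : Del d r R → ℂ, IsBddMeas v ∧ (∀ L : Del d r R, AvgTendsto (fun b => v (L.shift b)) 0) ∧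
      ∫⁻ L, ‖z L - v L‖ₑ ∂μ < ε := by
  -- The closed span of the coboundaries is its own double orthogonal. The first orthogonal consists
  -- of constants, and `z` has mean zero.
  have hmem : (hz.memLp μ).toLp z ∈ (Submodule.span ℂ (coboundaries μ)).topologicalClosure := by
    rw [← Submodule.orthogonal_orthogonal_eq_closure]
    intro w hw
    obtain ⟨c, hc⟩ := ae_eq_const_of_mem_orthogonal hμ herg hw
    rw [L2.inner_def, integral_congr_ae (g := fun L => z L * starRingEnd ℂ c),
      integral_mul_const, hz0, zero_mul]
    filter_upwards [hc, (hz.memLp μ).coeFn_toLp] with L h1 h2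
    rw [h1, h2]
    simp [Function.const]
  rw [← SetLike.mem_coe, Submodule.topologicalClosure_coe, EMetric.mem_closure_iff] at hmem
  obtain ⟨u, hu, hzu⟩ := hmem ε (pos_iff_ne_zero.2 hε)
  obtain ⟨v, hv, huv, hav⟩ := exists_rep_of_mem_span hu
  refine ⟨v, hv, hav, lt_of_le_of_lt ?_ hzu⟩
  rw [Lp.edist_def]
  calc ∫⁻ L, ‖z L - v L‖ₑ ∂μ = eLpNorm (fun L => z L - v L) 1 μ := by
        rw [eLpNorm_one_eq_lintegral_enorm]
    _ ≤ eLpNorm (fun L => z L - v L) 2 μ :=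
        eLpNorm_le_eLpNorm_of_exponent_le (by norm_num) (hz.sub hv).1.aestronglyMeasurable
    _ = _ := by
        refine eLpNorm_congr_ae ?_
        filter_upwards [huv, (hz.memLp μ).coeFn_toLp] with L h1 h2
        simp [h1, h2]

end Aperiodic
end

/-! ### The maximal inequality and almost everywhere convergence -/

noncomputable section

namespace Aperiodic

variable {d : ℕ} {r R : ℝ} [hr : Fact (0 < r)] {μ : Measure (Del d r R)}

lemma volume_closedBall_mul (x : E d) {t : ℝ} (ht : 0 ≤ t) {n : ℝ} (hn : 0 ≤ n) :
    volume (Metric.closedBall x (t * n))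
      = ENNReal.ofReal (t ^ d) * volume (Metric.closedBall (0 : E d) n) := by
  rw [Measure.addHaar_closedBall_mul _ _ ht hn, finrank_euclideanSpace_fin]

/-- Covering estimate: the set of centres of balls with large averages is controlled by the
integral. -/
lemma volume_large_average_le {W : E d → ℝ≥0∞} {N : ℕ} (l : ℝ≥0∞)
    {A : Set (E d)} (hA : A ⊆ Metric.closedBall 0 N)
    (h : ∀ a ∈ A, ∃ n : ℕ, 1 ≤ n ∧ n ≤ N ∧
      l * volume (Metric.closedBall (0 : E d) n) ≤ ∫⁻ b in Metric.closedBall a n, W b) :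
    l * volume A ≤ ENNReal.ofReal (5 ^ d) * ∫⁻ b in Metric.closedBall (0 : E d) (2 * N), W b := by
  choose! n hn1 hnN hn using h
  -- Vitali's lemma selects disjoint balls whose fivefold enlargements cover `A`, whence the factor
  -- `5 ^ d`.
  obtain ⟨u, huA, hdisj, hcov⟩ := Vitali.exists_disjoint_subfamily_covering_enlargement_closedBall
    A id (fun a => (n a : ℝ)) N (fun a ha => by exact_mod_cast hnN a ha) 5 (by norm_num)
  have hcount : u.Countable := by
    refine hdisj.countable_of_nonempty_interior fun a ha => ⟨a, ?_⟩
    refine Metric.ball_subset_interior_closedBall (Metric.mem_ball_self ?_)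
    exact_mod_cast hn1 a (huA ha)
  have hAsub : A ⊆ ⋃ b ∈ u, Metric.closedBall b (5 * n b) := by
    intro a ha
    obtain ⟨b, hb, hab⟩ := hcov a ha
    exact mem_biUnion hb (hab (Metric.mem_closedBall_self (Nat.cast_nonneg _)))
  have : Countable u := hcount
  calc l * volume A ≤ l * ∑' b : u, volume (Metric.closedBall b.1 (5 * n b.1)) := by
        gcongr
        exact (measure_mono hAsub).trans (measure_biUnion_le volume hcount _)
    _ = ENNReal.ofReal (5 ^ d) * ∑' b : u, l * volume (Metric.closedBall (0 : E d) (n b.1)) := by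
        rw [ENNReal.tsum_mul_left]
        simp_rw [volume_closedBall_mul _ (by norm_num : (0 : ℝ) ≤ 5) (Nat.cast_nonneg _)]
        rw [ENNReal.tsum_mul_left]
        ring
    _ ≤ ENNReal.ofReal (5 ^ d) * ∑' b : u, ∫⁻ b in Metric.closedBall b.1 (n b.1), W b := by
        gcongr with b
        exact hn b.1 (huA b.2)
    _ = ENNReal.ofReal (5 ^ d) * ∫⁻ b in ⋃ b : u, Metric.closedBall b.1 (n b.1), W b := by
        rw [lintegral_iUnion (fun _ => measurableSet_closedBall)]
        intro a b hab
        exact hdisj a.2 b.2 (fun h => hab (Subtype.ext h))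
    _ ≤ _ := by
        gcongr
        refine iUnion_subset fun b => Metric.closedBall_subset_closedBall' ?_
        have h1 : (n b.1 : ℝ) ≤ N := by exact_mod_cast hnN b.1 (huA b.2)
        have h2 := Metric.mem_closedBall.1 (hA (huA b.2))
        linarith

/-- The maximal inequality for averages over balls. -/
lemma maximal_inequality [SFinite μ]
    (hμ : ∀ a : E d, MeasurePreserving (Del.shift (r := r) (R := R) a) μ μ)
    {w : Del d r R → ℝ≥0∞} (hw : Measurable w) (l : ℝ≥0∞) :
    l * μ {L | ∃ n : ℕ, 1 ≤ n ∧ l * volume (Metric.closedBall (0 : E d) n)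
        ≤ ∫⁻ b in Metric.closedBall 0 n, w (L.shift b)}
      ≤ ENNReal.ofReal (10 ^ d) * ∫⁻ L, w L ∂μ := by
  have hws : Measurable fun p : Del d r R × E d => w (p.1.shift p.2) := hw.comp measurable_shift
  have hI : ∀ n : ℕ, Measurable fun L : Del d r R =>
      ∫⁻ b in Metric.closedBall 0 n, w (L.shift b) := fun n => hws.lintegral_prod_right'
  -- Vitali's lemma needs bounded radii: they are capped at `N`, and the cap is removed by
  -- monotonicity.
  let S : ℕ → Set (Del d r R) := fun N => {L | ∃ n : ℕ, 1 ≤ n ∧ n ≤ N ∧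
    l * volume (Metric.closedBall (0 : E d) n) ≤ ∫⁻ b in Metric.closedBall 0 n, w (L.shift b)}
  have hSm : ∀ N, MeasurableSet (S N) := by
    intro N
    have : S N = ⋃ n : ℕ, ⋃ (_ : 1 ≤ n ∧ n ≤ N), {L | l * volume (Metric.closedBall (0 : E d) n)
        ≤ ∫⁻ b in Metric.closedBall 0 n, w (L.shift b)} := by
      ext L
      simp [S, and_assoc]
    rw [this]
    exact MeasurableSet.iUnion fun n => MeasurableSet.iUnion fun _ =>
      measurableSet_le measurable_const (hI n)
  have hmono : Monotone S := fun N M h L ⟨n, h1, h2, h3⟩ => ⟨n, h1, h2.trans h, h3⟩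
  have hunion : {L : Del d r R | ∃ n : ℕ, 1 ≤ n ∧ l * volume (Metric.closedBall (0 : E d) n)
        ≤ ∫⁻ b in Metric.closedBall 0 n, w (L.shift b)} = ⋃ N, S N := by
    ext L
    simp only [mem_iUnion]
    exact ⟨fun ⟨n, h1, h2⟩ => ⟨n, n, h1, le_rfl, h2⟩, fun ⟨_, n, h1, _, h2⟩ => ⟨n, h1, h2⟩⟩
  have hmain : ∀ N, 1 ≤ N → l * μ (S N) ≤ ENNReal.ofReal (10 ^ d) * ∫⁻ L, w L ∂μ := by
    intro N hN
    set V := volume (Metric.closedBall (0 : E d) N) with hV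
    have hV0 : V ≠ 0 := (Metric.measure_closedBall_pos _ _ (by exact_mod_cast hN)).ne'
    have hVt : V ≠ ∞ := measure_closedBall_lt_top.ne
    have hind : Measurable fun p : Del d r R × E d =>
        (S N).indicator (1 : Del d r R → ℝ≥0∞) (p.1.shift p.2) :=
      (measurable_one.indicator (hSm N)).comp measurable_shift
    -- Transference: the covering estimate in `ℝᵈ` is applied along the orbit of `L`. Integration
    -- over `μ` and invariance turn it into an estimate on the hull; `10 = 5 * 2`, since the ball on
    -- the right has twice the radius of the one on the left.
    have step : ∀ L : Del d r R, l * ∫⁻ a in Metric.closedBall (0 : E d) N,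
        (S N).indicator (1 : Del d r R → ℝ≥0∞) (L.shift a)
        ≤ ENNReal.ofReal (5 ^ d) *
          ∫⁻ b in Metric.closedBall (0 : E d) (2 * N), w (L.shift b) := by
      intro L
      have hpre : MeasurableSet ((fun a => L.shift a) ⁻¹' S N) := measurable_shift_left L (hSm N)
      have e1 : ∫⁻ a in Metric.closedBall (0 : E d) N,
          (S N).indicator (1 : Del d r R → ℝ≥0∞) (L.shift a)
          = volume ((fun a => L.shift a) ⁻¹' S N ∩ Metric.closedBall (0 : E d) N) := by
        rw [← Measure.restrict_apply hpre, ← lintegral_indicator_one hpre]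
        rfl
      rw [e1]
      refine volume_large_average_le l inter_subset_right ?_
      rintro a ⟨⟨n, h1, h2, h3⟩, -⟩
      refine ⟨n, h1, h2, h3.trans_eq ?_⟩
      simp_rw [Del.shift_shift]
      have := (measurePreserving_add_left (volume : Measure (E d)) a).setLIntegral_comp_preimage_emb
        (measurableEmbedding_addLeft a) (fun b => w (L.shift b)) (Metric.closedBall a n)
      rw [← this]
      congr 2
      simp
    have hint : ∀ t : ℝ, ∫⁻ L, (∫⁻ b in Metric.closedBall (0 : E d) t, w (L.shift b)) ∂μ
        = volume (Metric.closedBall (0 : E d) t) * ∫⁻ L, w L ∂μ := by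
      intro t
      rw [lintegral_lintegral_swap hws.aemeasurable]
      simp_rw [(hμ _).lintegral_comp hw]
      rw [setLIntegral_const, mul_comm]
    have hint' : ∫⁻ L, (∫⁻ a in Metric.closedBall (0 : E d) N,
        (S N).indicator (1 : Del d r R → ℝ≥0∞) (L.shift a)) ∂μ = V * μ (S N) := by
      rw [lintegral_lintegral_swap hind.aemeasurable]
      simp_rw [(hμ _).lintegral_comp (measurable_one.indicator (hSm N))]
      rw [setLIntegral_const, mul_comm, lintegral_indicator_one (hSm N)]
    have hfin := lintegral_mono (μ := μ) step
    rw [lintegral_const_mul _ hind.lintegral_prod_right', hint',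
      lintegral_const_mul _ hws.lintegral_prod_right', hint,
      volume_closedBall_mul _ (by norm_num) (Nat.cast_nonneg _), ← hV] at hfin
    rw [← ENNReal.mul_le_mul_iff_right hV0 hVt]
    calc V * (l * μ (S N)) = l * (V * μ (S N)) := by ring
      _ ≤ _ := hfin
      _ = V * (ENNReal.ofReal (10 ^ d) * ∫⁻ L, w L ∂μ) := by
        rw [show (10 : ℝ) ^ d = 5 ^ d * 2 ^ d by rw [← mul_pow]; norm_num,
          ENNReal.ofReal_mul (by positivity)]
        ring
  rw [hunion, hmono.measure_iUnion, ENNReal.mul_iSup]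
  refine iSup_le fun N => ?_
  exact (mul_le_mul_right (measure_mono (hmono (Nat.le_succ N))) l).trans (hmain (N + 1) (by omega))

/-- **The pointwise ergodic theorem** for bounded functions, simultaneously for all convex
bodies. -/
theorem ae_avgTendsto [IsProbabilityMeasure μ]
    (hμ : ∀ a : E d, MeasurePreserving (Del.shift (r := r) (R := R) a) μ μ)
    (herg : ∀ S : Set (Del d r R), MeasurableSet S →
      (∀ a : E d, Del.shift a ⁻¹' S = S) → μ S = 0 ∨ μ Sᶜ = 0)
    {h : Del d r R → ℂ} (hh : IsBddMeas h) :
    ∀ᵐ L ∂μ, AvgTendsto (fun b => h (L.shift b)) (∫ L, h L ∂μ) := by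
  set m := ∫ L, h L ∂μ with hm
  let z : Del d r R → ℂ := fun L => h L - m
  have hz : IsBddMeas z := hh.sub (IsBddMeas.const m)
  have hz0 : ∫ L, z L ∂μ = 0 := by
    simp only [z]
    rw [integral_sub (hh.integrable μ) (integrable_const m), integral_const]
    simp [hm]
  -- An error below `4 ^ (-k)`, tested at level `2 ^ (-k)`, has a bad set of measure at most `10 ^ d
  -- * 2 ^ (-k)`, which is summable. The bad sets involve balls only, so one null set serves every
  -- `K`.
  have hε : ∀ k : ℕ, ((4 : ℝ≥0∞)⁻¹) ^ k ≠ 0 := fun k => pow_ne_zero _ (by simp)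
  choose v hv hav hzv using fun k => exists_approx hμ herg hz hz0 (hε k)
  have hwm : ∀ k, Measurable fun L => ‖z L - v k L‖ₑ := fun k => (hz.sub (hv k)).1.enorm
  let T : ℕ → Set (Del d r R) := fun k => {L | ∃ n : ℕ, 1 ≤ n ∧
    ((2 : ℝ≥0∞)⁻¹) ^ k * volume (Metric.closedBall (0 : E d) n)
      ≤ ∫⁻ b in Metric.closedBall 0 n, ‖z (L.shift b) - v k (L.shift b)‖ₑ}
  have hT : ∀ k, μ (T k) ≤ ENNReal.ofReal (10 ^ d) * (2⁻¹ : ℝ≥0∞) ^ k := by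
    intro k
    have h1 := maximal_inequality hμ (hwm k) ((2 : ℝ≥0∞)⁻¹ ^ k)
    have h20 : (2⁻¹ : ℝ≥0∞) ^ k ≠ 0 := pow_ne_zero _ (by simp)
    have h2t : (2⁻¹ : ℝ≥0∞) ^ k ≠ ∞ := ENNReal.pow_ne_top (by simp)
    rw [← ENNReal.mul_le_mul_iff_right h20 h2t]
    refine h1.trans ((mul_le_mul_right (hzv k).le _).trans_eq ?_)
    rw [show (4 : ℝ≥0∞) = 2 * 2 by norm_num, ENNReal.mul_inv (by simp) (by simp), mul_pow]
    ring
  have hsum : ∑' k, μ (T k) ≠ ∞ := by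
    refine ((ENNReal.tsum_le_tsum hT).trans_lt ?_).ne
    rw [ENNReal.tsum_mul_left, ENNReal.tsum_geometric]
    exact ENNReal.mul_lt_top ENNReal.ofReal_lt_top (by simp)
  filter_upwards [ae_eventually_notMem hsum] with L hL
  have hzL : AvgTendsto (fun b => z (L.shift b)) 0 := by
    intro K hK hb
    rw [zero_mul]
    obtain ⟨M, hM⟩ := hb.subset_closedBall 0
    set M' := max M 0 with hM'
    have hKM : K ⊆ Metric.closedBall 0 M' :=
      hM.trans (Metric.closedBall_subset_closedBall (le_max_left _ _))
    set V := volume.real (Metric.closedBall (0 : E d) 1) with hV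
    have key : ∀ k, L ∉ T k → ∀ ρ : ℝ, 1 ≤ ρ →
        ‖((ρ ^ d : ℝ) : ℂ)⁻¹ * ∫ b in ρ • K, (z (L.shift b) - v k (L.shift b))‖
          ≤ (2⁻¹ : ℝ) ^ k * ((M' + 2) ^ d * V) := by
      intro k hk ρ hρ
      have hρ0 : 0 < ρ := by linarith
      -- The added `1` makes the radius positive, as `T k` requires; as `ρ ≥ 1`, the radius is still
      -- at most `(M' + 2) * ρ`.
      set n : ℕ := ⌈M' * ρ⌉₊ + 1 with hn
      have hM'0 : 0 ≤ M' := le_max_right _ _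
      have hn2 : (n : ℝ) ≤ (M' + 2) * ρ := by
        have := Nat.ceil_lt_add_one (a := M' * ρ) (by positivity)
        rw [hn]
        push_cast
        linarith
      have hsub : ρ • K ⊆ Metric.closedBall 0 n := by
        rintro _ ⟨x, hx, rfl⟩
        have h1 := hKM hx
        rw [mem_closedBall_zero_iff] at h1 ⊢
        simp only [norm_smul, Real.norm_of_nonneg hρ0.le]
        have := Nat.le_ceil (M' * ρ)
        rw [hn]
        push_cast
        nlinarith
      have hnot : ∫⁻ b in Metric.closedBall 0 n, ‖z (L.shift b) - v k (L.shift b)‖ₑ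
          ≤ (2⁻¹ : ℝ≥0∞) ^ k * volume (Metric.closedBall (0 : E d) n) := by
        by_contra! hcon
        exact hk ⟨n, by omega, hcon.le⟩
      have hb1 : ‖∫ b in ρ • K, (z (L.shift b) - v k (L.shift b))‖ₑ
          ≤ ENNReal.ofReal ((2⁻¹ : ℝ) ^ k * ((n : ℝ) ^ d * V)) := by
        refine (enorm_integral_le_lintegral_enorm _).trans ?_
        refine (lintegral_mono_set hsub).trans (hnot.trans_eq ?_)
        have := volume_closedBall_mul (0 : E d) (Nat.cast_nonneg n) zero_le_one
        rw [mul_one] at this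
        have h2 : ENNReal.ofReal ((2⁻¹ : ℝ) ^ k) = (2⁻¹ : ℝ≥0∞) ^ k := by
          rw [ENNReal.ofReal_pow (by norm_num), ENNReal.ofReal_inv_of_pos (by norm_num),
            ENNReal.ofReal_ofNat]
        rw [this, ENNReal.ofReal_mul (by positivity), h2, ENNReal.ofReal_mul (by positivity), hV,
          ofReal_measureReal measure_closedBall_lt_top.ne]
      have hb2 : ‖∫ b in ρ • K, (z (L.shift b) - v k (L.shift b))‖
          ≤ (2⁻¹ : ℝ) ^ k * ((n : ℝ) ^ d * V) := by
        rw [← ofReal_norm] at hb1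
        exact (ENNReal.ofReal_le_ofReal_iff (by positivity)).1 hb1
      rw [norm_mul, norm_inv, Complex.norm_real, Real.norm_of_nonneg (by positivity),
        inv_mul_le_iff₀ (by positivity)]
      refine hb2.trans ?_
      calc (2⁻¹ : ℝ) ^ k * ((n : ℝ) ^ d * V) ≤ (2⁻¹ : ℝ) ^ k * (((M' + 2) * ρ) ^ d * V) := by
            gcongr
        _ = _ := by
            rw [mul_pow]
            ring
    rw [Metric.tendsto_nhds]
    intro ε hε
    have hlim : Tendsto (fun k : ℕ => (2⁻¹ : ℝ) ^ k * ((M' + 2) ^ d * V)) atTop (𝓝 0) := by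
      have := (tendsto_pow_atTop_nhds_zero_of_lt_one (by norm_num : (0 : ℝ) ≤ 2⁻¹)
        (by norm_num)).mul_const ((M' + 2) ^ d * V)
      rwa [zero_mul] at this
    obtain ⟨k, hkL, hk⟩ := (hL.and (hlim.eventually (gt_mem_nhds (half_pos hε)))).exists
    have hvk := hav k L K hK hb
    rw [zero_mul, Metric.tendsto_nhds] at hvk
    filter_upwards [hvk (ε / 2) (half_pos hε), eventually_ge_atTop 1] with ρ h1 h2
    have h3 := key k hkL ρ h2
    rw [dist_zero_right] at h1 ⊢
    have hzi := (hz.comp (measurable_shift_left L)).integrableOn (hb.smul₀ ρ)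
    have hvi := ((hv k).comp (measurable_shift_left L)).integrableOn (hb.smul₀ ρ)
    rw [integral_sub hzi hvi, mul_sub] at h3
    have := norm_le_norm_add_norm_sub' (((ρ ^ d : ℝ) : ℂ)⁻¹ * ∫ b in ρ • K, z (L.shift b))
      (((ρ ^ d : ℝ) : ℂ)⁻¹ * ∫ b in ρ • K, v k (L.shift b))
    linarith
  have := hzL.add (avgTendsto_const m) (hz.comp (measurable_shift_left L)) (IsBddMeas.const m)
  simpa [z] using this

end Aperiodic
end

noncomputable section

namespace Aperiodic

open ProbabilityTheory

/-! ### Averages over the points of a pattern -/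

variable {d : ℕ} {r R : ℝ}

lemma tsum_eq_sum_of_forall_eq_zero (L : Del d r R) {F : Finset (E d)} (hF : ∀ x ∈ F, x ∈ L.1)
    {f : E d → ℂ} (hf : ∀ x ∈ L.1, x ∉ F → f x = 0) : ∑' x : L.1, f x = ∑ x ∈ F, f x := by
  classical
  have h : ∑' x : L.1, f x = ∑ x ∈ F.subtype (· ∈ L.1), f x := by
    refine tsum_eq_sum fun x hx => hf x x.2 fun h => hx ?_
    simpa using h
  rw [h, ← Finset.sum_subtype_of_mem f hF]

variable [hr : Fact (0 < r)]

omit hr in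
lemma ptsMeasure_singleton (L : Del d r R) {y : E d} (hy : y ∈ L.1) : ptsMeasure L {y} = 1 := by
  rw [ptsMeasure_apply L (measurableSet_singleton y), tsum_eq_single ⟨y, hy⟩]
  · simp
  · intro x hx
    have h : x.1 ≠ y := fun h => hx (Subtype.ext h)
    simp [h]

lemma hasFiniteSupport_integral_ptsMeasure (L : Del d r R) {F : Finset (E d)}
    (hF : ∀ x ∈ F, x ∈ L.1) {f : E d → ℂ} (hf : ∀ x ∈ L.1, x ∉ F → f x = 0) :
    Integrable f (ptsMeasure L) ∧ ∫ x, f x ∂(ptsMeasure L) = ∑ x ∈ F, f x := by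
  classical
  have hae : f =ᵐ[ptsMeasure L] fun x => ∑ y ∈ F, ({y} : Set (E d)).indicator (fun _ => f y) x := by
    refine (ae_ptsMeasure_iff L).2 fun x hx => ?_
    beta_reduce
    by_cases hxF : x ∈ F
    · rw [Finset.sum_eq_single x]
      · simp
      · intro y _ hy
        simp [hy.symm]
      · exact fun h => absurd hxF h
    · rw [hf x hx hxF, Finset.sum_eq_zero]
      intro y hy
      refine indicator_of_notMem (fun h => hxF ?_) _
      rw [mem_singleton_iff] at h
      rwa [h]
  have hint : ∀ y ∈ F, Integrable (({y} : Set (E d)).indicator fun _ => f y) (ptsMeasure L) := by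
    intro y hy
    refine (integrable_indicator_iff (measurableSet_singleton y)).2 (integrableOn_const ?_)
    rw [ptsMeasure_singleton L (hF y hy)]
    simp
  refine ⟨(integrable_finsetSum F hint).congr hae.symm, ?_⟩
  rw [integral_congr_ae hae, integral_finsetSum F hint]
  refine Finset.sum_congr rfl fun y hy => ?_
  rw [integral_indicator_const _ (measurableSet_singleton y), Measure.real,
    ptsMeasure_singleton L (hF y hy)]
  simp

/-- The finite set of points of the pattern in a bounded region. -/
def Del.finpts (L : Del d r R) {S : Set (E d)} (hS : Bornology.IsBounded S) : Finset (E d) :=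
  (L.finite_inter hS).toFinset

lemma Del.mem_finpts (L : Del d r R) {S : Set (E d)} (hS : Bornology.IsBounded S) {x : E d} :
    x ∈ L.finpts hS ↔ x ∈ L.1 ∧ x ∈ S := by
  simp [Del.finpts]

lemma tsum_eq_sum_finpts (L : Del d r R) {S : Set (E d)} (hS : Bornology.IsBounded S)
    {f : E d → ℂ} (hf : ∀ x ∈ L.1, x ∉ S → f x = 0) :
    ∑' x : L.1, f x = ∑ x ∈ L.finpts hS, f x :=
  tsum_eq_sum_of_forall_eq_zero L (fun _ hx => ((L.mem_finpts hS).1 hx).1)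
    fun _ hx hxF => hf _ hx fun hxS => hxF ((L.mem_finpts hS).2 ⟨hx, hxS⟩)

lemma integral_ptsMeasure_eq_sum (L : Del d r R) {S : Set (E d)} (hS : Bornology.IsBounded S)
    {f : E d → ℂ} (hf : ∀ x ∈ L.1, x ∉ S → f x = 0) :
    Integrable f (ptsMeasure L) ∧ ∫ x, f x ∂(ptsMeasure L) = ∑ x ∈ L.finpts hS, f x :=
  hasFiniteSupport_integral_ptsMeasure L (fun _ hx => ((L.mem_finpts hS).1 hx).1)
    fun _ hx hxF => hf _ hx fun hxS => hxF ((L.mem_finpts hS).2 ⟨hx, hxS⟩)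

lemma integral_ptsMeasure_eq_tsum (L : Del d r R) {S : Set (E d)} (hS : Bornology.IsBounded S)
    {f : E d → ℂ} (hf : ∀ x ∈ L.1, x ∉ S → f x = 0) :
    ∫ x, f x ∂(ptsMeasure L) = ∑' x : L.1, f x := by
  rw [(integral_ptsMeasure_eq_sum L hS hf).2, tsum_eq_sum_finpts L hS hf]

omit hr in
lemma ptsMeasure_ball_le_one (L : Del d r R) (c : E d) : ptsMeasure L (Metric.ball c r) ≤ 1 := by
  have := ptsMeasure_inter_ball univ MeasurableSet.univ c L
  rw [univ_inter] at this
  rw [this]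
  exact indicator_le_self' (by simp) L

/-- A sum over the points in `S` differs from the integral over `S` of its smoothing only by a
boundary term. -/
lemma norm_tsum_sub_setIntegral_le (L : Del d r R) {φ : E d → ℂ} {C : ℝ} (hC0 : 0 ≤ C)
    (hC : ∀ x ∈ L.1, ‖φ x‖ ≤ C) {S : Set (E d)}
    (hS : NullMeasurableSet S (volume : Measure (E d))) (hb : Bornology.IsBounded S) :
    ‖∑' x : L.1, S.indicator φ x - ∫ b in S, (volume.real (Metric.ball (0 : E d) r) : ℂ)⁻¹ *
        ∑' x : L.1, (Metric.ball b r).indicator φ x‖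
      ≤ C * (volume.real (Metric.ball (0 : E d) r))⁻¹ *
        volume.real (Metric.cthickening r (frontier S)) := by
  classical
  set v := volume.real (Metric.ball (0 : E d) r) with hv
  have hv0 : 0 < v := ENNReal.toReal_pos (Metric.measure_ball_pos _ _ hr.out).ne'
    measure_ball_lt_top.ne
  have hvc : (v : ℂ) ≠ 0 := by exact_mod_cast hv0.ne'
  have hbt : Bornology.IsBounded (Metric.thickening r S) := hb.thickening
  set F := L.finpts hbt with hF
  have hST : S ⊆ Metric.thickening r S := Metric.self_subset_thickening hr.out S
  have hFL : ∀ x ∈ F, x ∈ L.1 := fun x hx => ((L.mem_finpts hbt).1 hx).1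
  -- `T x` spreads the mass `φ x` evenly over the ball of radius `r` about `x`.
  let T : E d → E d → ℂ := fun x b => (Metric.ball x r).indicator (fun _ => (v : ℂ)⁻¹ * φ x) b
  have hT : ∀ x, Integrable (T x) := fun x =>
    (integrable_indicator_iff measurableSet_ball).2 (integrableOn_const measure_ball_lt_top.ne)
  have hTint : ∀ x, ∫ b, T x b = φ x := by
    intro x
    simp only [T]
    rw [integral_indicator_const _ measurableSet_ball, Measure.real,
      Measure.addHaar_ball_center, ← Measure.real, ← hv, Complex.real_smul,
      mul_inv_cancel_left₀ hvc]
  have e1 : ∑' x : L.1, S.indicator φ x = ∑ x ∈ F, ∫ b, S.indicator (fun _ => T x b) x := by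
    rw [tsum_eq_sum_finpts L hbt fun x _ hx => indicator_of_notMem (fun h => hx (hST h)) _]
    refine Finset.sum_congr rfl fun x _ => ?_
    by_cases hx : x ∈ S
    · simp [hx, hTint]
    · simp [hx]
  have e2 : ∫ b in S, (v : ℂ)⁻¹ * ∑' x : L.1, (Metric.ball b r).indicator φ x
      = ∑ x ∈ F, ∫ b, S.indicator (T x) b := by
    rw [← integral_indicator₀ hS, ← integral_finsetSum F fun x _ =>
      (hT x).integrableOn.integrable_indicator₀ hS]
    refine integral_congr_ae (ae_of_all _ fun b => ?_)
    by_cases hbS : b ∈ S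
    · simp only [indicator_of_mem hbS]
      rw [tsum_eq_sum_finpts L hbt, Finset.mul_sum]
      · refine Finset.sum_congr rfl fun x _ => ?_
        by_cases hxb : dist x b < r
        · simp [T, hxb, dist_comm b x]
        · simp [T, hxb, dist_comm b x]
      · intro x _ hx
        refine indicator_of_notMem (fun h => hx ?_) _
        exact Metric.mem_thickening_iff.2 ⟨b, hbS, h⟩
    · simp [hbS]
  have hI1 : ∀ x, Integrable fun b => S.indicator (fun _ => T x b) x := by
    intro x
    by_cases hx : x ∈ S
    · simpa [hx] using hT x
    · simp [hx]
  rw [e1, e2, ← Finset.sum_sub_distrib]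
  simp_rw [← integral_sub (hI1 _) ((hT _).integrableOn.integrable_indicator₀ hS)]
  rw [← integral_finsetSum F (f := fun x b => S.indicator (fun _ => T x b) x - S.indicator (T x) b)
    fun x _ => (hI1 x).sub ((hT x).integrableOn.integrable_indicator₀ hS)]
  have hmeas : MeasurableSet (Metric.cthickening r (frontier S)) :=
    Metric.isClosed_cthickening.measurableSet
  have hfin : volume (Metric.cthickening r (frontier S)) ≠ ∞ :=
    ((isCompact_frontier_of_isBounded hb).isBounded.cthickening).measure_lt_top.ne
  calc _ ≤ ∫ b, (Metric.cthickening r (frontier S)).indicator (fun _ => C * v⁻¹) b := by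
        refine norm_integral_le_of_norm_le
          ((integrable_indicator_iff hmeas).2 (integrableOn_const hfin)) (ae_of_all _ fun b => ?_)
        have hnn : 0 ≤ (Metric.cthickening r (frontier S)).indicator (fun _ => C * v⁻¹) b :=
          indicator_nonneg (fun _ _ => by positivity) _
        -- The balls are disjoint, so at most one point contributes at `b`, and its two terms cancel
        -- unless the frontier separates it from `b`.
        by_cases hex : ∃ x ∈ F, dist x b < r
        · obtain ⟨x, hxF, hxb⟩ := hex
          rw [Finset.sum_eq_single_of_mem x hxF]
          · have hTb : T x b = (v : ℂ)⁻¹ * φ x := by simp [T, hxb, dist_comm b x]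
            have hnorm : ‖T x b‖ ≤ C * v⁻¹ := by
              rw [hTb, norm_mul, norm_inv, Complex.norm_real, Real.norm_of_nonneg hv0.le, mul_comm]
              exact mul_le_mul_of_nonneg_right (hC x (hFL x hxF)) (by positivity)
            by_cases h1 : x ∈ S <;> by_cases h2 : b ∈ S
            · simpa [h1, h2] using hnn
            · rw [indicator_of_mem
                (mem_cthickening_frontier_of_mem_of_notMem h1 h2 hxb.le).2]
              simpa [h1, h2] using hnorm
            · rw [indicator_of_mem (mem_cthickening_frontier_of_mem_of_notMem h2 h1
                (by rw [dist_comm]; exact hxb.le)).1]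
              simpa [h1, h2] using hnorm
            · simpa [h1, h2] using hnn
          · intro y hyF hyx
            have hyb : ¬ dist y b < r := fun h =>
              hyx (L.eq_of_mem_ball (hFL y hyF) (hFL x hxF) h hxb)
            have hTb : T y b = 0 := by simp [T, hyb, dist_comm b y]
            simp [indicator, hTb]
        · rw [Finset.sum_eq_zero]
          · simpa using hnn
          · intro y hyF
            have hyb : ¬ dist y b < r := fun h => hex ⟨y, hyF, h⟩
            have hTb : T y b = 0 := by simp [T, hyb, dist_comm b y]
            simp [indicator, hTb]
    _ = _ := by
        rw [integral_indicator_const _ hmeas, smul_eq_mul]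
        ring

variable {μ : Measure (Del d r R)}

/-- The smoothing of a function on the transversal to a function on the hull. -/
def smoothing (g : Del d r R → ℂ) (L : Del d r R) : ℂ :=
  (volume.real (Metric.ball (0 : E d) r) : ℂ)⁻¹ *
    ∫ x, (Metric.ball (0 : E d) r).indicator (fun x => g (L.shift x)) x ∂(ptsMeasure L)

lemma measurable_uncurry_smoothing {g : Del d r R → ℂ} (hg : Measurable g) :
    Measurable fun p : Del d r R × E d =>
      (Metric.ball (0 : E d) r).indicator (fun x => g (p.1.shift x)) p.2 := by
  have : (fun p : Del d r R × E d =>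
      (Metric.ball (0 : E d) r).indicator (fun x => g (p.1.shift x)) p.2)
      = (univ ×ˢ Metric.ball (0 : E d) r).indicator fun p => g (p.1.shift p.2) := by
    ext p
    by_cases h : p.2 ∈ Metric.ball (0 : E d) r
    · rw [indicator_of_mem h,
        indicator_of_mem (show p ∈ univ ×ˢ Metric.ball (0 : E d) r from ⟨trivial, h⟩)]
    · rw [indicator_of_notMem h, indicator_of_notMem (show p ∉ univ ×ˢ Metric.ball (0 : E d) r from
        fun h' => h h'.2)]
  rw [this]
  exact (hg.comp measurable_shift).indicator (MeasurableSet.univ.prod measurableSet_ball)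

lemma isBddMeas_smoothing {g : Del d r R → ℂ} (hg : IsBddMeas g) : IsBddMeas (smoothing g) := by
  refine IsBddMeas.const_mul ⟨?_, ?_⟩ _
  · have := (measurable_uncurry_smoothing hg.1).stronglyMeasurable.integral_kernel_prod_right'
      (κ := pts d r R)
    simp_rw [pts_apply] at this
    exact this.measurable
  · obtain ⟨C, hC0, hC⟩ := hg.bdd
    refine ⟨C, hC0, fun L => ?_⟩
    rw [integral_indicator measurableSet_ball]
    have h1 := ptsMeasure_ball_le_one L (0 : E d)
    refine (norm_setIntegral_le_of_norm_le_const (h1.trans_lt ENNReal.one_lt_top)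
      fun x _ => hC (L.shift x)).trans ?_
    refine mul_le_of_le_one_right hC0 ?_
    exact ENNReal.toReal_le_of_le_ofReal zero_le_one (by simpa using h1)

lemma smoothing_shift (g : Del d r R → ℂ) (L : Del d r R) (b : E d) :
    smoothing g (L.shift b) = (volume.real (Metric.ball (0 : E d) r) : ℂ)⁻¹ *
      ∑' x : L.1, (Metric.ball b r).indicator (fun x => g (L.shift x)) x := by
  rw [smoothing, integral_ptsMeasure_eq_tsum (L.shift b) (Metric.isBounded_ball (x := 0) (r := r))
    (fun x _ hx => indicator_of_notMem hx _)]
  congr 1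
  let ψ : (L.shift b).1 ≃ L.1 :=
    { toFun := fun x => ⟨x.1 + b, x.2⟩
      invFun := fun x => ⟨x.1 - b, by rw [Del.mem_shift, sub_add_cancel]; exact x.2⟩
      left_inv := fun x => by simp
      right_inv := fun x => by simp }
  rw [← ψ.tsum_eq]
  refine tsum_congr fun x => ?_
  simp only [ψ, Equiv.coe_fn_mk, Del.shift_shift, indicator, Metric.mem_ball,
    dist_eq_norm, add_sub_cancel_right, add_comm b, sub_zero]

/-- Campbell's formula for the product of `g` with the indicator of the ball: the integral
factorises and the normalising volume cancels. -/
lemma integral_smoothing [IsFiniteMeasure μ]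
    (hμ : ∀ a : E d, MeasurePreserving (Del.shift (r := r) (R := R) a) μ μ)
    {g : Del d r R → ℂ} (hg : IsBddMeas g) :
    ∫ L, smoothing g L ∂μ = ∫ L, g L ∂(transverseMeasure μ) := by
  have hm : Measurable fun p : Del d r R × E d => (p.1.shift p.2, p.2) :=
    measurable_shift.prodMk measurable_snd
  set v := volume.real (Metric.ball (0 : E d) r) with hv
  have hv0 : 0 < v := ENNReal.toReal_pos (Metric.measure_ball_pos _ _ hr.out).ne'
    measure_ball_lt_top.ne
  have hvc : (v : ℂ) ≠ 0 := by exact_mod_cast hv0.ne'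
  let G : Del d r R × E d → ℂ := fun p =>
    g p.1 * (Metric.ball (0 : E d) r).indicator (fun _ => (1 : ℂ)) p.2
  have hG : Integrable G ((transverseMeasure μ).prod volume) :=
    (hg.integrable _).mul_prod
      ((integrable_indicator_iff measurableSet_ball).2 (integrableOn_const measure_ball_lt_top.ne))
  have hG2 := hG
  rw [← map_campbell hμ, integrable_map_measure (map_campbell hμ ▸ hG.1) hm.aemeasurable] at hG2
  have key : ∫ L, ∫ x, (Metric.ball (0 : E d) r).indicator (fun x => g (L.shift x)) x
      ∂(ptsMeasure L) ∂μ = v * ∫ L, g L ∂(transverseMeasure μ) := by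
    have h1 := Measure.integral_compProd hG2
    simp only [Function.comp_def] at h1
    rw [← integral_map (f := G) hm.aemeasurable (map_campbell hμ ▸ hG.1), map_campbell hμ] at h1
    rw [integral_prod_mul, integral_indicator_const _ measurableSet_ball, ← hv, mul_comm,
      Complex.real_smul, mul_one] at h1
    rw [h1]
    refine integral_congr_ae (ae_of_all _ fun L => ?_)
    beta_reduce
    rw [pts_apply]
    refine integral_congr_ae (ae_of_all _ fun x => ?_)
    by_cases hx : x ∈ Metric.ball (0 : E d) r
    · simp [G, indicator_of_mem hx]
    · simp [G, indicator_of_notMem hx]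
  simp only [smoothing]
  rw [integral_const_mul, key, inv_mul_cancel_left₀ hvc]

/-- For `𝐏`-almost every pattern the sums of a bounded function over the points in dilated convex
bodies are asymptotic to its mean times the volume. -/
theorem ae_tendsto_tsum [IsProbabilityMeasure μ]
    (hμ : ∀ a : E d, MeasurePreserving (Del.shift (r := r) (R := R) a) μ μ)
    (herg : ∀ S : Set (Del d r R), MeasurableSet S →
      (∀ a : E d, Del.shift a ⁻¹' S = S) → μ S = 0 ∨ μ Sᶜ = 0)
    {g : Del d r R → ℂ} (hg : IsBddMeas g) :
    ∀ᵐ L ∂(transverseMeasure μ), ∀ K : Set (E d), Convex ℝ K → Bornology.IsBounded K →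
      Tendsto (fun ρ : ℝ => ((ρ ^ d : ℝ) : ℂ)⁻¹ *
        ∑' x : L.1, (ρ • K).indicator (fun x => g (L.shift x)) x) atTop
        (𝓝 ((∫ L, g L ∂(transverseMeasure μ)) * (volume.real K : ℂ))) := by
  -- A `μ`-almost sure statement yields, for `𝐏`-almost every pattern, only some good translate.
  -- That is enough, since averages do not depend on the base point.
  filter_upwards [ae_exists_shift_of_ae hμ (ae_avgTendsto hμ herg (isBddMeas_smoothing hg))]
    with L ⟨a, ha⟩ K hK hb
  simp_rw [Del.shift_shift, add_comm a] at ha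
  have h1 := AvgTendsto.translate ((isBddMeas_smoothing hg).comp (measurable_shift_left L)) ha
  rw [integral_smoothing hμ hg] at h1
  have h2 := h1 K hK hb
  obtain ⟨C, hC0, hC⟩ := hg.bdd
  have h3 : Tendsto (fun ρ : ℝ => ((ρ ^ d : ℝ) : ℂ)⁻¹ *
      (∑' x : L.1, (ρ • K).indicator (fun x => g (L.shift x)) x -
        ∫ b in ρ • K, smoothing g (L.shift b))) atTop (𝓝 0) := by
    have hl := (tendsto_volume_cthickening_frontier hK hb hr.out.le).const_mul
      (C * (volume.real (Metric.ball (0 : E d) r))⁻¹)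
    rw [mul_zero] at hl
    refine squeeze_zero_norm' ?_ hl
    filter_upwards [eventually_gt_atTop 0] with ρ hρ
    rw [norm_mul, norm_inv, Complex.norm_real, Real.norm_of_nonneg (by positivity), mul_left_comm]
    simp_rw [smoothing_shift]
    exact mul_le_mul_of_nonneg_left (norm_tsum_sub_setIntegral_le L hC0 (fun x _ => hC _)
      (nullMeasurableSet_smul hK ρ) (hb.smul₀ ρ)) (by positivity)
  have h4 := h3.add h2
  rw [zero_add] at h4
  refine h4.congr fun ρ => ?_
  ring

end Aperiodic
end

noncomputable section

namespace Aperiodic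

/-! ### Operators on `ℓ²` -/

section Hilbert

variable {H : Type} [NormedAddCommGroup H] [InnerProductSpace ℂ H] [CompleteSpace H]

/-- Holds because `|T|² = T* T`. It bounds the diagonal entries of `|T|` by `‖T e_x‖` without a
polar decomposition. -/
lemma norm_absOp_apply (T : H →L[ℂ] H) (v : H) : ‖absOp T v‖ = ‖T v‖ := by
  have hsa : IsSelfAdjoint (absOp T) := IsSelfAdjoint.of_nonneg (CFC.abs_nonneg T)
  have hadj : ContinuousLinearMap.adjoint (absOp T) = absOp T := hsa
  have hmul : absOp T * absOp T = ContinuousLinearMap.adjoint T * T := CFC.abs_mul_abs T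
  have h : inner ℂ (absOp T v) (absOp T v) = inner ℂ (T v) (T v) := by
    calc inner ℂ (absOp T v) (absOp T v)
        = inner ℂ (ContinuousLinearMap.adjoint (absOp T) v) (absOp T v) := by rw [hadj]
      _ = inner ℂ v ((absOp T * absOp T) v) := by
          rw [ContinuousLinearMap.adjoint_inner_left]
          rfl
      _ = inner ℂ v (ContinuousLinearMap.adjoint T (T v)) := by
          rw [hmul]
          rfl
      _ = inner ℂ (T v) (T v) := ContinuousLinearMap.adjoint_inner_right _ _ _
  rw [inner_self_eq_norm_sq_to_K, inner_self_eq_norm_sq_to_K] at h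
  have h' : ‖absOp T v‖ ^ 2 = ‖T v‖ ^ 2 := by exact_mod_cast h
  exact (sq_eq_sq₀ (norm_nonneg _) (norm_nonneg _)).1 h'

end Hilbert

section Kernels

variable {ι : Type}

lemma inner_e_left (x : ι) (ψ : ell2 ι) : inner ℂ (e x) ψ = ψ x := by
  classical
  rw [e, lp.inner_single_left]
  simp

lemma e_apply [DecidableEq ι] (x y : ι) : e x y = if y = x then (1 : ℂ) else 0 := by
  rw [e]
  simp only [lp.coeFn_single, Pi.single_apply]
  congr

lemma norm_e (x : ι) : ‖e x‖ = 1 := by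
  classical
  rw [e, lp.norm_single (by norm_num)]
  simp

lemma sum_norm_sq_le (ψ : ell2 ι) (t : Finset ι) : ∑ y ∈ t, ‖ψ y‖ ^ 2 ≤ ‖ψ‖ ^ 2 := by
  have := lp.sum_rpow_le_norm_rpow (p := 2) (by simp) ψ t
  simpa using this

/-- The sesquilinear form of the kernel `k` on finitely supported vectors is bounded by `C`. -/
def IsFormBound (k : ι → ι → ℂ) (C : ℝ) : Prop :=
  ∀ (s t : Finset ι) (u v : ι → ℂ),
    ‖∑ x ∈ s, ∑ y ∈ t, starRingEnd ℂ (u x) * k x y * v y‖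
      ≤ C * √(∑ x ∈ s, ‖u x‖ ^ 2) * √(∑ y ∈ t, ‖v y‖ ^ 2)

lemma sqrt_le_of_le_mul_sqrt {A C : ℝ} (hA : 0 ≤ A) (hC : 0 ≤ C) (h : A ≤ C * √A) : A ≤ C ^ 2 := by
  have h1 := Real.sq_sqrt hA
  have h2 := Real.sqrt_nonneg A
  have h3 : √A ≤ C := by
    rcases h2.eq_or_lt with h0 | h0
    · rw [← h0]
      exact hC
    · nlinarith
  nlinarith

/-- The form is tested against the conjugate of the row. This puts the rows in `ℓ²`; for a singleton
it bounds a single entry by `C`. -/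
lemma IsFormBound.row {k : ι → ι → ℂ} {C : ℝ} (hC : 0 ≤ C) (h : IsFormBound k C) (x : ι)
    (t : Finset ι) : ∑ y ∈ t, ‖k x y‖ ^ 2 ≤ C ^ 2 := by
  have h1 := h {x} t (fun _ => 1) (fun y => starRingEnd ℂ (k x y))
  have h2 : ∀ y, k x y * starRingEnd ℂ (k x y) = ((‖k x y‖ ^ 2 : ℝ) : ℂ) := fun y => by
    rw [Complex.mul_conj, Complex.normSq_eq_norm_sq]
  simp only [Finset.sum_singleton, map_one, one_mul, norm_one, one_pow, Real.sqrt_one, mul_one,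
    h2, RCLike.norm_conj] at h1
  rw [← Complex.ofReal_sum, Complex.norm_real,
    Real.norm_of_nonneg (Finset.sum_nonneg fun _ _ => by positivity)] at h1
  exact sqrt_le_of_le_mul_sqrt (Finset.sum_nonneg fun _ _ => by positivity) hC h1

/-- A kernel with bounded form defines a bounded operator. -/
theorem IsFormBound.exists_op {k : ι → ι → ℂ} {C : ℝ} (hC : 0 ≤ C) (h : IsFormBound k C) :
    ∃ T, IsOpOfKernel k T := by
  have hrow : ∀ x, Memℓp (fun y => starRingEnd ℂ (k x y)) 2 := fun x =>
    memℓp_gen' (C := C ^ 2) fun t => by simpa using h.row hC x t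
  let ρ : ι → ell2 ι := fun x => ⟨fun y => starRingEnd ℂ (k x y), hrow x⟩
  have hρ : ∀ (x : ι) (ψ : ell2 ι), HasSum (fun y => k x y * ψ y) (inner ℂ (ρ x) ψ) := by
    intro x ψ
    have := lp.hasSum_inner (𝕜 := ℂ) (ρ x) ψ
    refine this.congr_fun fun y => ?_
    simp [ρ, mul_comm]
  have hbound : ∀ (ψ : ell2 ι) (s : Finset ι),
      ∑ x ∈ s, ‖inner ℂ (ρ x) ψ‖ ^ 2 ≤ (C * ‖ψ‖) ^ 2 := by
    intro ψ s
    refine sqrt_le_of_le_mul_sqrt (Finset.sum_nonneg fun _ _ => by positivity) (by positivity) ?_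
    -- Testing the form with the image of `ψ` itself, cut down to `s`, gives `‖u‖² ≤ C ‖ψ‖ ‖u‖`.
    set u : ι → ℂ := fun x => inner ℂ (ρ x) ψ with hu
    have hlim : HasSum (fun y => ∑ x ∈ s, starRingEnd ℂ (u x) * (k x y * ψ y))
        (∑ x ∈ s, starRingEnd ℂ (u x) * u x) :=
      hasSum_sum fun x _ => (hρ x ψ).mul_left _
    have hle : ∀ t : Finset ι, ‖∑ y ∈ t, ∑ x ∈ s, starRingEnd ℂ (u x) * (k x y * ψ y)‖
        ≤ C * ‖ψ‖ * √(∑ x ∈ s, ‖u x‖ ^ 2) := by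
      intro t
      rw [Finset.sum_comm]
      simp_rw [← mul_assoc]
      refine (h s t u ψ).trans ?_
      rw [mul_right_comm]
      gcongr
      exact Real.sqrt_le_iff.2 ⟨norm_nonneg _, sum_norm_sq_le ψ t⟩
    have hfin := le_of_tendsto (Filter.Tendsto.norm hlim) (Eventually.of_forall hle)
    refine le_trans (le_of_eq ?_) hfin
    have h2 : ∀ x, starRingEnd ℂ (u x) * u x = ((‖u x‖ ^ 2 : ℝ) : ℂ) := fun x => by
      rw [mul_comm, Complex.mul_conj, Complex.normSq_eq_norm_sq]
    simp_rw [h2]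
    rw [← Complex.ofReal_sum, Complex.norm_real,
      Real.norm_of_nonneg (Finset.sum_nonneg fun _ _ => by positivity)]
  have hmem : ∀ ψ : ell2 ι, Memℓp (fun x => inner ℂ (ρ x) ψ) 2 := fun ψ =>
    memℓp_gen' (C := (C * ‖ψ‖) ^ 2) fun s => by simpa using hbound ψ s
  let T₀ : ell2 ι →ₗ[ℂ] ell2 ι :=
    { toFun := fun ψ => ⟨fun x => inner ℂ (ρ x) ψ, hmem ψ⟩
      map_add' := fun ψ φ => by
        ext x
        exact inner_add_right _ _ _
      map_smul' := fun c ψ => by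
        ext x
        exact inner_smul_right _ _ _ }
  refine ⟨T₀.mkContinuous C fun ψ => ?_, fun ψ x => hρ x ψ⟩
  refine lp.norm_le_of_forall_sum_le (by simp) (by positivity) fun s => ?_
  simpa [T₀] using hbound ψ s

/-- The hypothesis is additive in the squared norms, the shape that localising an integral
inequality produces. Rescaling `u` against `v` and rotating the phase turns the arithmetic mean into
the geometric one. -/
lemma isFormBound_of_re_le {k : ι → ι → ℂ} {C : ℝ}
    (h : ∀ (s t : Finset ι) (u v : ι → ℂ),
      (∑ x ∈ s, ∑ y ∈ t, starRingEnd ℂ (u x) * k x y * v y).re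
        ≤ C / 2 * (∑ x ∈ s, ‖u x‖ ^ 2 + ∑ y ∈ t, ‖v y‖ ^ 2)) : IsFormBound k C := by
  intro s t u v
  set Q := ∑ x ∈ s, ∑ y ∈ t, starRingEnd ℂ (u x) * k x y * v y with hQ
  set A := ∑ x ∈ s, ‖u x‖ ^ 2 with hA
  set D := ∑ y ∈ t, ‖v y‖ ^ 2 with hD
  have hA0 : 0 ≤ A := Finset.sum_nonneg fun _ _ => by positivity
  have hD0 : 0 ≤ D := Finset.sum_nonneg fun _ _ => by positivity
  have key : ∀ a b : ℂ, (starRingEnd ℂ a * b * Q).re ≤ C / 2 * (‖a‖ ^ 2 * A + ‖b‖ ^ 2 * D) := by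
    intro a b
    have := h s t (fun x => a * u x) (fun y => b * v y)
    simp only [map_mul, norm_mul, mul_pow] at this
    rw [← Finset.mul_sum, ← Finset.mul_sum] at this
    refine le_trans (le_of_eq ?_) this
    rw [hQ, Finset.mul_sum]
    congr 1
    refine Finset.sum_congr rfl fun x _ => ?_
    rw [Finset.mul_sum]
    refine Finset.sum_congr rfl fun y _ => ?_
    ring
  -- choose the phase of `b` so that the form is real and nonnegative
  obtain ⟨θ, hθ, hθQ⟩ : ∃ θ : ℂ, ‖θ‖ = 1 ∧ θ * Q = (‖Q‖ : ℂ) := by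
    by_cases hQ0 : Q = 0
    · exact ⟨1, by simp, by simp [hQ0]⟩
    · refine ⟨(‖Q‖ : ℂ) / Q, ?_, div_mul_cancel₀ _ hQ0⟩
      rw [norm_div, Complex.norm_real, norm_norm, div_self (norm_ne_zero_iff.2 hQ0)]
  have key2 : ∀ a b : ℝ, 0 ≤ a → 0 ≤ b → a * b * ‖Q‖ ≤ C / 2 * (a ^ 2 * A + b ^ 2 * D) := by
    intro a b ha hb
    have := key a (b * θ)
    rw [Complex.conj_ofReal, show (a : ℂ) * (b * θ) * Q = ((a * b : ℝ) : ℂ) * (θ * Q) by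
      push_cast; ring, hθQ, ← Complex.ofReal_mul, Complex.ofReal_re] at this
    simpa [hθ, abs_of_nonneg ha, abs_of_nonneg hb] using this
  have hsA := Real.sq_sqrt hA0
  have hsD := Real.sq_sqrt hD0
  -- Degenerate case: if one of the vectors has norm zero, blowing it up forces the form to vanish.
  have zero_of : ∀ F : ℝ, (∀ n : ℕ, (n : ℝ) * ‖Q‖ ≤ F) → ‖Q‖ ≤ 0 := by
    intro F hF
    by_contra! hpos
    obtain ⟨n, hn⟩ := exists_nat_gt (F / ‖Q‖)
    rw [div_lt_iff₀ hpos] at hn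
    exact absurd (hF n) (not_le.2 hn)
  rcases hA0.eq_or_lt with h0 | h0
  · have : ‖Q‖ ≤ 0 := zero_of (C / 2 * D) fun n => by
      have := key2 n 1 (Nat.cast_nonneg n) zero_le_one
      rw [← h0] at this
      simpa using this
    rw [← h0]
    simpa using this
  rcases hD0.eq_or_lt with h1 | h1
  · have : ‖Q‖ ≤ 0 := zero_of (C / 2 * A) fun n => by
      have := key2 1 n zero_le_one (Nat.cast_nonneg n)
      rw [← h1] at this
      simpa using this
    rw [← h1]
    simpa using this
  have hsA0 : 0 < √A := Real.sqrt_pos.2 h0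
  have hsD0 : 0 < √D := Real.sqrt_pos.2 h1
  -- The optimal scaling: both terms on the right become `A * D`.
  have h3 := key2 (√D) (√A) hsD0.le hsA0.le
  rw [hsA, hsD] at h3
  have h4 : √D * √A * ‖Q‖ ≤ √D * √A * (C * √A * √D) := by
    refine h3.trans (le_of_eq ?_)
    rw [show √D * √A * (C * √A * √D) = C * (√D ^ 2 * √A ^ 2) by ring, hsA, hsD]
    ring
  exact le_of_mul_le_mul_left h4 (by positivity)

lemma IsOpOfKernel.apply_e {k : ι → ι → ℂ} {T : ell2 ι →L[ℂ] ell2 ι} (hT : IsOpOfKernel k T)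
    (x y : ι) : T (e y) x = k x y := by
  classical
  refine (hT (e y) x).unique ?_
  have := hasSum_single (f := fun z => k x z * e y z) y fun z hz => by
    rw [e_apply, if_neg hz, mul_zero]
  simpa [e_apply] using this

lemma isOpOfKernel_opOfKernel {k : ι → ι → ℂ} (h : ∃ T, IsOpOfKernel k T) :
    IsOpOfKernel k (opOfKernel k) := by
  rw [opOfKernel, dif_pos h]
  exact h.choose_spec

lemma isFormBound_diag [DecidableEq ι] {w : ι → ℂ} {C : ℝ} (hw : ∀ x, ‖w x‖ ≤ C) :
    IsFormBound (fun x y => if x = y then w x else 0) C := by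
  intro s t u v
  have e1 : ∑ x ∈ s, ∑ y ∈ t, starRingEnd ℂ (u x) * (if x = y then w x else 0) * v y
      = ∑ x ∈ s ∩ t, starRingEnd ℂ (u x) * w x * v x := by
    rw [← Finset.filter_mem_eq_inter, Finset.sum_filter]
    refine Finset.sum_congr rfl fun x _ => ?_
    simp
  rw [e1]
  rcases (s ∩ t).eq_empty_or_nonempty with h0 | ⟨x₀, -⟩
  · rw [h0, Finset.sum_empty, norm_zero]
    by_cases hne : Nonempty ι
    · have : 0 ≤ C := (norm_nonneg _).trans (hw hne.some)
      positivity
    · have : IsEmpty ι := not_nonempty_iff.1 hne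
      rw [Finset.eq_empty_of_isEmpty s]
      simp
  have hC : 0 ≤ C := (norm_nonneg _).trans (hw x₀)
  calc ‖∑ x ∈ s ∩ t, starRingEnd ℂ (u x) * w x * v x‖
      ≤ ∑ x ∈ s ∩ t, C * (‖u x‖ * ‖v x‖) := by
        refine norm_sum_le_of_le _ fun x _ => ?_
        rw [norm_mul, norm_mul, RCLike.norm_conj, mul_right_comm, mul_comm]
        exact mul_le_mul_of_nonneg_right (hw x) (by positivity)
    _ ≤ C * (√(∑ x ∈ s ∩ t, ‖u x‖ ^ 2) * √(∑ x ∈ s ∩ t, ‖v x‖ ^ 2)) := by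
        rw [← Finset.mul_sum]
        exact mul_le_mul_of_nonneg_left (Real.sum_mul_le_sqrt_mul_sqrt _ _ _) hC
    _ ≤ _ := by
        rw [mul_assoc]
        gcongr
        · exact Finset.inter_subset_left
        · exact Finset.inter_subset_right

variable {T W : ell2 ι →L[ℂ] ell2 ι} {w : ι → ℂ}

lemma apply_e_of_diag [DecidableEq ι]
    (hW : IsOpOfKernel (fun x y => if x = y then w x else 0) W) (x : ι) : W (e x) = w x • e x := by
  ext y
  rw [hW.apply_e]
  by_cases h : y = x
  · simp [h, e_apply]
  · simp [h, e_apply]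

/-- The diagonal of `|T W|` is dominated by `‖T W e_x‖ ≤ ‖T‖ |w x|`. -/
lemma isTraceClass_mul_of_diag (hW : ∀ x, W (e x) = w x • e x) (hs : Summable fun x => ‖w x‖) :
    IsTraceClass (T * W) := by
  refine Summable.of_norm_bounded (hs.mul_left ‖T‖) fun x => ?_
  calc ‖(inner ℂ (e x) (absOp (T * W) (e x))).re‖
      ≤ ‖inner ℂ (e x) (absOp (T * W) (e x))‖ := Complex.abs_re_le_norm _
    _ ≤ ‖e x‖ * ‖absOp (T * W) (e x)‖ := norm_inner_le_norm _ _
    _ = ‖T (W (e x))‖ := by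
        rw [norm_e, one_mul, norm_absOp_apply]
        rfl
    _ ≤ ‖T‖ * ‖w x‖ := by
        refine (T.le_opNorm _).trans_eq ?_
        rw [hW, norm_smul, norm_e, mul_one]

lemma opTrace_mul_of_diag {k : ι → ι → ℂ} (hT : IsOpOfKernel k T)
    (hW : ∀ x, W (e x) = w x • e x) : opTrace (T * W) = ∑' x, k x x * w x := by
  refine tsum_congr fun x => ?_
  rw [inner_e_left, mul_apply_eq_comp, hW, map_smul, lp.coeFn_smul, Pi.smul_apply,
    hT.apply_e, smul_eq_mul, mul_comm]

end Kernels

end Aperiodic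
end

noncomputable section

namespace Aperiodic

/-! ### Residues of Dirichlet series -/

section Residue

variable {ι : Type} {u : ι → ℝ} {g : ι → ℂ} {C D α : ℝ} {m : ℂ}

lemma integrableOn_rpow_neg {σ c : ℝ} (hσ : 0 < σ) (hc : 0 < c) :
    IntegrableOn (fun v : ℝ => v ^ (-σ - 1)) (Ioi c) :=
  integrableOn_Ioi_rpow_of_lt (by linarith) hc

lemma integral_rpow_neg {σ c : ℝ} (hσ : 0 < σ) (hc : 0 < c) :
    ∫ v in Ioi c, v ^ (-σ - 1) = c ^ (-σ) / σ := by
  rw [integral_Ioi_rpow_of_lt (by linarith) hc, sub_add_cancel, neg_div_neg_eq]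

lemma integrableOn_cpow_neg {s : ℂ} {c : ℝ} (hs : 0 < s.re) (hc : 0 < c) :
    IntegrableOn (fun v : ℝ => (v : ℂ) ^ (-s - 1)) (Ioi c) :=
  integrableOn_Ioi_cpow_of_lt (by rw [Complex.sub_re, Complex.neg_re, Complex.one_re]; linarith) hc

lemma integral_cpow_neg {s : ℂ} {c : ℝ} (hs : 0 < s.re) (hc : 0 < c) :
    ∫ v in Ioi c, (v : ℂ) ^ (-s - 1) = (c : ℂ) ^ (-s) / s := by
  rw [integral_Ioi_cpow_of_lt
    (by rw [Complex.sub_re, Complex.neg_re, Complex.one_re]; linarith) hc,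
    sub_add_cancel, neg_div_neg_eq]

/-- The summatory function `∑_{u i < v} g i`. -/
def summatory (u : ι → ℝ) (g : ι → ℂ) (v : ℝ) : ℂ := ∑' i, (Ioi (u i)).indicator (fun _ => g i) v

/-- At most `D v ^ α` of the numbers `u i ≥ 1` are less than `v`. -/
structure IsGrowthBound (u : ι → ℝ) (D α : ℝ) : Prop where
  one_le : ∀ i, 1 ≤ u i
  nonneg : 0 ≤ D
  count : ∀ v, 1 ≤ v →
    ∑' i, (Ioi (u i)).indicator (fun _ => (1 : ℝ≥0∞)) v ≤ ENNReal.ofReal (D * v ^ α)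

namespace IsGrowthBound

lemma summable_count (hu : IsGrowthBound u D α) {v : ℝ} (hv : 1 ≤ v) :
    Summable (fun i => (Ioi (u i)).indicator (fun _ => (1 : ℝ)) v) ∧
      ∑' i, (Ioi (u i)).indicator (fun _ => (1 : ℝ)) v ≤ D * v ^ α := by
  have h := hu.count v hv
  have hne : ∑' i, (Ioi (u i)).indicator (fun _ => (1 : ℝ≥0∞)) v ≠ ∞ :=
    (h.trans_lt ENNReal.ofReal_lt_top).ne
  have heq : ∀ i, ((Ioi (u i)).indicator (fun _ => (1 : ℝ≥0∞)) v).toReal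
      = (Ioi (u i)).indicator (fun _ => (1 : ℝ)) v := fun i => by
    by_cases hi : v ∈ Ioi (u i)
    · simp only [indicator_of_mem hi, ENNReal.toReal_one]
    · simp only [indicator_of_notMem hi, ENNReal.toReal_zero]
  have hs := ENNReal.summable_toReal hne
  simp_rw [heq] at hs
  refine ⟨hs, ?_⟩
  have h2 := ENNReal.toReal_le_of_le_ofReal
    (mul_nonneg hu.nonneg (Real.rpow_nonneg (by linarith) _)) h
  rw [ENNReal.tsum_toReal_eq (fun i => ENNReal.ne_top_of_tsum_ne_top hne i)] at h2
  simp_rw [heq] at h2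
  exact h2

lemma summable_summatory (hu : IsGrowthBound u D α) (hg : ∀ i, ‖g i‖ ≤ C) {v : ℝ} (hv : 1 ≤ v) :
    Summable (fun i => (Ioi (u i)).indicator (fun _ => g i) v) ∧
      ‖summatory u g v‖ ≤ |C| * (D * v ^ α) := by
  obtain ⟨h1, h2⟩ := hu.summable_count hv
  have hle : ∀ i, ‖(Ioi (u i)).indicator (fun _ => g i) v‖
      ≤ |C| * (Ioi (u i)).indicator (fun _ => (1 : ℝ)) v := fun i => by
    by_cases hi : v ∈ Ioi (u i)
    · simpa only [indicator_of_mem hi, mul_one] using (hg i).trans (le_abs_self C)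
    · simp only [indicator_of_notMem hi, norm_zero, mul_zero, le_refl]
  refine ⟨Summable.of_norm_bounded (h1.mul_left |C|) hle, ?_⟩
  refine (tsum_of_norm_bounded (h1.mul_left |C|).hasSum hle).trans ?_
  rw [tsum_mul_left]
  exact mul_le_mul_of_nonneg_left h2 (abs_nonneg C)

/-- Layer cake: `u ^ (-σ) / σ` is the integral of `v ^ (-σ - 1)` over `v > u`. Tonelli turns the sum
into an integral of the counting function, finite for `σ > α`. -/
lemma summable_rpow [Countable ι] (hu : IsGrowthBound u D α) {σ : ℝ} (hσ0 : 0 < σ) (hσ : α < σ) :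
    Summable fun i => u i ^ (-σ) := by
  have hpos : ∀ i, 0 < u i := fun i => by linarith [hu.one_le i]
  have e1 : ∀ i, ENNReal.ofReal (u i ^ (-σ) / σ)
      = ∫⁻ v in Ioi (1 : ℝ), (Ioi (u i)).indicator (fun _ => (1 : ℝ≥0∞)) v *
        ENNReal.ofReal (v ^ (-σ - 1)) := by
    intro i
    rw [← integral_rpow_neg hσ0 (hpos i), ofReal_integral_eq_lintegral_ofReal
      (integrableOn_rpow_neg hσ0 (hpos i))]
    · have : ∀ v, (Ioi (u i)).indicator (fun _ => (1 : ℝ≥0∞)) v * ENNReal.ofReal (v ^ (-σ - 1))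
          = (Ioi (u i)).indicator (fun v => ENNReal.ofReal (v ^ (-σ - 1))) v := fun v => by
        by_cases hv : v ∈ Ioi (u i)
        · simp only [indicator_of_mem hv, one_mul]
        · simp only [indicator_of_notMem hv, zero_mul]
      simp_rw [this]
      rw [lintegral_indicator measurableSet_Ioi, Measure.restrict_restrict measurableSet_Ioi,
        inter_eq_self_of_subset_left (Ioi_subset_Ioi (hu.one_le i))]
    · filter_upwards [ae_restrict_mem measurableSet_Ioi] with v hv
      exact Real.rpow_nonneg ((hpos i).trans hv).le _
  have hfin : ∑' i, ENNReal.ofReal (u i ^ (-σ) / σ) ≠ ∞ := by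
    simp_rw [e1]
    rw [← lintegral_tsum]
    · simp_rw [ENNReal.tsum_mul_right]
      refine ne_of_lt (lt_of_le_of_lt (setLIntegral_mono' measurableSet_Ioi (g := fun v =>
        ENNReal.ofReal (D * v ^ (-(σ - α) - 1))) fun v hv => ?_) ?_)
      · have hv1 : (1 : ℝ) < v := hv
        have hv0 : 0 < v := by linarith
        refine (mul_le_mul_left (hu.count v hv1.le) _).trans_eq ?_
        rw [← ENNReal.ofReal_mul (mul_nonneg hu.nonneg (Real.rpow_nonneg hv0.le _)), mul_assoc,
          ← Real.rpow_add hv0]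
        ring_nf
      · have hi := (integrableOn_rpow_neg (sub_pos.2 hσ) one_pos).const_mul D
        refine lt_of_le_of_lt (lintegral_mono fun v => ?_) hi.2
        exact Real.ofReal_le_enorm _
    · intro i
      exact ((measurable_const.indicator measurableSet_Ioi).mul
        (by fun_prop)).aemeasurable
  have := ENNReal.summable_toReal hfin
  have h2 : ∀ i, (ENNReal.ofReal (u i ^ (-σ) / σ)).toReal = u i ^ (-σ) / σ := fun i =>
    ENNReal.toReal_ofReal (div_nonneg (Real.rpow_nonneg (hpos i).le _) hσ0.le)
  simp_rw [h2] at this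
  exact (summable_div_const_iff hσ0.ne').1 this

lemma norm_cpow (hu : IsGrowthBound u D α) (i : ι) (s : ℂ) :
    ‖(u i : ℂ) ^ s‖ = u i ^ s.re :=
  Complex.norm_cpow_eq_rpow_re_of_pos (by linarith [hu.one_le i]) s

/-- On a half plane `σ < Re s` with `σ > α` the series is dominated by the one at `σ`, so holomorphy
follows locally. -/
lemma differentiableOn_tsum [Countable ι] (hu : IsGrowthBound u D α) (hα : 0 < α)
    (hg : ∀ i, ‖g i‖ ≤ C) :
    DifferentiableOn ℂ (fun s : ℂ => ∑' i, g i * (u i : ℂ) ^ (-s)) {s | α < s.re} := by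
  intro s hs
  obtain ⟨σ, h1, h2⟩ := exists_between (show α < s.re from hs)
  have hopen : IsOpen {s : ℂ | σ < s.re} := isOpen_lt continuous_const Complex.continuous_re
  have hd : DifferentiableOn ℂ (fun s : ℂ => ∑' i, g i * (u i : ℂ) ^ (-s)) {s | σ < s.re} := by
    refine Complex.differentiableOn_tsum_of_summable_norm
      ((hu.summable_rpow (hα.trans h1) h1).mul_left C) (fun i => ?_) hopen fun i w hw => ?_
    · have : (u i : ℂ) ≠ 0 := by exact_mod_cast (by linarith [hu.one_le i] : u i ≠ 0)
      refine DifferentiableOn.const_mul ?_ _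
      exact (differentiable_neg.const_cpow (Or.inl this)).differentiableOn
    · rw [norm_mul, hu.norm_cpow, Complex.neg_re]
      have hC : 0 ≤ C := (norm_nonneg _).trans (hg i)
      refine mul_le_mul (hg i) ?_ (Real.rpow_nonneg (by linarith [hu.one_le i]) _) hC
      exact Real.rpow_le_rpow_of_exponent_le (hu.one_le i) (neg_le_neg (le_of_lt hw))
  exact (hd.differentiableAt (hopen.mem_nhds h2)).differentiableWithinAt

lemma aestronglyMeasurable_summatory [Countable ι] (hu : IsGrowthBound u D α)
    (hg : ∀ i, ‖g i‖ ≤ C) :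
    AEStronglyMeasurable (summatory u g) (volume.restrict (Ioi (1 : ℝ))) := by
  refine aestronglyMeasurable_of_tendsto_ae (atTop : Filter (Finset ι))
    (f := fun F v => ∑ i ∈ F, (Ioi (u i)).indicator (fun _ => g i) v) (fun F => ?_) ?_
  · exact (Finset.measurable_sum F fun i _ =>
      measurable_const.indicator measurableSet_Ioi).aestronglyMeasurable
  · filter_upwards [ae_restrict_mem measurableSet_Ioi] with v hv
    exact (hu.summable_summatory hg (le_of_lt hv)).1.hasSum

/-- Abel summation. -/
lemma tsum_eq_integral [Countable ι] (hu : IsGrowthBound u D α) (hα : 0 < α)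
    (hg : ∀ i, ‖g i‖ ≤ C) {s : ℂ} (hs : α < s.re) :
    ∑' i, g i * (u i : ℂ) ^ (-s)
      = s * ∫ v in Ioi (1 : ℝ), summatory u g v * (v : ℂ) ^ (-s - 1) := by
  have hpos : ∀ i, 0 < u i := fun i => by linarith [hu.one_le i]
  have hs0 : 0 < s.re := hα.trans hs
  have hsne : s ≠ 0 := fun h => by simp [h] at hs0
  let F : ι → ℝ → ℂ := fun i v => (Ioi (u i)).indicator (fun v => g i * (v : ℂ) ^ (-s - 1)) v
  have hres : ∀ i, (volume.restrict (Ioi (1 : ℝ))).restrict (Ioi (u i))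
      = volume.restrict (Ioi (u i)) := fun i => by
    rw [Measure.restrict_restrict measurableSet_Ioi,
      inter_eq_self_of_subset_left (Ioi_subset_Ioi (hu.one_le i))]
  have hF1 : ∀ i, Integrable (F i) (volume.restrict (Ioi 1)) := fun i => by
    refine (integrable_indicator_iff measurableSet_Ioi).2 ?_
    rw [IntegrableOn, hres]
    exact (integrableOn_cpow_neg hs0 (hpos i)).const_mul _
  have hF2 : ∀ i, ∫ v in Ioi (1 : ℝ), F i v = g i * ((u i : ℂ) ^ (-s) / s) := fun i => by
    simp only [F]
    rw [integral_indicator measurableSet_Ioi, hres, integral_const_mul,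
      integral_cpow_neg hs0 (hpos i)]
  have hF3 : ∀ i, ∫ v in Ioi (1 : ℝ), ‖F i v‖ = ‖g i‖ * (u i ^ (-s.re) / s.re) := fun i => by
    simp only [F, norm_indicator_eq_indicator_norm, norm_mul]
    rw [integral_indicator measurableSet_Ioi, hres, integral_const_mul,
      ← integral_rpow_neg hs0 (hpos i)]
    congr 1
    refine setIntegral_congr_fun measurableSet_Ioi fun v hv => ?_
    rw [Complex.norm_cpow_eq_rpow_re_of_pos ((hpos i).trans hv)]
    simp
  have hF4 : Summable fun i => ∫ v in Ioi (1 : ℝ), ‖F i v‖ := by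
    simp_rw [hF3]
    refine Summable.of_nonneg_of_le (fun i => ?_) (fun i => ?_)
      (((hu.summable_rpow hs0 hs).div_const s.re).mul_left C)
    · have := Real.rpow_nonneg (hpos i).le (-s.re)
      positivity
    · have := Real.rpow_nonneg (hpos i).le (-s.re)
      exact mul_le_mul_of_nonneg_right (hg i) (by positivity)
  have h := (hasSum_integral_of_summable_integral_norm hF1 hF4).tsum_eq
  simp_rw [hF2] at h
  have h5 : ∀ v, ∑' i, F i v = summatory u g v * (v : ℂ) ^ (-s - 1) := fun v => by
    rw [summatory, ← tsum_mul_right]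
    refine tsum_congr fun i => ?_
    simp only [F]
    by_cases hv : v ∈ Ioi (u i)
    · simp only [indicator_of_mem hv]
    · simp only [indicator_of_notMem hv, zero_mul]
  simp_rw [h5] at h
  rw [← h, ← tsum_mul_left]
  refine tsum_congr fun i => ?_
  field_simp

end IsGrowthBound

lemma cpow_mul_rpow {v : ℝ} (hv : 0 < v) (α : ℝ) (s : ℂ) :
    ((v ^ α : ℝ) : ℂ) * (v : ℂ) ^ (-s - 1) = (v : ℂ) ^ (-(s - α) - 1) := by
  rw [Complex.ofReal_cpow hv.le, ← Complex.cpow_add _ _ (by exact_mod_cast hv.ne')]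
  ring_nf

/-- If `∑_{u i < v} g i ∼ m v ^ α`, then `∑ g i (u i) ^ (-s)` has residue `α m` at `s = α`. -/
theorem hasResidueAt_tsum [Countable ι] (hu : IsGrowthBound u D α) (hα : 0 < α)
    (hg : ∀ i, ‖g i‖ ≤ C)
    (hm : Tendsto (fun v : ℝ => ((v ^ α : ℝ) : ℂ)⁻¹ * summatory u g v) atTop (𝓝 m)) :
    HasResidueAt (fun s => ∑' i, g i * (u i : ℂ) ^ (-s)) α (α * m) := by
  refine ⟨hu.differentiableOn_tsum hα hg, fun κ => ?_⟩
  set M := summatory u g with hM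
  have hMm := hu.aestronglyMeasurable_summatory hg
  obtain ⟨D', hD'0, hD'⟩ : ∃ D', 0 ≤ D' ∧ ∀ v : ℝ, 1 ≤ v → ‖M v - m * (v ^ α : ℝ)‖ ≤ D' * v ^ α := by
    refine ⟨|C| * D + ‖m‖, add_nonneg (mul_nonneg (abs_nonneg _) hu.nonneg) (norm_nonneg _),
      fun v hv => ?_⟩
    have hv0 : 0 ≤ v ^ α := Real.rpow_nonneg (by linarith) _
    have h1 := (hu.summable_summatory hg hv).2
    refine (norm_sub_le _ _).trans ?_
    rw [norm_mul, Complex.norm_real, Real.norm_of_nonneg hv0, add_mul]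
    linarith
  have hbase : ∀ s : ℂ, α < s.re →
      IntegrableOn (fun v : ℝ => v ^ (-(s.re - α) - 1)) (Ioi (1 : ℝ)) := fun s hs =>
    integrableOn_rpow_neg (sub_pos.2 hs) one_pos
  have hnormv : ∀ (s : ℂ) (v : ℝ), 1 < v → v ^ α * ‖(v : ℂ) ^ (-s - 1)‖ = v ^ (-(s.re - α) - 1) := by
    intro s v hv
    have hv0 : 0 < v := by linarith
    rw [Complex.norm_cpow_eq_rpow_re_of_pos hv0, ← Real.rpow_add hv0]
    simp
    ring_nf
  have hintR : ∀ s : ℂ, α < s.re →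
      IntegrableOn (fun v : ℝ => (M v - m * (v ^ α : ℝ)) * (v : ℂ) ^ (-s - 1)) (Ioi (1 : ℝ)) := by
    intro s hs
    refine Integrable.mono' ((hbase s hs).const_mul D') ?_ ?_
    · refine AEStronglyMeasurable.mul (hMm.sub ?_) ?_
      · exact (by fun_prop : Measurable fun v : ℝ => m * ((v ^ α : ℝ) : ℂ)).aestronglyMeasurable
      · exact (integrableOn_cpow_neg (hα.trans hs) one_pos).1
    · filter_upwards [ae_restrict_mem measurableSet_Ioi] with v hv
      rw [norm_mul, ← hnormv s v hv, ← mul_assoc]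
      exact mul_le_mul_of_nonneg_right (hD' v (le_of_lt hv)) (norm_nonneg _)
  -- The leading part `m v ^ α` contributes exactly `m / (s - α)` to the Abel integral, hence the
  -- term `s * m`; only the remainder needs an estimate.
  have hsplit : ∀ s : ℂ, α < s.re → (s - α) * ∑' i, g i * (u i : ℂ) ^ (-s)
      = s * m + (s - α) * s *
        ∫ v in Ioi (1 : ℝ), (M v - m * (v ^ α : ℝ)) * (v : ℂ) ^ (-s - 1) := by
    intro s hs
    have hsα : s - α ≠ 0 := fun h => by
      have := congrArg Complex.re h
      simp at this
      linarith
    have hre : 0 < (s - α).re := by simpa using hs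
    rw [hu.tsum_eq_integral hα hg hs]
    have hi2 : IntegrableOn (fun v : ℝ => m * (v : ℂ) ^ (-(s - α) - 1)) (Ioi (1 : ℝ)) :=
      (integrableOn_cpow_neg hre one_pos).const_mul m
    have : ∫ v in Ioi (1 : ℝ), M v * (v : ℂ) ^ (-s - 1)
        = (∫ v in Ioi (1 : ℝ), (M v - m * (v ^ α : ℝ)) * (v : ℂ) ^ (-s - 1)) + m / (s - α) := by
      have e : ∫ v in Ioi (1 : ℝ), m * (v : ℂ) ^ (-(s - α) - 1) = m / (s - α) := by
        rw [integral_const_mul, integral_cpow_neg hre one_pos]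
        simp [div_eq_mul_inv]
      rw [← e, ← integral_add (hintR s hs) hi2]
      refine setIntegral_congr_fun measurableSet_Ioi fun v hv => ?_
      rw [← cpow_mul_rpow (one_pos.trans hv)]
      ring
    rw [this]
    field_simp
    ring
  -- Beyond `V` the remainder is at most `ε v ^ α`, which costs `ε / (Re s - α)`; up to `V` it
  -- contributes a constant independent of `s`.
  have hbound : ∀ ε > 0, ∃ V : ℝ, 0 ≤ V ∧ ∀ s : ℂ, α < s.re →
      ‖∫ v in Ioi (1 : ℝ), (M v - m * (v ^ α : ℝ)) * (v : ℂ) ^ (-s - 1)‖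
        ≤ ε / (s.re - α) + D' * V := by
    intro ε hε
    obtain ⟨V, hV⟩ := eventually_atTop.1 (Metric.tendsto_nhds.1 hm ε hε)
    refine ⟨max V 1, by positivity, fun s hs => ?_⟩
    have hI : Integrable ((Ioc 1 (max V 1)).indicator fun _ => D')
        (volume.restrict (Ioi (1 : ℝ))) :=
      (integrable_indicator_iff measurableSet_Ioc).2
        (integrableOn_const ((Measure.restrict_apply_le _ _).trans_lt measure_Ioc_lt_top).ne)
    calc _ ≤ ∫ v in Ioi (1 : ℝ), (ε * v ^ (-(s.re - α) - 1)
          + (Ioc 1 (max V 1)).indicator (fun _ => D') v) := by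
          refine norm_integral_le_of_norm_le (((hbase s hs).const_mul ε).add hI) ?_
          filter_upwards [ae_restrict_mem measurableSet_Ioi] with v hv
          have hv1 : (1 : ℝ) < v := hv
          have hv0 : 0 < v := by linarith
          have hvα : 0 < v ^ α := Real.rpow_pos_of_pos hv0 _
          rw [norm_mul]
          by_cases hvV : v ≤ max V 1
          · rw [indicator_of_mem (show v ∈ Ioc 1 (max V 1) from ⟨hv1, hvV⟩)]
            have h1 : ‖M v - m * (v ^ α : ℝ)‖ * ‖(v : ℂ) ^ (-s - 1)‖
                ≤ D' * v ^ (-(s.re - α) - 1) := by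
              rw [← hnormv s v hv1, ← mul_assoc]
              exact mul_le_mul_of_nonneg_right (hD' v hv1.le) (norm_nonneg _)
            have h2 : v ^ (-(s.re - α) - 1) ≤ 1 :=
              Real.rpow_le_one_of_one_le_of_nonpos hv1.le (by linarith)
            have h3 : 0 ≤ v ^ (-(s.re - α) - 1) := Real.rpow_nonneg hv0.le _
            nlinarith
          · rw [indicator_of_notMem (fun h => hvV h.2), add_zero, ← hnormv s v hv1, ← mul_assoc]
            refine mul_le_mul_of_nonneg_right ?_ (norm_nonneg _)
            have h1 := (hV v (by
              have := le_max_left V 1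
              push Not at hvV
              linarith)).le
            rw [dist_eq_norm] at h1
            have h2 : M v - m * (v ^ α : ℝ)
                = ((v ^ α : ℝ) : ℂ) * (((v ^ α : ℝ) : ℂ)⁻¹ * M v - m) := by
              have : ((v ^ α : ℝ) : ℂ) ≠ 0 := by exact_mod_cast hvα.ne'
              field_simp
            rw [h2, norm_mul, Complex.norm_real, Real.norm_of_nonneg hvα.le, mul_comm]
            exact mul_le_mul_of_nonneg_right h1 hvα.le
      _ = ε * (1 / (s.re - α)) + D' * (max V 1 - 1) := by
          rw [integral_add ((hbase s hs).const_mul ε) hI, integral_const_mul,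
            integral_rpow_neg (sub_pos.2 hs) one_pos, Real.one_rpow,
            integral_indicator_const _ measurableSet_Ioc, Measure.real,
            Measure.restrict_apply measurableSet_Ioc,
            inter_eq_self_of_subset_left Ioc_subset_Ioi_self, Real.volume_Ioc,
            ENNReal.toReal_ofReal (by linarith [le_max_right V 1]), smul_eq_mul, mul_comm D']
      _ ≤ _ := by
          rw [mul_one_div]
          nlinarith
  set 𝓕 := 𝓝[{s : ℂ | α < s.re ∧ ‖s - α‖ ≤ κ * (s.re - α)}] (α : ℂ) with h𝓕
  have hmem : ∀ᶠ s : ℂ in 𝓕, α < s.re ∧ ‖s - α‖ ≤ κ * (s.re - α) := eventually_mem_nhdsWithin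
  have hid : Tendsto (fun s : ℂ => s) 𝓕 (𝓝 (α : ℂ)) := tendsto_nhdsWithin_of_tendsto_nhds tendsto_id
  have herr : Tendsto (fun s : ℂ => (s - α) * s *
      ∫ v in Ioi (1 : ℝ), (M v - m * (v ^ α : ℝ)) * (v : ℂ) ^ (-s - 1)) 𝓕 (𝓝 0) := by
    rw [Metric.tendsto_nhds]
    intro η hη
    -- In the sector `‖s - α‖ / (Re s - α) ≤ |κ|`, so the error bound tends to `α * |κ| * ε`, which
    -- this choice keeps below `η`.
    set ε := η / (2 * (|κ| + 1) * (α + 1)) with hε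
    have hε0 : 0 < ε := by positivity
    obtain ⟨V, hV0, hV⟩ := hbound ε hε0
    have hlim : Tendsto (fun s : ℂ => ‖s‖ * (|κ| * ε + ‖s - α‖ * (D' * V))) 𝓕
        (𝓝 (‖(α : ℂ)‖ * (|κ| * ε + ‖(α : ℂ) - α‖ * (D' * V)))) :=
      hid.norm.mul (tendsto_const_nhds.add ((hid.sub_const _).norm.mul_const _))
    have hlt : ‖(α : ℂ)‖ * (|κ| * ε + ‖(α : ℂ) - α‖ * (D' * V)) < η := by
      rw [sub_self, norm_zero, zero_mul, add_zero, Complex.norm_real, Real.norm_of_nonneg hα.le]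
      have h1 : ε * (2 * (|κ| + 1) * (α + 1)) = η := div_mul_cancel₀ _ (by positivity)
      have h2 := abs_nonneg κ
      nlinarith [mul_nonneg h2 hε0.le, mul_nonneg (mul_nonneg h2 hε0.le) hα.le,
        mul_pos hε0 hα]
    filter_upwards [hmem, hlim.eventually (gt_mem_nhds hlt)] with s ⟨hs1, hs2⟩ hs3
    rw [dist_zero_right]
    refine lt_of_le_of_lt ?_ hs3
    have hpos : 0 < s.re - α := sub_pos.2 hs1
    rw [norm_mul, norm_mul, mul_comm ‖s - α‖, mul_assoc]
    refine mul_le_mul_of_nonneg_left ?_ (norm_nonneg _)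
    calc _ ≤ ‖s - α‖ * (ε / (s.re - α) + D' * V) :=
          mul_le_mul_of_nonneg_left (hV s hs1) (norm_nonneg _)
      _ = (‖s - α‖ / (s.re - α)) * ε + ‖s - α‖ * (D' * V) := by ring
      _ ≤ _ := by
          gcongr
          rw [div_le_iff₀ hpos]
          exact hs2.trans (mul_le_mul_of_nonneg_right (le_abs_self κ) hpos.le)
  have hmain : Tendsto (fun s : ℂ => s * m + (s - α) * s *
      ∫ v in Ioi (1 : ℝ), (M v - m * (v ^ α : ℝ)) * (v : ℂ) ^ (-s - 1)) 𝓕 (𝓝 (α * m)) := by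
    have := (hid.mul_const m).add herr
    rwa [add_zero] at this
  refine hmain.congr' ?_
  filter_upwards [hmem] with s hs
  exact (hsplit s hs.1).symm

end Residue

end Aperiodic
end

noncomputable section

namespace Aperiodic

open ProbabilityTheory

/-! ### The groupoid measure -/

variable {d : ℕ} {r R : ℝ} {L₀ : Del d r R} {μ : Measure (Del d r R)}

lemma ev_of_mem (f : Gpd L₀ → ℂ) {L : Del d r R} {x : E d} (h : L ∈ transversal L₀ ∧ x ∈ L.1) :
    ev f L x = f ⟨(L, x), h⟩ :=
  dif_pos h

lemma ev_val (f : Gpd L₀ → ℂ) (γ : Gpd L₀) : ev f γ.1.1 γ.1.2 = f γ := ev_of_mem f γ.2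

lemma ev_of_notMem (f : Gpd L₀ → ℂ) {L : Del d r R} {x : E d}
    (h : ¬(L ∈ transversal L₀ ∧ x ∈ L.1)) : ev f L x = 0 :=
  dif_neg h

/-- The inclusion of the groupoid in `Del × ℝᵈ`. -/
def Gpd.val (γ : Gpd L₀) : Del d r R × E d := γ.1

variable [hr : Fact (0 < r)]

lemma isClosedEmbedding_val : IsClosedEmbedding (Gpd.val (L₀ := L₀)) :=
  (isClosed_gpd L₀).isClosedEmbedding_subtypeVal

lemma measurableEmbedding_val : MeasurableEmbedding (Gpd.val (L₀ := L₀)) :=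
  isClosedEmbedding_val.measurableEmbedding

lemma measurable_ev {f : Gpd L₀ → ℂ} (hf : Measurable f) :
    Measurable fun p : Del d r R × E d => ev f p.1 p.2 := by
  have h : (fun p : Del d r R × E d => ev f p.1 p.2)
      = Function.extend Gpd.val f (fun _ => 0) := by
    funext p
    by_cases hp : p.1 ∈ transversal L₀ ∧ p.2 ∈ p.1.1
    · rw [ev_of_mem f hp]
      exact (measurableEmbedding_val.injective.extend_apply f _ (⟨p, hp⟩ : Gpd L₀)).symm
    · rw [ev_of_notMem f hp, Function.extend_apply']
      rintro ⟨γ, rfl⟩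
      exact hp γ.2
  rw [h]
  exact measurableEmbedding_val.measurable_extend hf measurable_const

omit hr in
lemma tsum_fibre (L : Del d r R) {H : Del d r R × E d → ℝ≥0∞}
    (hH : ∀ p ∉ range (Gpd.val (L₀ := L₀)), H p = 0) :
    ∑' γ : {γ : Gpd L₀ // γ.1.1 = L}, H γ.1.val = ∑' x : L.1, H (L, x) := by
  have hinj : Function.Injective fun γ : {γ : Gpd L₀ // γ.1.1 = L} =>
      (⟨γ.1.1.2, by have := γ.1.2.2; rw [γ.2] at this; exact this⟩ : L.1) := by
    intro γ γ' h
    exact Subtype.ext (Subtype.ext (Prod.ext (γ.2.trans γ'.2.symm) (congrArg Subtype.val h)))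
  rw [← hinj.tsum_eq]
  · refine tsum_congr ?_
    rintro ⟨⟨⟨L1, x⟩, h⟩, rfl⟩
    rfl
  · intro x hx
    have : (L, x.1) ∈ range (Gpd.val (L₀ := L₀)) := by
      by_contra hc
      exact hx (hH _ hc)
    obtain ⟨γ, hγ⟩ := this
    refine ⟨⟨γ, congrArg Prod.fst hγ⟩, Subtype.ext (congrArg Prod.snd hγ)⟩

lemma fibre_apply (L : Del d r R) {A : Set (Gpd L₀)} (hA : MeasurableSet A) :
    (Measure.sum fun γ : {γ : Gpd L₀ // γ.1.1 = L} => Measure.dirac γ.1) A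
      = ∫⁻ x, (Gpd.val '' A).indicator 1 (L, x) ∂(ptsMeasure L) := by
  rw [Measure.sum_apply _ hA, lintegral_ptsMeasure, ← tsum_fibre L (L₀ := L₀)]
  · refine tsum_congr fun γ => ?_
    rw [Measure.dirac_apply' _ hA]
    by_cases h : γ.1 ∈ A
    · rw [indicator_of_mem h, indicator_of_mem (mem_image_of_mem _ h)]
      rfl
    · rw [indicator_of_notMem h, indicator_of_notMem]
      rwa [measurableEmbedding_val.injective.mem_set_image]
  · intro p hp
    refine indicator_of_notMem (fun h => hp ?_) _
    exact image_subset_range _ _ h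

lemma measurable_fibre : Measurable fun L : Del d r R =>
    Measure.sum fun γ : {γ : Gpd L₀ // γ.1.1 = L} => Measure.dirac γ.1 := by
  refine Measure.measurable_of_measurable_coe _ fun A hA => ?_
  simp_rw [fibre_apply _ hA]
  exact measurable_lintegral_pts (measurable_one.indicator
    (measurableEmbedding_val.measurableSet_image' hA))

lemma gpdMeasure_apply [IsFiniteMeasure μ] {A : Set (Gpd L₀)} (hA : MeasurableSet A) :
    gpdMeasure L₀ μ A = fibreMeasure μ (Gpd.val '' A) := by
  have hA' := measurableEmbedding_val.measurableSet_image' hA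
  rw [gpdMeasure, Measure.bind_apply hA measurable_fibre.aemeasurable,
    ← lintegral_indicator_one hA', lintegral_fibreMeasure (measurable_one.indicator hA')]
  simp_rw [fibre_apply _ hA]

lemma ae_mem_transversal [IsFiniteMeasure μ] (hμ : μ (hull L₀)ᶜ = 0) :
    ∀ᵐ L ∂(transverseMeasure μ), L ∈ transversal L₀ := by
  have hm : MeasurableSet (transversal L₀)ᶜ := (isClosed_transversal L₀).measurableSet.compl
  rw [ae_iff, show {L | L ∉ transversal L₀} = (transversal L₀)ᶜ from rfl,
    ← lintegral_indicator_one hm,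
    lintegral_transverse _ (measurable_one.indicator hm),
    lintegral_congr_ae (g := 0) ?_, lintegral_zero_fun]
  filter_upwards [show ∀ᵐ L ∂μ, L ∈ hull L₀ from hμ] with L hL
  rw [lintegral_congr_ae (g := 0) ?_, lintegral_zero_fun]
  · rfl
  rw [EventuallyEq, ae_ptsMeasure_iff]
  intro x hx
  rw [indicator_of_notMem (s := (transversal L₀)ᶜ), mul_zero]
  · rfl
  · exact fun h => h (shift_mem_transversal hL hx)

lemma ae_fibreMeasure_iff [IsFiniteMeasure μ] {p : Del d r R × E d → Prop}
    (hp : MeasurableSet {x | p x}) :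
    (∀ᵐ q ∂(fibreMeasure μ), p q) ↔ ∀ᵐ L ∂(transverseMeasure μ), ∀ x ∈ L.1, p (L, x) := by
  rw [fibreMeasure, Measure.ae_compProd_iff hp]
  simp_rw [pts_apply, ae_ptsMeasure_iff]

/-- The groupoid measure is the restriction of the fibre measure to the groupoid. -/
lemma measurePreserving_val [IsFiniteMeasure μ] (hμ : μ (hull L₀)ᶜ = 0) :
    MeasurePreserving Gpd.val (gpdMeasure L₀ μ) (fibreMeasure μ) := by
  refine ⟨measurableEmbedding_val.measurable, Measure.ext fun A hA => ?_⟩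
  rw [Measure.map_apply measurableEmbedding_val.measurable hA,
    gpdMeasure_apply (measurableEmbedding_val.measurable hA), image_preimage_eq_inter_range]
  have hR : ∀ᵐ q ∂(fibreMeasure μ), q ∈ range (Gpd.val (L₀ := L₀)) := by
    refine (ae_fibreMeasure_iff measurableEmbedding_val.measurableSet_range).2 ?_
    filter_upwards [ae_mem_transversal hμ] with L hL x hx
    exact ⟨⟨(L, x), hL, hx⟩, rfl⟩
  exact measure_congr (inter_ae_eq_left_of_ae_eq_univ (eventuallyEq_univ.2 hR))

lemma ae_ev_eq [IsFiniteMeasure μ] (hμ : μ (hull L₀)ᶜ = 0) {f g : Gpd L₀ → ℂ}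
    (h : f =ᵐ[gpdMeasure L₀ μ] g) :
    ∀ᵐ L ∂(transverseMeasure μ), ∀ x ∈ L.1, ev f L x = ev g L x := by
  obtain ⟨N, hN, hNm, hN0⟩ := exists_measurable_superset_of_null (ae_iff.1 h)
  have hN' := measurableEmbedding_val.measurableSet_image' hNm
  have h1 : ∀ᵐ q ∂(fibreMeasure μ), q ∉ Gpd.val '' N := by
    rw [gpdMeasure_apply hNm] at hN0
    exact measure_eq_zero_iff_ae_notMem.1 hN0
  rw [ae_fibreMeasure_iff hN'.compl] at h1
  filter_upwards [h1, ae_mem_transversal hμ] with L hL hLt x hx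
  rw [ev_of_mem f ⟨hLt, hx⟩, ev_of_mem g ⟨hLt, hx⟩]
  by_contra hc
  exact hL x hx ⟨_, hN hc, rfl⟩

/-- The kernel at `L` sees the function on the fibres over all `L - x`, so the exceptional null set
must be controlled along whole fibres. -/
lemma ae_repKernel_eq [IsFiniteMeasure μ] (hμ : μ (hull L₀)ᶜ = 0)
    (hμ' : ∀ a : E d, MeasurePreserving (Del.shift (r := r) (R := R) a) μ μ)
    (B : Matrix (Fin d) (Fin d) ℝ) {f g : Gpd L₀ → ℂ} (h : f =ᵐ[gpdMeasure L₀ μ] g) :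
    ∀ᵐ L ∂(transverseMeasure μ), repKernel B f L = repKernel B g L := by
  filter_upwards [ae_forall_shift hμ' (ae_ev_eq hμ h)] with L hL
  funext x y
  rw [repKernel, repKernel, hL x.1 x.2 (y.1 - x.1) (by rw [Del.mem_shift, sub_add_cancel]; exact y.2)]

end Aperiodic
end

noncomputable section

namespace Aperiodic

open ProbabilityTheory

/-! ### Fibrewise bounded functions -/

variable {d : ℕ} {r R : ℝ} {μ : Measure (Del d r R)}

/-- Bounded measurable functions on the fibres, supported in a bounded region. -/
structure IsFibreBdd (c : Del d r R × E d → ℂ) : Prop where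
  measurable : Measurable c
  bdd : ∃ M ρ : ℝ, 0 ≤ M ∧ (∀ p, ‖c p‖ ≤ M) ∧ ∀ p, ρ < ‖p.2‖ → c p = 0

variable [hr : Fact (0 < r)]

lemma exists_ptsMeasure_closedBall_le (ρ : ℝ) : ∃ N : ℝ≥0∞, N ≠ ∞ ∧
    ∀ L : Del d r R, ptsMeasure L (Metric.closedBall 0 ρ) ≤ N := by
  refine ⟨_, ?_, fun L => ptsMeasure_le L measurableSet_closedBall⟩
  refine (ENNReal.div_lt_top ?_ (Metric.measure_ball_pos _ _ hr.out).ne').ne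
  exact (Metric.isBounded_closedBall.thickening).measure_lt_top.ne

lemma lintegral_fibreMeasure_le [IsFiniteMeasure μ] {G : Del d r R × E d → ℝ≥0∞}
    {H : Del d r R → ℝ≥0∞} (hG : Measurable G) {ρ : ℝ} {N : ℝ≥0∞}
    (hN : ∀ L : Del d r R, ptsMeasure L (Metric.closedBall 0 ρ) ≤ N)
    (h : ∀ p, G p ≤ H p.1) (h0 : ∀ p, ρ < ‖p.2‖ → G p = 0) :
    ∫⁻ p, G p ∂(fibreMeasure μ) ≤ ∫⁻ L, H L * N ∂(transverseMeasure μ) := by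
  rw [lintegral_fibreMeasure hG]
  refine lintegral_mono fun L => ?_
  calc ∫⁻ x, G (L, x) ∂(ptsMeasure L)
      ≤ ∫⁻ x, (Metric.closedBall 0 ρ).indicator (fun _ => H L) x ∂(ptsMeasure L) := by
        refine lintegral_mono fun x => ?_
        by_cases hx : x ∈ Metric.closedBall (0 : E d) ρ
        · rw [indicator_of_mem hx]
          exact h (L, x)
        · rw [h0 (L, x) (by simpa using hx)]
          exact bot_le
    _ = H L * ptsMeasure L (Metric.closedBall 0 ρ) := by
        rw [lintegral_indicator_const measurableSet_closedBall]
    _ ≤ H L * N := by gcongr; exact hN L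

/-- The number of points in a ball is bounded uniformly over the patterns, so a bounded region of
`x` has finite fibre measure. -/
lemma IsFibreBdd.memLp [IsFiniteMeasure μ] {c : Del d r R × E d → ℂ} (hc : IsFibreBdd c) :
    MemLp c 2 (fibreMeasure μ) := by
  obtain ⟨M, ρ, hM, hcM, hc0⟩ := hc.bdd
  obtain ⟨N, hN, hNL⟩ := exists_ptsMeasure_closedBall_le (d := d) (r := r) (R := R) ρ
  have hS : MeasurableSet {p : Del d r R × E d | ‖p.2‖ ≤ ρ} :=
    measurableSet_le (by fun_prop) measurable_const
  have hfin : fibreMeasure μ {p : Del d r R × E d | ‖p.2‖ ≤ ρ} ≠ ∞ := by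
    rw [← lintegral_indicator_one hS]
    refine ((lintegral_fibreMeasure_le (H := fun _ => 1) (measurable_one.indicator hS) hNL
      (fun p => indicator_le_self' (by simp) p)
      (fun p hp => indicator_of_notMem (by simpa using hp) _)).trans_lt ?_).ne
    rw [lintegral_const]
    exact ENNReal.mul_lt_top (by simpa using hN.lt_top) (measure_lt_top _ _)
  refine (memLp_indicator_const 2 hS (M : ℂ) (Or.inr hfin)).mono
    hc.measurable.aestronglyMeasurable (Eventually.of_forall fun p => ?_)
  by_cases hp : ‖p.2‖ ≤ ρ
  · rw [indicator_of_mem (by exact hp)]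
    simpa [abs_of_nonneg hM] using hcM p
  · rw [hc0 p (not_le.1 hp), norm_zero]
    exact norm_nonneg _

omit hr in
lemma norm_phase (B : Matrix (Fin d) (Fin d) ℝ) (y z : E d) : ‖phase B y z‖ = 1 := by
  rw [phase, Complex.norm_exp]
  simp

omit hr in
lemma measurable_phase (B : Matrix (Fin d) (Fin d) ℝ) :
    Measurable fun p : E d × E d => phase B p.1 p.2 := by
  unfold phase flux
  fun_prop

omit hr in
lemma phase_zero_left (B : Matrix (Fin d) (Fin d) ℝ) (z : E d) : phase B 0 z = 1 := by
  simp [phase, flux]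

omit hr in
lemma phase_self {B : Matrix (Fin d) (Fin d) ℝ} (hB : B.transpose = -B) (z : E d) :
    phase B z z = 1 := by
  have h : flux B 0 z z = 0 := by
    have h1 : ∑ j, ∑ k, B j k * z j * z k = -∑ j, ∑ k, B j k * z j * z k := by
      conv_lhs => rw [Finset.sum_comm]
      rw [← Finset.sum_neg_distrib]
      refine Finset.sum_congr rfl fun j _ => ?_
      rw [← Finset.sum_neg_distrib]
      refine Finset.sum_congr rfl fun k _ => ?_
      have := congrFun (congrFun hB j) k
      rw [Matrix.transpose_apply, Matrix.neg_apply] at this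
      rw [this]
      ring
    simp only [flux, PiLp.zero_apply, sub_zero]
    linarith
  simp [phase, h]

/-! ### The sesquilinear form of a kernel -/

/-- `(L, z) ↦ c(L,z) ∑_{w ∈ L} exp(-iΓ⟨0,w,z⟩) φ(L,w) χ(z-w)`. -/
def convForm (B : Matrix (Fin d) (Fin d) ℝ) (c φ : Del d r R × E d → ℂ) (χ : E d → ℂ)
    (p : Del d r R × E d) : ℂ :=
  c p * ∫ w, phase B w p.2 * φ (p.1, w) * χ (p.2 - w) ∂(ptsMeasure p.1)

/-- `(L, w) ↦ ∑_{z ∈ L} c(L,z) exp(-iΓ⟨0,w,z⟩) χ(z-w)`. -/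
def convDual (B : Matrix (Fin d) (Fin d) ℝ) (c : Del d r R × E d → ℂ) (χ : E d → ℂ)
    (p : Del d r R × E d) : ℂ :=
  ∫ z, c (p.1, z) * phase B p.2 z * χ (z - p.2) ∂(ptsMeasure p.1)

lemma measurable_integral_pts_param {γ : Type*} [MeasurableSpace γ]
    {f : (Del d r R × γ) × E d → ℂ} (hf : Measurable f) :
    Measurable fun p : Del d r R × γ => ∫ x, f (p, x) ∂(ptsMeasure p.1) := by
  have := (hf.stronglyMeasurable.integral_kernel_prod_right'
    (κ := (pts d r R).comap Prod.fst measurable_fst)).measurable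
  simpa only [Kernel.comap_apply, pts_apply] using this

variable {B : Matrix (Fin d) (Fin d) ℝ} {c φ : Del d r R × E d → ℂ} {χ : E d → ℂ}

lemma measurable_convForm (hc : Measurable c) (hφ : Measurable φ) (hχ : Measurable χ) :
    Measurable (convForm B c φ χ) := by
  refine hc.mul (measurable_integral_pts_param
    (f := fun q : (Del d r R × E d) × E d => phase B q.2 q.1.2 * φ (q.1.1, q.2) * χ (q.1.2 - q.2)) ?_)
  exact (((measurable_phase B).fun_comp (by fun_prop : Measurable
    fun q : (Del d r R × E d) × E d => (q.2, q.1.2))).mul (hφ.fun_comp (by fun_prop))).mul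
    (hχ.fun_comp (by fun_prop))

lemma isFibreBdd_convDual (hc : IsFibreBdd c) (hχ : Measurable χ)
    {Mχ ρχ : ℝ} (hχM : ∀ x, ‖χ x‖ ≤ Mχ) (hχ0 : ∀ x, ρχ < ‖x‖ → χ x = 0) :
    IsFibreBdd (convDual B c χ) := by
  obtain ⟨M, ρ, hM, hcM, hc0⟩ := hc.bdd
  obtain ⟨N, hN, hNL⟩ := exists_ptsMeasure_closedBall_le (d := d) (r := r) (R := R) ρ
  have hMχ : 0 ≤ Mχ := (norm_nonneg _).trans (hχM 0)
  refine ⟨measurable_integral_pts_param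
    (f := fun q : (Del d r R × E d) × E d => c (q.1.1, q.2) * phase B q.1.2 q.2 * χ (q.2 - q.1.2)) ?_,
    M * Mχ * N.toReal, ρ + ρχ, by positivity, fun p => ?_, fun p hp => ?_⟩
  · exact ((hc.measurable.fun_comp (by fun_prop)).mul ((measurable_phase B).fun_comp
      (by fun_prop : Measurable fun q : (Del d r R × E d) × E d => (q.1.2, q.2)))).mul
      (hχ.fun_comp (by fun_prop))
  · have h1 : ‖convDual B c χ p‖ₑ ≤ ENNReal.ofReal (M * Mχ) * N := by
      refine (enorm_integral_le_lintegral_enorm _).trans ?_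
      calc ∫⁻ z, ‖c (p.1, z) * phase B p.2 z * χ (z - p.2)‖ₑ ∂(ptsMeasure p.1)
          ≤ ∫⁻ z, (Metric.closedBall 0 ρ).indicator (fun _ => ENNReal.ofReal (M * Mχ)) z
              ∂(ptsMeasure p.1) := by
            refine lintegral_mono fun z => ?_
            by_cases hz : z ∈ Metric.closedBall (0 : E d) ρ
            · rw [indicator_of_mem hz, ← ofReal_norm]
              refine ENNReal.ofReal_le_ofReal ?_
              rw [norm_mul, norm_mul, norm_phase, mul_one]
              exact mul_le_mul (hcM _) (hχM _) (norm_nonneg _) hM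
            · rw [hc0 (p.1, z) (by simpa using hz)]
              simp
        _ ≤ _ := by
            rw [lintegral_indicator_const measurableSet_closedBall]
            gcongr
            exact hNL _
    rw [← ofReal_norm, ← ENNReal.ofReal_toReal hN, ← ENNReal.ofReal_mul (by positivity)] at h1
    exact (ENNReal.ofReal_le_ofReal_iff (by positivity)).1 h1
  · rw [convDual, integral_eq_zero_of_ae]
    refine Eventually.of_forall fun z => ?_
    by_cases hz : ρ < ‖z‖
    · simp [hc0 (p.1, z) hz]
    · have : ρχ < ‖z - p.2‖ := by
        have := norm_sub_norm_le p.2 z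
        rw [norm_sub_rev] at this
        linarith [not_lt.1 hz]
      simp [hχ0 _ this]

/-- Both supports are bounded, so on one fibre this is an exchange of two finite sums. -/
lemma integral_convForm_fibre (L : Del d r R) {ρ ρχ : ℝ} (hc0 : ∀ p, ρ < ‖p.2‖ → c p = 0)
    (hχ0 : ∀ x, ρχ < ‖x‖ → χ x = 0) :
    ∫ z, convForm B c φ χ (L, z) ∂(ptsMeasure L)
      = ∫ w, convDual B c χ (L, w) * φ (L, w) ∂(ptsMeasure L) := by
  have hz0 : ∀ z ∈ L.1, z ∉ Metric.closedBall (0 : E d) ρ → c (L, z) = 0 :=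
    fun z _ hz => hc0 _ (by simpa using hz)
  have hb := Metric.isBounded_closedBall (x := (0 : E d)) (r := ρ)
  have hb' := Metric.isBounded_closedBall (x := (0 : E d)) (r := ρ + ρχ)
  have hw0 : ∀ z w : E d, z ∈ Metric.closedBall (0 : E d) ρ →
      w ∉ Metric.closedBall (0 : E d) (ρ + ρχ) → χ (z - w) = 0 := by
    intro z w hz hw
    refine hχ0 _ ?_
    simp only [mem_closedBall_zero_iff, not_le] at hz hw
    have := norm_sub_norm_le w z
    rw [norm_sub_rev] at this
    linarith
  have hdual : ∀ w, convDual B c χ (L, w)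
      = ∑ z ∈ L.finpts hb, c (L, z) * phase B w z * χ (z - w) := fun w =>
    (integral_ptsMeasure_eq_sum L hb fun z hz hzF => by simp [hz0 z hz hzF]).2
  rw [(integral_ptsMeasure_eq_sum L hb fun z hz hzF => by simp [convForm, hz0 z hz hzF]).2,
    (integral_ptsMeasure_eq_sum L hb' fun w hw hwF => ?_).2]
  · simp_rw [hdual, Finset.sum_mul]
    rw [Finset.sum_comm]
    refine Finset.sum_congr rfl fun z hz => ?_
    rw [convForm, (integral_ptsMeasure_eq_sum L hb' fun w hw hwF => ?_).2, Finset.mul_sum]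
    · exact Finset.sum_congr rfl fun w _ => by ring
    · rw [hw0 z w ((L.mem_finpts hb).1 hz).2 hwF, mul_zero]
  · rw [hdual, Finset.sum_eq_zero, zero_mul]
    intro z hz
    rw [hw0 z w ((L.mem_finpts hb).1 hz).2 hwF, mul_zero]

/-- On each fibre the integrand is dominated by a multiple of the sum of `|φ|` over a larger ball,
integrable as a product of two square integrable functions. -/
lemma integrable_convForm [IsFiniteMeasure μ] (hc : IsFibreBdd c) (hφ : Measurable φ)
    (hφ2 : MemLp φ 2 (fibreMeasure μ)) (hχ : Measurable χ)
    {Mχ ρχ : ℝ} (hχM : ∀ x, ‖χ x‖ ≤ Mχ) (hχ0 : ∀ x, ρχ < ‖x‖ → χ x = 0) :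
    Integrable (convForm B c φ χ) (fibreMeasure μ) := by
  obtain ⟨M, ρ, hM, hcM, hc0⟩ := hc.bdd
  obtain ⟨N, hN, hNL⟩ := exists_ptsMeasure_closedBall_le (d := d) (r := r) (R := R) ρ
  have hMχ : 0 ≤ Mχ := (norm_nonneg _).trans (hχM 0)
  let D : Del d r R × E d → ℂ := {p : Del d r R × E d | ‖p.2‖ ≤ ρ + ρχ}.indicator
    fun _ => ((M * Mχ : ℝ) : ℂ)
  have hS : MeasurableSet {p : Del d r R × E d | ‖p.2‖ ≤ ρ + ρχ} :=
    measurableSet_le (by fun_prop) measurable_const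
  have hD : IsFibreBdd D := by
    refine ⟨measurable_const.indicator hS, M * Mχ, ρ + ρχ, by positivity, fun p => ?_,
      fun p hp => indicator_of_notMem (by simpa using hp) _⟩
    refine (norm_indicator_le_norm_self _ _).trans ?_
    rw [Complex.norm_real, Real.norm_of_nonneg (by positivity)]
  have hDφ : Integrable (D * φ) (fibreMeasure μ) := hD.memLp.integrable_mul hφ2
  have hm := measurable_convForm (B := B) hc.measurable hφ hχ
  refine ⟨hm.aestronglyMeasurable, ?_⟩
  rw [HasFiniteIntegral]
  refine (lintegral_fibreMeasure_le (H := fun L => ∫⁻ w, ‖D (L, w) * φ (L, w)‖ₑ ∂(ptsMeasure L))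
    hm.enorm hNL (fun p => ?_) (fun p hp => by simp [convForm, hc0 p hp])).trans_lt ?_
  · by_cases hp : ρ < ‖p.2‖
    · simp [convForm, hc0 p hp]
    rw [convForm, ← integral_const_mul]
    refine (enorm_integral_le_lintegral_enorm _).trans (lintegral_mono fun w => ?_)
    rw [← ofReal_norm, ← ofReal_norm]
    refine ENNReal.ofReal_le_ofReal ?_
    rw [norm_mul, norm_mul, norm_mul, norm_phase, one_mul, norm_mul]
    by_cases hw : ‖w‖ ≤ ρ + ρχ
    · simp only [D]
      rw [indicator_of_mem (by exact hw), Complex.norm_real, Real.norm_of_nonneg (by positivity)]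
      calc ‖c p‖ * (‖φ (p.1, w)‖ * ‖χ (p.2 - w)‖) ≤ M * (‖φ (p.1, w)‖ * Mχ) := by
            gcongr
            · exact hcM p
            · exact hχM _
        _ = _ := by ring
    · have : ρχ < ‖p.2 - w‖ := by
        have := norm_sub_norm_le w p.2
        rw [norm_sub_rev] at this
        linarith [not_lt.1 hp]
      rw [hχ0 _ this, norm_zero, mul_zero, mul_zero]
      positivity
  · rw [lintegral_mul_const' _ _ hN]
    refine ENNReal.mul_lt_top ?_ hN.lt_top
    have := hDφ.2
    rw [HasFiniteIntegral, lintegral_fibreMeasure (hD.measurable.mul hφ).enorm] at this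
    exact this

lemma integral_fibreMeasure [IsFiniteMeasure μ] {G : Del d r R × E d → ℂ}
    (hG : Integrable G (fibreMeasure μ)) : ∫ p, G p ∂(fibreMeasure μ)
      = ∫ L, ∫ x, G (L, x) ∂(ptsMeasure L) ∂(transverseMeasure μ) := by
  rw [fibreMeasure, Measure.integral_compProd hG]
  simp_rw [pts_apply]

/-- Exhibits the integral as a pairing of `φ` with a fixed square integrable function, hence as a
continuous functional of `φ` in `L²`. -/
lemma integral_convForm [IsFiniteMeasure μ] (hc : IsFibreBdd c) (hφ : Measurable φ)
    (hφ2 : MemLp φ 2 (fibreMeasure μ)) (hχ : Measurable χ)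
    {Mχ ρχ : ℝ} (hχM : ∀ x, ‖χ x‖ ≤ Mχ) (hχ0 : ∀ x, ρχ < ‖x‖ → χ x = 0) :
    ∫ p, convForm B c φ χ p ∂(fibreMeasure μ)
      = ∫ p, convDual B c χ p * φ p ∂(fibreMeasure μ) := by
  have hi : Integrable (fun p => convDual B c χ p * φ p) (fibreMeasure μ) :=
    (isFibreBdd_convDual hc hχ hχM hχ0).memLp.integrable_mul hφ2
  rw [integral_fibreMeasure hi, integral_fibreMeasure (integrable_convForm hc hφ hφ2 hχ hχM hχ0)]
  obtain ⟨M, ρ, hM, hcM, hc0⟩ := hc.bdd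
  exact integral_congr_ae (Eventually.of_forall fun L => integral_convForm_fibre L hc0 hχ0)

end Aperiodic
end

noncomputable section

namespace Aperiodic

open ProbabilityTheory

/-! ### Matrix elements of elements of the von Neumann algebra -/

variable {d : ℕ} {r R : ℝ} {L₀ : Del d r R} {μ : Measure (Del d r R)}
  {B : Matrix (Fin d) (Fin d) ℝ} {χ χ₁ χ₂ : E d → ℂ}

/-- Continuous functions with bounded support. -/
structure IsTest (χ : E d → ℂ) : Prop where
  continuous : Continuous χ
  support : ∃ ρ : ℝ, ∀ x, ρ < ‖x‖ → χ x = 0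

lemma IsTest.bdd (hχ : IsTest χ) : ∃ M, ∀ x, ‖χ x‖ ≤ M := by
  obtain ⟨ρ, hρ⟩ := hχ.support
  refine hχ.continuous.bounded_above_of_compact_support
    (HasCompactSupport.intro (isCompact_closedBall (0 : E d) ρ) fun x hx => hρ x ?_)
  simpa using hx

/-- The function `(L, x) ↦ χ(x) ψ(L - x)`. -/
def prodFun (χ : E d → ℂ) (ψ : C(Del d r R, ℝ)) (p : Del d r R × E d) : ℂ :=
  χ p.2 * (ψ (p.1.shift p.2) : ℂ)

variable [hr : Fact (0 < r)]

instance : T2Space (Gpd L₀) := isClosedEmbedding_val.isEmbedding.t2Space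

lemma continuous_prodFun (hχ : IsTest χ) (ψ : C(Del d r R, ℝ)) : Continuous (prodFun χ ψ) :=
  (hχ.continuous.comp continuous_snd).mul
    (Complex.continuous_ofReal.comp (ψ.continuous.comp Del.continuous_shift))

lemma isFibreBdd_prodFun (hχ : IsTest χ) (ψ : C(Del d r R, ℝ)) : IsFibreBdd (prodFun χ ψ) := by
  obtain ⟨ρ, hρ⟩ := hχ.support
  obtain ⟨M, hM⟩ := hχ.bdd
  have hM0 : 0 ≤ M := (norm_nonneg _).trans (hM 0)
  refine ⟨(continuous_prodFun hχ ψ).measurable, M * ‖ψ‖, ρ, by positivity, fun p => ?_,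
    fun p hp => by simp [prodFun, hρ _ hp]⟩
  rw [prodFun, norm_mul, Complex.norm_real]
  exact mul_le_mul (hM _) (ψ.norm_coe_le_norm _) (norm_nonneg _) hM0

/-- The restriction of `(L, x) ↦ χ(x) ψ(L - x)` to the groupoid. -/
def testFun (L₀ : Del d r R) (hχ : IsTest χ) (ψ : C(Del d r R, ℝ)) : C_c(Gpd L₀, ℂ) where
  toFun γ := prodFun χ ψ γ.val
  continuous_toFun := (continuous_prodFun hχ ψ).comp isClosedEmbedding_val.continuous
  hasCompactSupport' := by
    obtain ⟨ρ, hρ⟩ := hχ.support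
    refine HasCompactSupport.intro (isClosedEmbedding_val.isCompact_preimage
      (isCompact_univ.prod (isCompact_closedBall (0 : E d) ρ))) fun γ hγ => ?_
    have : ρ < ‖γ.val.2‖ := by simpa using hγ
    simp [prodFun, hρ _ this]

lemma testFun_apply (hχ : IsTest χ) (ψ : C(Del d r R, ℝ)) (γ : Gpd L₀) :
    testFun L₀ hχ ψ γ = χ γ.1.2 * (ψ (γ.1.1.shift γ.1.2) : ℂ) :=
  rfl

/-- A continuous bump at the origin that vanishes outside the ball of radius `r`. -/
lemma isTest_hat (c : E d) : IsTest fun x : E d => ((max 0 (1 - ‖x + c‖ / r) : ℝ) : ℂ) := by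
  refine ⟨by fun_prop, r + ‖c‖, fun x hx => ?_⟩
  have h1 := norm_sub_le (x + c) c
  rw [add_sub_cancel_right] at h1
  have : 1 ≤ ‖x + c‖ / r := by
    rw [le_div_iff₀ hr.out]
    linarith
  rw [max_eq_left (by linarith)]
  simp

omit hr in
lemma eq_zero_of_norm_lt (γ : Gpd L₀) (h : ‖γ.1.2‖ < r) : γ.1.2 = 0 := by
  refine γ.1.1.eq_of_mem_ball (c := 0) γ.2.2 γ.2.1.2 (by simpa using h) ?_
  simpa using (norm_nonneg _).trans_lt h

/-- The unit as an element of `C_c(𝒢)`. -/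
def unitCc (L₀ : Del d r R) : C_c(Gpd L₀, ℂ) := testFun L₀ (isTest_hat (r := r) 0) 1

lemma unitCc_apply (γ : Gpd L₀) : unitCc L₀ γ = unitFun L₀ γ := by
  rw [unitCc, testFun_apply, unitFun]
  split_ifs with h
  · simp [h]
  · have : ¬‖γ.1.2‖ < r := fun hlt => h (eq_zero_of_norm_lt γ hlt)
    have : 1 ≤ ‖γ.1.2‖ / r := by
      rw [le_div_iff₀ hr.out]
      linarith
    rw [add_zero, max_eq_left (by linarith)]
    simp

omit hr in
lemma ev_unitFun {L : Del d r R} {x : E d} (h : L ∈ transversal L₀ ∧ x ∈ L.1) :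
    ev (unitFun L₀) L x = open Classical in if x = 0 then 1 else 0 :=
  ev_of_mem _ h

lemma ev_testFun (hχ : IsTest χ) (ψ : C(Del d r R, ℝ)) {L : Del d r R} {x : E d}
    (h : L ∈ transversal L₀ ∧ x ∈ L.1) :
    ev (testFun L₀ hχ ψ) L x = χ x * (ψ (L.shift x) : ℂ) :=
  ev_of_mem _ h

/-- Only `y = x` survives in the convolution, and its phase is trivial because `B` is antisymmetric.
-/
lemma conv_unitFun (hB : B.transpose = -B) (f : Gpd L₀ → ℂ) (γ : Gpd L₀) :
    conv B f (unitFun L₀) γ = f γ := by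
  rw [conv, tsum_eq_single (⟨γ.1.2, γ.2.2⟩ : γ.1.1.1)]
  · have h : γ.1.1.shift γ.1.2 ∈ transversal L₀ := shift_mem_transversal γ.2.1.1 γ.2.2
    rw [phase_self hB, ev_val, sub_self, ev_unitFun ⟨h, h.2⟩, if_pos rfl]
    simp
  · intro y hy
    have h : γ.1.2 - y.1 ≠ 0 := fun h => hy (Subtype.ext (sub_eq_zero.1 h).symm)
    have h0 : ev (unitFun L₀) (γ.1.1.shift y.1) (γ.1.2 - y.1) = 0 := by
      by_cases hm : γ.1.1.shift y.1 ∈ transversal L₀ ∧ γ.1.2 - y.1 ∈ (γ.1.1.shift y.1).1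
      · rw [ev_unitFun hm, if_neg h]
      · exact ev_of_notMem _ hm
    rw [h0, mul_zero]

/-- `(L, x) ↦ ψ(L - x)² conj χ(x)`. -/
def sqFun (χ : E d → ℂ) (ψ : C(Del d r R, ℝ)) (p : Del d r R × E d) : ℂ :=
  ((ψ (p.1.shift p.2) ^ 2 : ℝ) : ℂ) * (starRingEnd ℂ) (χ p.2)

omit hr in
lemma IsTest.conj (hχ : IsTest χ) : IsTest fun x => (starRingEnd ℂ) (χ x) := by
  obtain ⟨ρ, hρ⟩ := hχ.support
  exact ⟨Complex.continuous_conj.comp hχ.continuous, ρ, fun x hx => by simp [hρ x hx]⟩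

lemma isFibreBdd_sqFun (hχ : IsTest χ) (ψ : C(Del d r R, ℝ)) : IsFibreBdd (sqFun χ ψ) := by
  have h : sqFun χ ψ = prodFun (fun x => (starRingEnd ℂ) (χ x)) (ψ ^ 2) := by
    funext p
    simp [sqFun, prodFun, mul_comm]
  rw [h]
  exact isFibreBdd_prodFun hχ.conj _

/-- Since `(L - y) - (x - y) = L - x`, all terms of the convolution carry the same factor `ψ(L -
x)`. Left convolution commutes with multiplication by functions of the source, and this allows
localisation in the pattern. -/
lemma conj_testFun_mul_conv (h₁ : IsTest χ₁) (h₂ : IsTest χ₂) (ψ : C(Del d r R, ℝ))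
    (f : Gpd L₀ → ℂ) (γ : Gpd L₀) :
    (starRingEnd ℂ) (testFun L₀ h₁ ψ γ) * conv B f (testFun L₀ h₂ ψ) γ
      = convForm B (sqFun χ₁ ψ) (fun p => ev f p.1 p.2) χ₂ γ.val := by
  obtain ⟨ρ, hρ⟩ := h₂.support
  have hconv : conv B f (testFun L₀ h₂ ψ) γ
      = (∑' y : γ.1.1.1, phase B y.1 γ.1.2 * ev f γ.1.1 y.1 * χ₂ (γ.1.2 - y.1))
        * (ψ (γ.1.1.shift γ.1.2) : ℂ) := by
    rw [conv, ← tsum_mul_right]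
    refine tsum_congr fun y => ?_
    have hm : γ.1.1.shift y.1 ∈ transversal L₀ ∧ γ.1.2 - y.1 ∈ (γ.1.1.shift y.1).1 :=
      ⟨shift_mem_transversal γ.2.1.1 y.2, by
        rw [Del.mem_shift, sub_add_cancel]; exact γ.2.2⟩
    rw [ev_testFun h₂ ψ hm, Del.shift_shift, add_sub_cancel, mul_assoc _ (χ₂ _)]
  have hint := integral_ptsMeasure_eq_tsum γ.1.1
    (Metric.isBounded_closedBall (x := γ.1.2) (r := ρ))
    (f := fun y => phase B y γ.1.2 * ev f γ.1.1 y * χ₂ (γ.1.2 - y)) (fun y _ hy => by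
      rw [hρ, mul_zero]
      rw [← dist_eq_norm, dist_comm]
      simpa using hy)
  rw [hconv, ← hint, testFun_apply, convForm, sqFun, map_mul, Complex.conj_ofReal]
  simp only [Gpd.val]
  push_cast
  ring

variable [IsFiniteMeasure μ]

lemma memLp_comp_val (hμ : μ (hull L₀)ᶜ = 0) {G : Del d r R × E d → ℂ}
    (hG : MemLp G 2 (fibreMeasure μ)) : MemLp (fun γ : Gpd L₀ => G γ.val) 2 (gpdMeasure L₀ μ) :=
  hG.comp_measurePreserving (measurePreserving_val hμ)

lemma memLp_ev (hμ : μ (hull L₀)ᶜ = 0) {f : Gpd L₀ → ℂ} (hf : Measurable f)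
    (hf2 : MemLp f 2 (gpdMeasure L₀ μ)) :
    MemLp (fun p : Del d r R × E d => ev f p.1 p.2) 2 (fibreMeasure μ) := by
  rw [← (measurePreserving_val hμ).map_eq, memLp_map_measure_iff
    (measurable_ev hf).aestronglyMeasurable measurableEmbedding_val.measurable.aemeasurable]
  rwa [show (fun p : Del d r R × E d => ev f p.1 p.2) ∘ Gpd.val = f from funext (ev_val f)]

lemma memLp_testFun (hμ : μ (hull L₀)ᶜ = 0) (hχ : IsTest χ) (ψ : C(Del d r R, ℝ)) :
    MemLp (testFun L₀ hχ ψ) 2 (gpdMeasure L₀ μ) := by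
  have h := memLp_comp_val (L₀ := L₀) hμ (isFibreBdd_prodFun hχ ψ).memLp
  exact h.ae_eq (Eventually.of_forall fun γ => rfl)

lemma integral_comp_val (hμ : μ (hull L₀)ᶜ = 0) (G : Del d r R × E d → ℂ) :
    ∫ γ : Gpd L₀, G γ.val ∂(gpdMeasure L₀ μ) = ∫ p, G p ∂(fibreMeasure μ) :=
  (measurePreserving_val hμ).integral_comp measurableEmbedding_val G

lemma integral_conj_testFun_mul_conv (hμ : μ (hull L₀)ᶜ = 0) (h₁ : IsTest χ₁) (h₂ : IsTest χ₂)
    (ψ : C(Del d r R, ℝ)) {f : Gpd L₀ → ℂ} (hf : Measurable f)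
    (hf2 : MemLp f 2 (gpdMeasure L₀ μ)) :
    ∫ γ, (starRingEnd ℂ) (testFun L₀ h₁ ψ γ) * conv B f (testFun L₀ h₂ ψ) γ ∂(gpdMeasure L₀ μ)
      = ∫ γ : Gpd L₀, convDual B (sqFun χ₁ ψ) χ₂ γ.val * f γ ∂(gpdMeasure L₀ μ) := by
  obtain ⟨ρ, hρ⟩ := h₂.support
  obtain ⟨M, hM⟩ := h₂.bdd
  simp_rw [conj_testFun_mul_conv]
  rw [integral_comp_val hμ, integral_convForm (isFibreBdd_sqFun h₁ ψ) (measurable_ev hf)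
    (memLp_ev hμ hf hf2) h₂.continuous.measurable hM hρ, ← integral_comp_val hμ (L₀ := L₀)]
  refine integral_congr_ae (Eventually.of_forall fun γ => ?_)
  beta_reduce
  rw [← ev_val f γ]
  rfl

/-- Matrix elements of `T` between test functions in terms of its symbol. -/
lemma inner_vonNeumann (hμ : μ (hull L₀)ᶜ = 0) (hB : B.transpose = -B)
    (h₁ : IsTest χ₁) (h₂ : IsTest χ₂) (ψ : C(Del d r R, ℝ))
    {T : GNS L₀ μ →WOT[ℂ] GNS L₀ μ} (hT : T ∈ vonNeumann L₀ B μ) {η : GNS L₀ μ}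
    (hη : η =ᵐ[gpdMeasure L₀ μ] unitFun L₀) :
    inner ℂ ((memLp_testFun hμ h₁ ψ).toLp _ : GNS L₀ μ) (T ((memLp_testFun hμ h₂ ψ).toLp _))
      = ∫ γ : Gpd L₀, convDual B (sqFun χ₁ ψ) χ₂ γ.val * (T η) γ ∂(gpdMeasure L₀ μ) := by
  obtain ⟨ρ, hρ⟩ := h₂.support
  obtain ⟨M, hM⟩ := h₂.bdd
  have hΘ : MemLp (fun γ : Gpd L₀ => (starRingEnd ℂ) (convDual B (sqFun χ₁ ψ) χ₂ γ.val)) 2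
      (gpdMeasure L₀ μ) := by
    have h := memLp_comp_val (L₀ := L₀) hμ (isFibreBdd_convDual (B := B) (isFibreBdd_sqFun h₁ ψ)
      h₂.continuous.measurable hM hρ).memLp
    exact h.star
  have hΘT : ∀ ξ : GNS L₀ μ, inner ℂ (hΘ.toLp _ : GNS L₀ μ) ξ
      = ∫ γ : Gpd L₀, convDual B (sqFun χ₁ ψ) χ₂ γ.val * ξ γ ∂(gpdMeasure L₀ μ) := by
    intro ξ
    rw [L2.inner_def]
    refine integral_congr_ae ?_
    filter_upwards [hΘ.coeFn_toLp] with γ hγ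
    rw [hγ, RCLike.inner_apply, Complex.conj_conj, mul_comm]
  rw [← hΘT]
  -- Both sides are continuous in `T` for the weak operator topology, so left convolutions suffice.
  have hcl : IsClosed {T : GNS L₀ μ →WOT[ℂ] GNS L₀ μ |
      inner ℂ ((memLp_testFun hμ h₁ ψ).toLp _ : GNS L₀ μ) (T ((memLp_testFun hμ h₂ ψ).toLp _))
        = inner ℂ (hΘ.toLp _ : GNS L₀ μ) (T η)} :=
    isClosed_eq (ContinuousLinearMapWOT.continuous_inner_apply continuous_id _ _)
      (ContinuousLinearMapWOT.continuous_inner_apply continuous_id _ _)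
  refine closure_minimal ?_ hcl hT
  rintro T ⟨F, hF⟩
  -- Uniform discreteness puts the unit in `C_c(𝒢)`, so `T η = F ∗ 1 = F`.
  have hTη : T η =ᵐ[gpdMeasure L₀ μ] F := by
    have h := hF (unitCc L₀) η (hη.trans (Eventually.of_forall fun γ => (unitCc_apply γ).symm))
    refine h.trans (Eventually.of_forall fun γ => ?_)
    rw [show (⇑(unitCc L₀) : Gpd L₀ → ℂ) = unitFun L₀ from funext unitCc_apply]
    exact conv_unitFun hB _ _
  have hF2 : MemLp F 2 (gpdMeasure L₀ μ) := (Lp.memLp (T η)).ae_eq hTη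
  have hFm : Measurable F := (map_continuous F).measurable
  rw [mem_ofPred_eq, hΘT, integral_congr_ae (g := fun γ : Gpd L₀ =>
    convDual B (sqFun χ₁ ψ) χ₂ γ.val * F γ) (by
      filter_upwards [hTη] with γ hγ
      rw [hγ]), ← integral_conj_testFun_mul_conv hμ h₁ h₂ ψ hFm hF2, L2.inner_def]
  refine integral_congr_ae ?_
  filter_upwards [(memLp_testFun hμ h₁ ψ).coeFn_toLp, hF _ _ (memLp_testFun hμ h₂ ψ).coeFn_toLp]
    with γ hγ hγ'
  rw [hγ, hγ', RCLike.inner_apply, mul_comm]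

end Aperiodic
end

noncomputable section

namespace Aperiodic

open ProbabilityTheory

/-! ### Localisation of integral inequalities -/

/-- An integrable function whose integrals against squares of continuous functions are not
positive is almost everywhere not positive. -/
lemma ae_nonpos_of_forall_integral_sq_mul {X : Type*} [TopologicalSpace X] [CompactSpace X]
    [MeasurableSpace X] [BorelSpace X] [HasOuterApproxClosed X] {P : Measure X}
    [IsFiniteMeasure P] [P.WeaklyRegular] {k : X → ℝ} (hk : Integrable k P) (hkm : Measurable k)
    (h : ∀ ψ : C(X, ℝ), ∫ x, ψ x ^ 2 * k x ∂P ≤ 0) : ∀ᵐ x ∂P, k x ≤ 0 := by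
  have hF : ∀ F : Set X, IsClosed F → ∫ x in F, k x ∂P ≤ 0 := by
    intro F hF
    rw [← integral_indicator hF.measurableSet]
    -- Continuous functions with values in `[0, 1]` tending pointwise to the indicator of `F`, as do
    -- their squares.
    let ψ : ℕ → C(X, ℝ) := fun n => ⟨fun x => (hF.apprSeq n x : ℝ), by fun_prop⟩
    refine le_of_tendsto' (tendsto_integral_of_dominated_convergence (fun x => ‖k x‖)
      (F := fun n x => ψ n x ^ 2 * k x) (fun n => ?_) hk.norm (fun n => ?_) ?_) (fun n => h (ψ n))
    · exact (((ψ n).continuous.measurable.pow_const 2).mul hkm).aestronglyMeasurable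
    · refine Eventually.of_forall fun x => ?_
      have h1 : (hF.apprSeq n x : ℝ) ≤ 1 := by
        exact_mod_cast HasOuterApproxClosed.apprSeq_apply_le_one hF n x
      rw [norm_mul, norm_pow]
      refine mul_le_of_le_one_left (norm_nonneg _) (pow_le_one₀ (norm_nonneg _) ?_)
      rw [Real.norm_of_nonneg (by exact NNReal.coe_nonneg _)]
      exact h1
    · refine Eventually.of_forall fun x => ?_
      have h1 := tendsto_pi_nhds.1 (HasOuterApproxClosed.tendsto_apprSeq hF) x
      have h2 : Tendsto (fun n => ψ n x) atTop
          (𝓝 ((F.indicator (fun _ => (1 : NNReal)) x : NNReal) : ℝ)) :=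
        (NNReal.tendsto_coe.2 h1)
      have h3 := (h2.pow 2).mul_const (k x)
      convert h3 using 2
      by_cases hx : x ∈ F <;> simp [hx]
  have hA : MeasurableSet {x | 0 < k x} := measurableSet_lt measurable_const hkm
  have h0 : P {x | 0 < k x} = 0 := by
    -- By regularity it suffices that closed sets on which `k` is positive are null.
    rw [hA.measure_eq_iSup_isClosed_of_ne_top (measure_ne_top _ _)]
    simp only [ENNReal.iSup_eq_zero]
    intro F hFA hFc
    have hpos : 0 ≤ᵐ[P.restrict F] k :=
      (ae_restrict_iff' hFc.measurableSet).2 (Eventually.of_forall fun x hx => (hFA hx).le)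
    have h1 : ∫ x in F, k x ∂P = 0 := le_antisymm (hF F hFc) (integral_nonneg_of_ae hpos)
    have h2 := (setIntegral_eq_zero_iff_of_nonneg_ae hpos hk.integrableOn).1 h1
    have h3 := (ae_restrict_iff' hFc.measurableSet).1 h2
    refine measure_mono_null (fun x hx => ?_) (ae_iff.1 h3)
    intro hc
    have := hc hx
    have h4 : 0 < k x := hFA hx
    simp only [Pi.zero_apply] at this
    linarith
  rw [ae_iff]
  simpa only [not_le] using h0

variable {d : ℕ} {r R : ℝ} {L₀ : Del d r R} {μ : Measure (Del d r R)}
  {B : Matrix (Fin d) (Fin d) ℝ} {χ χ₁ χ₂ : E d → ℂ}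

/-- `∑_{x ∈ L} G(L - x, -x)`. -/
def fibreSum (G : Del d r R × E d → ℂ) (L : Del d r R) : ℂ :=
  ∫ x, G (inv (L, x)) ∂(ptsMeasure L)

variable [hr : Fact (0 < r)]

lemma measurable_fibreSum {G : Del d r R × E d → ℂ} (hG : Measurable G) :
    Measurable (fibreSum G) := by
  have := ((hG.fun_comp measurable_inv).stronglyMeasurable.integral_kernel_prod_right'
    (κ := pts d r R)).measurable
  simp only [pts_apply] at this
  exact this

variable [IsFiniteMeasure μ]

lemma integrable_comp_inv (hμ : ∀ a : E d, MeasurePreserving (Del.shift (r := r) (R := R) a) μ μ)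
    {G : Del d r R × E d → ℂ} (hG : Integrable G (fibreMeasure μ)) :
    Integrable (fun p => G (inv p)) (fibreMeasure μ) :=
  (measurePreserving_inv hμ).integrable_comp_of_integrable hG

lemma integrable_fibreSum (hμ : ∀ a : E d, MeasurePreserving (Del.shift (r := r) (R := R) a) μ μ)
    {G : Del d r R × E d → ℂ} (hG : Integrable G (fibreMeasure μ)) :
    Integrable (fibreSum G) (transverseMeasure μ) := by
  have := (integrable_comp_inv hμ hG).integral_compProd
  simp only [Kernel.const_apply, Kernel.prodMkLeft_apply, pts_apply] at this
  exact this

/-- Inversion turns `ψ(L - x)` into `ψ(L)`, which is constant along the fibre and leaves the sum. -/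
lemma integral_sq_mul (hμ : ∀ a : E d, MeasurePreserving (Del.shift (r := r) (R := R) a) μ μ)
    {G : Del d r R × E d → ℂ} (hG : Integrable G (fibreMeasure μ)) (ψ : C(Del d r R, ℝ)) :
    ∫ p, ((ψ (p.1.shift p.2) ^ 2 : ℝ) : ℂ) * G p ∂(fibreMeasure μ)
      = ∫ L, ((ψ L ^ 2 : ℝ) : ℂ) * fibreSum G L ∂(transverseMeasure μ) := by
  have hψ : Measurable fun p : Del d r R × E d => ((ψ (p.1.shift p.2) ^ 2 : ℝ) : ℂ) :=
    Complex.measurable_ofReal.comp ((ψ.continuous.measurable.comp measurable_shift).pow_const 2)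
  have hi : Integrable (fun p : Del d r R × E d => ((ψ (p.1.shift p.2) ^ 2 : ℝ) : ℂ) * G p)
      (fibreMeasure μ) := by
    refine hG.bdd_mul (c := ‖ψ‖ ^ 2) hψ.aestronglyMeasurable (Eventually.of_forall fun p => ?_)
    rw [Complex.norm_real, norm_pow]
    exact pow_le_pow_left₀ (norm_nonneg _) (ψ.norm_coe_le_norm _) 2
  have hmap := (measurePreserving_inv hμ).map_eq
  have h1 := integral_map (μ := fibreMeasure μ) measurable_inv.aemeasurable
    (f := fun p : Del d r R × E d => ((ψ (p.1.shift p.2) ^ 2 : ℝ) : ℂ) * G p)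
    (by rw [hmap]; exact hi.aestronglyMeasurable)
  rw [hmap] at h1
  rw [h1, integral_fibreMeasure (integrable_comp_inv hμ hi)]
  refine integral_congr_ae (Eventually.of_forall fun L => ?_)
  beta_reduce
  rw [fibreSum, ← integral_const_mul]
  refine integral_congr_ae (Eventually.of_forall fun x => ?_)
  simp only [inv, Del.shift_shift, add_neg_cancel, Del.shift_zero]

/-- `(L, x) ↦ |χ(x)|²`. -/
def normFun (χ : E d → ℂ) (p : Del d r R × E d) : ℂ := (starRingEnd ℂ) (χ p.2) * χ p.2

/-- `(L, z) ↦ conj χ₁(z) ∑_{w ∈ L} exp(-iΓ⟨0,w,z⟩) f(L,w) χ₂(z-w)`. -/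
def matrixFun (B : Matrix (Fin d) (Fin d) ℝ) (χ₁ χ₂ : E d → ℂ) (f : Gpd L₀ → ℂ) :
    Del d r R × E d → ℂ :=
  convForm B (fun p => (starRingEnd ℂ) (χ₁ p.2)) (fun p => ev f p.1 p.2) χ₂

omit [IsFiniteMeasure μ] in
lemma isFibreBdd_snd (hχ : IsTest χ) : IsFibreBdd (fun p : Del d r R × E d => χ p.2) := by
  have := isFibreBdd_prodFun hχ (1 : C(Del d r R, ℝ))
  unfold prodFun at this
  simpa using this

lemma integrable_normFun (hχ : IsTest χ) : Integrable (normFun χ) (fibreMeasure μ) :=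
  (isFibreBdd_snd hχ.conj).memLp.integrable_mul (isFibreBdd_snd hχ).memLp

omit [IsFiniteMeasure μ] in
lemma measurable_normFun (hχ : IsTest χ) : Measurable (normFun (r := r) (R := R) χ) :=
  (isFibreBdd_snd hχ.conj).measurable.mul (isFibreBdd_snd hχ).measurable

lemma integrable_matrixFun (hμ : μ (hull L₀)ᶜ = 0) (h₁ : IsTest χ₁) (h₂ : IsTest χ₂)
    {f : Gpd L₀ → ℂ} (hf : Measurable f) (hf2 : MemLp f 2 (gpdMeasure L₀ μ)) :
    Integrable (matrixFun B χ₁ χ₂ f) (fibreMeasure μ) := by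
  obtain ⟨ρ, hρ⟩ := h₂.support
  obtain ⟨M, hM⟩ := h₂.bdd
  exact integrable_convForm (isFibreBdd_snd h₁.conj) (measurable_ev hf) (memLp_ev hμ hf hf2)
    h₂.continuous.measurable hM hρ

omit [IsFiniteMeasure μ] in
lemma measurable_matrixFun (h₁ : IsTest χ₁) (h₂ : IsTest χ₂)
    {f : Gpd L₀ → ℂ} (hf : Measurable f) : Measurable (matrixFun B χ₁ χ₂ f) :=
  measurable_convForm (isFibreBdd_snd h₁.conj).measurable (measurable_ev hf)
    h₂.continuous.measurable

lemma norm_sq_testFun (hμ : μ (hull L₀)ᶜ = 0)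
    (hμ' : ∀ a : E d, MeasurePreserving (Del.shift (r := r) (R := R) a) μ μ)
    (hχ : IsTest χ) (ψ : C(Del d r R, ℝ)) :
    ((‖((memLp_testFun hμ hχ ψ).toLp _ : GNS L₀ μ)‖ ^ 2 : ℝ) : ℂ)
      = ∫ L, ((ψ L ^ 2 : ℝ) : ℂ) * fibreSum (normFun χ) L ∂(transverseMeasure μ) := by
  rw [← integral_sq_mul hμ' (integrable_normFun hχ), ← integral_comp_val hμ (L₀ := L₀)]
  have h := inner_self_eq_norm_sq_to_K (𝕜 := ℂ) ((memLp_testFun hμ hχ ψ).toLp _ : GNS L₀ μ)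
  push_cast
  refine Eq.trans h.symm ?_
  rw [L2.inner_def]
  refine integral_congr_ae ?_
  filter_upwards [(memLp_testFun hμ hχ ψ).coeFn_toLp] with γ hγ
  rw [hγ, RCLike.inner_apply, testFun_apply, map_mul, Complex.conj_ofReal, normFun]
  simp only [Gpd.val]
  ring

/-- With `norm_sq_testFun`, both sides of the operator bound become integrals over patterns against
the same weight `ψ ^ 2`. -/
lemma inner_eq_integral_fibreSum (hμ : μ (hull L₀)ᶜ = 0)
    (hμ' : ∀ a : E d, MeasurePreserving (Del.shift (r := r) (R := R) a) μ μ)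
    (hB : B.transpose = -B) (h₁ : IsTest χ₁) (h₂ : IsTest χ₂) (ψ : C(Del d r R, ℝ))
    {T : GNS L₀ μ →WOT[ℂ] GNS L₀ μ} (hT : T ∈ vonNeumann L₀ B μ) {η : GNS L₀ μ}
    (hη : η =ᵐ[gpdMeasure L₀ μ] unitFun L₀) {f : Gpd L₀ → ℂ} (hf : Measurable f)
    (hTf : T η =ᵐ[gpdMeasure L₀ μ] f) :
    inner ℂ ((memLp_testFun hμ h₁ ψ).toLp _ : GNS L₀ μ) (T ((memLp_testFun hμ h₂ ψ).toLp _))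
      = ∫ L, ((ψ L ^ 2 : ℝ) : ℂ) * fibreSum (matrixFun B χ₁ χ₂ f) L ∂(transverseMeasure μ) := by
  have hf2 : MemLp f 2 (gpdMeasure L₀ μ) := (Lp.memLp (T η)).ae_eq hTf
  rw [inner_vonNeumann hμ hB h₁ h₂ ψ hT hη, integral_congr_ae (g := fun γ : Gpd L₀ =>
    convDual B (sqFun χ₁ ψ) χ₂ γ.val * f γ) (by
      filter_upwards [hTf] with γ hγ
      rw [hγ]), ← integral_conj_testFun_mul_conv hμ h₁ h₂ ψ hf hf2,
    ← integral_sq_mul hμ' (integrable_matrixFun hμ h₁ h₂ hf hf2)]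
  simp_rw [conj_testFun_mul_conv]
  rw [integral_comp_val hμ]
  refine integral_congr_ae (Eventually.of_forall fun p => ?_)
  simp only [convForm, sqFun, matrixFun, mul_assoc]

/-- The form bound for the symbol of an element of the von Neumann algebra, tested against a pair
of functions. -/
lemma ae_re_fibreSum_le (hμ : μ (hull L₀)ᶜ = 0)
    (hμ' : ∀ a : E d, MeasurePreserving (Del.shift (r := r) (R := R) a) μ μ)
    (hB : B.transpose = -B) (h₁ : IsTest χ₁) (h₂ : IsTest χ₂)
    {T : GNS L₀ μ →WOT[ℂ] GNS L₀ μ} (hT : T ∈ vonNeumann L₀ B μ) {η : GNS L₀ μ}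
    (hη : η =ᵐ[gpdMeasure L₀ μ] unitFun L₀) {f : Gpd L₀ → ℂ} (hf : Measurable f)
    (hTf : T η =ᵐ[gpdMeasure L₀ μ] f) :
    ∀ᵐ L ∂(transverseMeasure μ), (fibreSum (matrixFun B χ₁ χ₂ f) L).re
      ≤ ‖T.toCLM‖ / 2 * ((fibreSum (normFun χ₁) L).re + (fibreSum (normFun χ₂) L).re) := by
  have hf2 : MemLp f 2 (gpdMeasure L₀ μ) := (Lp.memLp (T η)).ae_eq hTf
  set C := ‖T.toCLM‖
  have i0 := integrable_fibreSum hμ' (integrable_matrixFun (B := B) hμ h₁ h₂ hf hf2)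
  have i1 := integrable_fibreSum hμ' (integrable_normFun (μ := μ) (r := r) (R := R) h₁)
  have i2 := integrable_fibreSum hμ' (integrable_normFun (μ := μ) (r := r) (R := R) h₂)
  have m0 := measurable_fibreSum (measurable_matrixFun (L₀ := L₀) (B := B) h₁ h₂ hf)
  have m1 := measurable_fibreSum (measurable_normFun (r := r) (R := R) h₁)
  have m2 := measurable_fibreSum (measurable_normFun (r := r) (R := R) h₂)
  have key : ∀ᵐ L ∂(transverseMeasure μ), (fibreSum (matrixFun B χ₁ χ₂ f) L).re
      - C / 2 * ((fibreSum (normFun χ₁) L).re + (fibreSum (normFun χ₂) L).re) ≤ 0 := by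
    refine ae_nonpos_of_forall_integral_sq_mul
      (i0.re.sub ((i1.re.add i2.re).const_mul (C / 2)))
      ((Complex.measurable_re.comp m0).sub (((Complex.measurable_re.comp m1).add
        (Complex.measurable_re.comp m2)).const_mul _)) fun ψ => ?_
    have hre : ∀ F : Del d r R → ℂ, Integrable F (transverseMeasure μ) →
        Integrable (fun L => ψ L ^ 2 * (F L).re) (transverseMeasure μ) ∧
        ∫ L, ψ L ^ 2 * (F L).re ∂(transverseMeasure μ)
          = (∫ L, ((ψ L ^ 2 : ℝ) : ℂ) * F L ∂(transverseMeasure μ)).re := by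
      intro F hF
      have hi : Integrable (fun L => ((ψ L ^ 2 : ℝ) : ℂ) * F L) (transverseMeasure μ) := by
        refine hF.bdd_mul (c := ‖ψ‖ ^ 2) (Complex.measurable_ofReal.comp
          (ψ.continuous.measurable.pow_const 2)).aestronglyMeasurable
          (Eventually.of_forall fun p => ?_)
        rw [Complex.norm_real, norm_pow]
        exact pow_le_pow_left₀ (norm_nonneg _) (ψ.norm_coe_le_norm _) 2
      have h1 : ∀ L, ψ L ^ 2 * (F L).re = (((ψ L ^ 2 : ℝ) : ℂ) * F L).re := fun L =>
        (Complex.re_ofReal_mul _ _).symm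
      simp_rw [h1]
      exact ⟨hi.re, integral_re hi⟩
    have e0 := inner_eq_integral_fibreSum hμ hμ' hB h₁ h₂ ψ hT hη hf hTf
    have e1 := norm_sq_testFun hμ hμ' h₁ ψ
    have e2 := norm_sq_testFun hμ hμ' h₂ ψ
    set u : GNS L₀ μ := (memLp_testFun hμ h₁ ψ).toLp _
    set v : GNS L₀ μ := (memLp_testFun hμ h₂ ψ).toLp _
    have hb : (inner ℂ u (T v)).re ≤ C * (‖u‖ * ‖v‖) := by
      calc (inner ℂ u (T v)).re ≤ ‖inner ℂ u (T v)‖ := Complex.re_le_norm _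
        _ ≤ ‖u‖ * ‖T v‖ := norm_inner_le_norm _ _
        _ ≤ ‖u‖ * (C * ‖v‖) := by
            gcongr
            exact T.toCLM.le_opNorm v
        _ = _ := by ring
    have hsplit : ∫ L, ψ L ^ 2 * ((fibreSum (matrixFun B χ₁ χ₂ f) L).re
        - C / 2 * ((fibreSum (normFun χ₁) L).re + (fibreSum (normFun χ₂) L).re))
          ∂(transverseMeasure μ)
        = (inner ℂ u (T v)).re - C / 2 * (‖u‖ ^ 2 + ‖v‖ ^ 2) := by
      rw [e0, ← (hre _ i0).2, ← Complex.ofReal_re (‖u‖ ^ 2), ← Complex.ofReal_re (‖v‖ ^ 2), e1, e2,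
        ← (hre _ i1).2, ← (hre _ i2).2, ← integral_add (hre _ i1).1 (hre _ i2).1,
        ← integral_const_mul]
      refine Eq.trans ?_ (integral_sub (hre _ i0).1
        (((hre _ i1).1.add (hre _ i2).1).const_mul (C / 2)))
      refine integral_congr_ae (Eventually.of_forall fun L => ?_)
      simp only
      ring
    refine hsplit.le.trans ?_
    have hC : 0 ≤ C := norm_nonneg _
    -- The geometric mean `‖u‖ ‖v‖` is weakened to the arithmetic mean of the squares, which is
    -- linear in `ψ ^ 2` and so can be localised; `isFormBound_of_re_le` recovers the loss on each
    -- fibre.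
    nlinarith [mul_nonneg hC (sq_nonneg (‖u‖ - ‖v‖))]
  filter_upwards [key] with L hL
  linarith

end Aperiodic
end

noncomputable section

namespace Aperiodic

open ProbabilityTheory

/-! ### Boundedness of the fibre operators -/

variable {d : ℕ} {r R : ℝ} {L₀ : Del d r R} {μ : Measure (Del d r R)}
  {B : Matrix (Fin d) (Fin d) ℝ} {χ χ₁ χ₂ : E d → ℂ}

variable [hr : Fact (0 < r)]

lemma integral_ptsMeasure_eq_sum_subtype (L : Del d r R) {s : Finset L.1} {f : E d → ℂ}
    (hf : ∀ x : L.1, x ∉ s → f x = 0) : ∫ x, f x ∂(ptsMeasure L) = ∑ x ∈ s, f x := by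
  classical
  rw [(hasFiniteSupport_integral_ptsMeasure L (F := s.image Subtype.val) ?_ ?_).2,
    Finset.sum_image (fun _ _ _ _ h => Subtype.ext h)]
  · intro x hx
    obtain ⟨y, _, rfl⟩ := Finset.mem_image.1 hx
    exact y.2
  · exact fun x hx hxs => hf ⟨x, hx⟩ fun h => hxs (Finset.mem_image_of_mem _ h)

lemma fibreSum_normFun (L : Del d r R) {s : Finset L.1} (hs : ∀ x : L.1, x ∉ s → χ (-x.1) = 0) :
    (fibreSum (normFun χ) L).re = ∑ x ∈ s, ‖χ (-x.1)‖ ^ 2 := by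
  rw [fibreSum, integral_ptsMeasure_eq_sum_subtype L fun x hx => by simp [normFun, inv, hs x hx],
    Complex.re_sum]
  refine Finset.sum_congr rfl fun x _ => ?_
  simp only [normFun, inv]
  rw [← Complex.normSq_eq_conj_mul_self, Complex.ofReal_re, Complex.normSq_eq_norm_sq]

/-- With `z = -x` and `w = y - x` one has `z - w = -y`, and phase and symbol combine to the kernel
of `π_L(f)`. The vectors tested are `x ↦ χ(-x)`, whence the reflected bumps below. -/
lemma fibreSum_matrixFun (f : Gpd L₀ → ℂ) (L : Del d r R) {s t : Finset L.1}
    (hs : ∀ x : L.1, x ∉ s → χ₁ (-x.1) = 0) (ht : ∀ x : L.1, x ∉ t → χ₂ (-x.1) = 0) :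
    fibreSum (matrixFun B χ₁ χ₂ f) L
      = ∑ x ∈ s, ∑ y ∈ t, (starRingEnd ℂ) (χ₁ (-x.1)) * repKernel B f L x y * χ₂ (-y.1) := by
  rw [fibreSum, integral_ptsMeasure_eq_sum_subtype L
    fun x hx => by simp [matrixFun, convForm, inv, hs x hx]]
  refine Finset.sum_congr rfl fun x _ => ?_
  simp only [matrixFun, convForm, inv]
  have hm : (ptsMeasure (L.shift x.1)) = (ptsMeasure L).map (fun y => y - x.1) := by
    refine Measure.ext_of_lintegral _ fun g hg => ?_
    rw [lintegral_map hg (by fun_prop), lintegral_ptsMeasure_shift]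
  rw [hm, (measurableEmbedding_subRight x.1).integral_map,
    integral_ptsMeasure_eq_sum_subtype L (s := t), Finset.mul_sum]
  · refine Finset.sum_congr rfl fun y _ => ?_
    rw [repKernel, show -x.1 - (y.1 - x.1) = -y.1 by abel]
    ring
  · intro y hy
    rw [show -x.1 - (y.1 - x.1) = -y.1 by abel, ht y hy, mul_zero]

/-- A continuous bump at the `n`-th point of a dense sequence, reflected at the origin. -/
def hat (d : ℕ) (r : ℝ) (n : ℕ) (x : E d) : ℂ :=
  ((max 0 (1 - ‖x + TopologicalSpace.denseSeq (E d) n‖ / r) : ℝ) : ℂ)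

/-- A countable family of combinations of bumps. -/
def hatComb (d : ℕ) (r : ℝ) (S : Finset (ℕ × ℕ)) (x : E d) : ℂ :=
  ∑ p ∈ S, TopologicalSpace.denseSeq ℂ p.2 * hat d r p.1 x

lemma isTest_hatComb (S : Finset (ℕ × ℕ)) : IsTest (hatComb d r S) := by
  classical
  have h : ∀ n, IsTest (hat d r n) := fun n => isTest_hat (TopologicalSpace.denseSeq (E d) n)
  induction S using Finset.induction_on with
  | empty => exact ⟨by unfold hatComb; simp [continuous_const], 0, fun x _ => by simp [hatComb]⟩
  | insert p S hp ih =>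
    obtain ⟨ρ, hρ⟩ := ih.support
    obtain ⟨ρ', hρ'⟩ := (h p.1).support
    have he : hatComb d r (insert p S) = fun x => TopologicalSpace.denseSeq ℂ p.2 * hat d r p.1 x
        + hatComb d r S x := by
      funext x
      rw [hatComb, Finset.sum_insert hp, hatComb]
    rw [he]
    refine ⟨(continuous_const.mul (h p.1).continuous).add ih.continuous, max ρ ρ', fun x hx => ?_⟩
    rw [hρ x ((le_max_left _ _).trans_lt hx), hρ' x ((le_max_right _ _).trans_lt hx)]
    simp

/-- Each point of a pattern is singled out by one of the bumps. -/
lemma exists_hat (L : Del d r R) : ∃ n : L.1 → ℕ, Function.Injective n ∧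
    (∀ x, hat d r (n x) (-x.1) ≠ 0) ∧ ∀ x y : L.1, x ≠ y → hat d r (n x) (-y.1) = 0 := by
  have h : ∀ x : L.1, ∃ n, dist x.1 (TopologicalSpace.denseSeq (E d) n) < r := fun x =>
    (TopologicalSpace.denseRange_denseSeq (E d)).exists_dist_lt x.1 hr.out
  choose n hn using h
  have hval : ∀ x y : L.1, hat d r (n x) (-y.1)
      = ((max 0 (1 - dist y.1 (TopologicalSpace.denseSeq (E d) (n x)) / r) : ℝ) : ℂ) := by
    intro x y
    rw [hat, dist_comm, dist_eq_norm, neg_add_eq_sub]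
  refine ⟨n, fun x y hxy => ?_, fun x => ?_, fun x y hxy => ?_⟩
  · refine Subtype.ext (L.eq_of_mem_ball x.2 y.2 (hn x) ?_)
    rw [hxy]
    exact hn y
  · have : dist x.1 (TopologicalSpace.denseSeq (E d) (n x)) / r < 1 := (div_lt_one hr.out).2 (hn x)
    rw [hval, max_eq_right (by linarith)]
    exact_mod_cast (by linarith : (0 : ℝ) < _).ne'
  · have : 1 ≤ dist y.1 (TopologicalSpace.denseSeq (E d) (n x)) / r := by
      rw [le_div_iff₀ hr.out, one_mul]
      by_contra hc
      exact hxy (Subtype.ext (L.eq_of_mem_ball x.2 y.2 (hn x) (not_le.1 hc)))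
    rw [hval, max_eq_left (by linarith)]
    simp

omit hr in
lemma hatComb_image (L : Del d r R) {n : L.1 → ℕ} (hinj : Function.Injective n)
    (hn : ∀ x y : L.1, x ≠ y → hat d r (n x) (-y.1) = 0) (s : Finset L.1) (a : L.1 → ℕ) (y : L.1) :
    (y ∈ s → hatComb d r (s.image fun x => (n x, a x)) (-y.1)
      = TopologicalSpace.denseSeq ℂ (a y) * hat d r (n y) (-y.1)) ∧
    (y ∉ s → hatComb d r (s.image fun x => (n x, a x)) (-y.1) = 0) := by
  have h : hatComb d r (s.image fun x => (n x, a x)) (-y.1)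
      = ∑ x ∈ s, TopologicalSpace.denseSeq ℂ (a x) * hat d r (n x) (-y.1) :=
    Finset.sum_image fun x _ x' _ hxx' => hinj (congrArg Prod.fst hxx')
  rw [h]
  refine ⟨fun hy => Finset.sum_eq_single y (fun x _ hxy => by rw [hn x y hxy, mul_zero])
    fun hc => absurd hy hc, fun hy => Finset.sum_eq_zero fun x hx => ?_⟩
  rw [hn x y fun hxy => hy (hxy ▸ hx), mul_zero]

/-- Every point of `L` has a bump that vanishes at all others, so the combinations realise a dense
set of coefficients on any finite part of `L`; both sides are continuous in the coefficients. -/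
lemma isFormBound_of_hatComb {f : Gpd L₀ → ℂ} {L : Del d r R} {C : ℝ}
    (h : ∀ S S' : Finset (ℕ × ℕ), (fibreSum (matrixFun B (hatComb d r S) (hatComb d r S') f) L).re
      ≤ C / 2 * ((fibreSum (normFun (hatComb d r S)) L).re
        + (fibreSum (normFun (hatComb d r S')) L).re)) :
    IsFormBound (repKernel B f L) C := by
  obtain ⟨n, hinj, hne, hn⟩ := exists_hat L
  refine isFormBound_of_re_le fun s t u v => ?_
  -- The nonzero value of each bump at its own point, divided out at the end.
  let w : L.1 → ℂ := fun x => hat d r (n x) (-x.1)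
  have hcl : IsClosed {q : (L.1 → ℂ) × (L.1 → ℂ) |
      (∑ x ∈ s, ∑ y ∈ t, (starRingEnd ℂ) (q.1 x * w x) * repKernel B f L x y * (q.2 y * w y)).re
        ≤ C / 2 * (∑ x ∈ s, ‖q.1 x * w x‖ ^ 2 + ∑ y ∈ t, ‖q.2 y * w y‖ ^ 2)} := by
    refine isClosed_le (Complex.continuous_re.comp ?_) (by fun_prop)
    refine continuous_finsetSum _ fun x _ => continuous_finsetSum _ fun y _ => ?_
    exact ((Complex.continuous_conj.comp (by fun_prop)).mul continuous_const).mul (by fun_prop)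
  have hD : DenseRange (Pi.map fun _ : L.1 => TopologicalSpace.denseSeq ℂ) :=
    DenseRange.piMap fun _ => TopologicalSpace.denseRange_denseSeq ℂ
  have hall : ∀ q : (L.1 → ℂ) × (L.1 → ℂ),
      (∑ x ∈ s, ∑ y ∈ t, (starRingEnd ℂ) (q.1 x * w x) * repKernel B f L x y * (q.2 y * w y)).re
        ≤ C / 2 * (∑ x ∈ s, ‖q.1 x * w x‖ ^ 2 + ∑ y ∈ t, ‖q.2 y * w y‖ ^ 2) := by
    intro q
    refine (hD.prodMap hD).induction_on q hcl ?_
    rintro ⟨a, b⟩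
    have h0 := h (s.image fun x => (n x, a x)) (t.image fun x => (n x, b x))
    rw [fibreSum_matrixFun (s := s) (t := t) f L
        (fun x hx => (hatComb_image L hinj hn s a x).2 hx)
        (fun x hx => (hatComb_image L hinj hn t b x).2 hx),
      fibreSum_normFun (s := s) L (fun x hx => (hatComb_image L hinj hn s a x).2 hx),
      fibreSum_normFun (s := t) L (fun x hx => (hatComb_image L hinj hn t b x).2 hx)] at h0
    have e1 : ∀ x ∈ s, hatComb d r (s.image fun x => (n x, a x)) (-x.1)
      = TopologicalSpace.denseSeq ℂ (a x) * w x := fun x hx => (hatComb_image L hinj hn s a x).1 hx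
    have e2 : ∀ x ∈ t, hatComb d r (t.image fun x => (n x, b x)) (-x.1)
      = TopologicalSpace.denseSeq ℂ (b x) * w x := fun x hx => (hatComb_image L hinj hn t b x).1 hx
    refine le_of_eq_of_le (congrArg Complex.re (Finset.sum_congr rfl fun x hx =>
      Finset.sum_congr rfl fun y hy => ?_)) (h0.trans_eq (congrArg (C / 2 * ·) (congrArg₂ (· + ·)
        (Finset.sum_congr rfl fun x hx => ?_) (Finset.sum_congr rfl fun y hy => ?_))))
    · exact (congrArg₂ (fun p q => (starRingEnd ℂ) p * repKernel B f L x y * q) (e1 x hx)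
        (e2 y hy)).symm
    · exact congrArg (fun p : ℂ => ‖p‖ ^ 2) (e1 x hx)
    · exact congrArg (fun p : ℂ => ‖p‖ ^ 2) (e2 y hy)
  have := hall (fun x => u x / w x, fun x => v x / w x)
  simpa only [div_mul_cancel₀ _ (show w _ ≠ 0 from hne _)] using this

/-- Elements of the von Neumann algebra have measurable symbols that define almost surely operators
on the fibres, with a uniform bound. -/
theorem IsLinfty.exists_isFormBound [IsFiniteMeasure μ] (hμ : μ (hull L₀)ᶜ = 0)
    (hμ' : ∀ a : E d, MeasurePreserving (Del.shift (r := r) (R := R) a) μ μ)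
    (hB : B.transpose = -B) {f : Gpd L₀ → ℂ} (hf : IsLinfty B μ f) :
    ∃ f₁ : Gpd L₀ → ℂ, Measurable f₁ ∧ f =ᵐ[gpdMeasure L₀ μ] f₁ ∧ ∃ C : ℝ, 0 ≤ C ∧
      ∀ᵐ L ∂(transverseMeasure μ), IsFormBound (repKernel B f₁ L) C := by
  obtain ⟨T, hT, η, hη, hTη⟩ := hf
  have hm : Measurable (T η : Gpd L₀ → ℂ) := (Lp.stronglyMeasurable (T η)).measurable
  refine ⟨T η, hm, hTη.symm, ‖T.toCLM‖, norm_nonneg _, ?_⟩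
  -- The test functions do not depend on `L` and are countable in number, so a single null set
  -- suffices.
  have h : ∀ᵐ L ∂(transverseMeasure μ), ∀ S S' : Finset (ℕ × ℕ),
      (fibreSum (matrixFun B (hatComb d r S) (hatComb d r S') (T η)) L).re
      ≤ ‖T.toCLM‖ / 2 * ((fibreSum (normFun (hatComb d r S)) L).re
        + (fibreSum (normFun (hatComb d r S')) L).re) := by
    rw [ae_all_iff]
    intro S
    rw [ae_all_iff]
    intro S'
    exact ae_re_fibreSum_le hμ hμ' hB (isTest_hatComb S) (isTest_hatComb S') hT hη hm
      EventuallyEq.rfl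
  filter_upwards [h] with L hL
  exact isFormBound_of_hatComb hL

end Aperiodic
end

noncomputable section

namespace Aperiodic

open ProbabilityTheory

/-! ### Residues -/

/-- Needed because the zeta function is a Dirichlet series in `1 + |x|²` with exponent `s / 2`. -/
lemma HasResidueAt.comp_div_two {G : ℂ → ℂ} {a : ℝ} {c : ℂ} (h : HasResidueAt G a c) :
    HasResidueAt (fun s => G (s / 2)) (2 * a) (2 * c) := by
  have hmaps : ∀ s : ℂ, 2 * a < s.re → a < (s / 2).re := fun s hs => by
    rw [show s / 2 = ((1 / 2 : ℝ) : ℂ) * s by push_cast; ring, Complex.re_ofReal_mul]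
    linarith
  refine ⟨h.1.comp (by fun_prop) fun s hs => hmaps s hs, fun κ => ?_⟩
  have hlim : Tendsto (fun s : ℂ => s / 2)
      (𝓝[{s : ℂ | 2 * a < s.re ∧ ‖s - (2 * a : ℝ)‖ ≤ κ * (s.re - 2 * a)}] ((2 * a : ℝ) : ℂ))
      (𝓝[{s : ℂ | a < s.re ∧ ‖s - a‖ ≤ κ * (s.re - a)}] (a : ℂ)) := by
    refine tendsto_nhdsWithin_iff.2 ⟨?_, ?_⟩
    · have : Tendsto (fun s : ℂ => s / 2) (𝓝 ((2 * a : ℝ) : ℂ)) (𝓝 (((2 * a : ℝ) : ℂ) / 2)) :=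
        (continuous_id.div_const 2).tendsto _
      rw [show ((2 * a : ℝ) : ℂ) / 2 = a by push_cast; ring] at this
      exact this.mono_left nhdsWithin_le_nhds
    · filter_upwards [self_mem_nhdsWithin] with s hs
      refine ⟨hmaps s hs.1, ?_⟩
      have h1 : s / 2 - a = ((1 / 2 : ℝ) : ℂ) * (s - (2 * a : ℝ)) := by push_cast; ring
      have h2 : (s / 2).re = 1 / 2 * s.re := by
        rw [show s / 2 = ((1 / 2 : ℝ) : ℂ) * s by push_cast; ring, Complex.re_ofReal_mul]
      rw [h1, norm_mul, Complex.norm_real, h2, Real.norm_of_nonneg (by norm_num)]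
      nlinarith [hs.2]
  refine (((h.2 κ).comp hlim).const_mul 2).congr fun s => ?_
  simp only [Function.comp]
  push_cast
  ring

lemma HasResidueAt.congr {G G' : ℂ → ℂ} {a : ℝ} {c : ℂ} (h : HasResidueAt G a c)
    (hG : ∀ s : ℂ, a < s.re → G' s = G s) : HasResidueAt G' a c := by
  refine ⟨h.1.congr fun s hs => hG s hs, fun κ => (h.2 κ).congr' ?_⟩
  filter_upwards [self_mem_nhdsWithin] with s hs
  rw [hG s hs.1]

/-! ### Operators on the points of one pattern -/

variable {d : ℕ} {r R : ℝ} {L₀ : Del d r R} {μ : Measure (Del d r R)}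

lemma localTrace_eq {L : Del d r R} {T : ell2 L.1 →L[ℂ] ell2 L.1} {a : E d → ℂ}
    (hT : ∀ x : L.1, T (e x) x = a x) (Λ : Set (E d)) :
    localTrace L T Λ = ∑' x : L.1, Λ.indicator a x := by
  classical
  rw [localTrace]
  refine tsum_congr fun x => ?_
  rw [inner_e_left, hT, indicator_apply]

lemma volume_real_pos {K : Set (E d)} (hb : Bornology.IsBounded K) (hi : (interior K).Nonempty) :
    0 < volume.real K :=
  ENNReal.toReal_pos (Measure.measure_pos_of_nonempty_interior _ hi).ne' hb.measure_lt_top.ne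

/-- The sums of `a` over the points in dilated convex bodies are asymptotic to `τ` times the
volume. -/
def HasMean (L : Del d r R) (a : E d → ℂ) (τ : ℂ) : Prop :=
  ∀ K : Set (E d), Convex ℝ K → Bornology.IsBounded K →
    Tendsto (fun ρ : ℝ => ((ρ ^ d : ℝ) : ℂ)⁻¹ * ∑' x : L.1, (ρ • K).indicator a x) atTop
      (𝓝 (τ * (volume.real K : ℂ)))

lemma HasMean.hasTracePerVolume {L : Del d r R} {a : E d → ℂ} {τ : ℂ} (h : HasMean L a τ)
    {T : ell2 L.1 →L[ℂ] ell2 L.1} (hT : ∀ x : L.1, T (e x) x = a x) :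
    HasTracePerVolume L T τ := by
  intro K hK hb hi
  have hv : (volume.real K : ℂ) ≠ 0 := by exact_mod_cast (volume_real_pos hb hi).ne'
  have h1 := (h K hK hb).div_const (volume.real K : ℂ)
  rw [mul_div_cancel_right₀ _ hv] at h1
  refine h1.congr' ?_
  filter_upwards [eventually_gt_atTop 0] with ρ hρ
  rw [localTrace_eq hT, volume_real_smul K hρ.le]
  push_cast
  rw [inv_mul_eq_div, div_div]

variable [hr : Fact (0 < r)]

lemma ncard_inter_eq_tsum (L : Del d r R) {S : Set (E d)} (hS : Bornology.IsBounded S) :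
    ((L.1 ∩ S).ncard : ℂ) = ∑' x : L.1, S.indicator (fun _ => (1 : ℂ)) x := by
  rw [tsum_eq_sum_finpts L hS fun x _ hx => indicator_of_notMem hx _,
    Finset.sum_congr rfl fun x hx => indicator_of_mem ((L.mem_finpts hS).1 hx).2 _,
    Finset.sum_const, nsmul_eq_mul, mul_one, ← ncard_coe_finset]
  congr 2
  ext x
  simp [L.mem_finpts hS]

lemma HasMean.hasTracePerSite {L : Del d r R} {a : E d → ℂ} {τ m : ℂ} (h : HasMean L a τ)
    (h1 : HasMean L (fun _ => 1) m) (hm : m ≠ 0)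
    {T : ell2 L.1 →L[ℂ] ell2 L.1} (hT : ∀ x : L.1, T (e x) x = a x) :
    HasTracePerSite L T (τ / m) := by
  intro K hK hb hi
  have hv : (volume.real K : ℂ) ≠ 0 := by exact_mod_cast (volume_real_pos hb hi).ne'
  have h2 := (h K hK hb).div (h1 K hK hb) (mul_ne_zero hm hv)
  rw [mul_div_mul_right _ _ hv] at h2
  refine h2.congr' ?_
  filter_upwards [eventually_gt_atTop 0] with ρ hρ
  have hρ' : ((ρ ^ d : ℝ) : ℂ)⁻¹ ≠ 0 := inv_ne_zero (by exact_mod_cast (pow_pos hρ d).ne')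
  rw [localTrace_eq hT, ncard_inter_eq_tsum L (hb.smul₀ ρ)]
  exact mul_div_mul_left _ _ hρ'

/-- Packing: as `√v ≥ 1`, thickening the ball of radius `√v` by `r` stays within radius `(1 + r)
√v`; the constant is a ratio of ball volumes. -/
lemma isGrowthBound_one_add_norm_sq (L : Del d r R) :
    IsGrowthBound (fun x : L.1 => 1 + ‖x.1‖ ^ 2) (((1 + r) / r) ^ d) ((d : ℝ) / 2) := by
  have hr0 := hr.out
  refine ⟨fun x => by nlinarith [sq_nonneg ‖x.1‖], by positivity, fun v hv => ?_⟩
  have hv0 : 0 ≤ v := zero_le_one.trans hv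
  have hs : 1 ≤ √v := Real.one_le_sqrt.2 hv
  have hball : volume (Metric.ball (0 : E d) 1) ≠ 0 := (Metric.measure_ball_pos _ _ one_pos).ne'
  have hball' : volume (Metric.ball (0 : E d) 1) ≠ ∞ := measure_ball_lt_top.ne
  calc ∑' x : L.1, (Ioi (1 + ‖x.1‖ ^ 2)).indicator (fun _ => (1 : ℝ≥0∞)) v
      ≤ ∑' x : L.1, (Metric.ball (0 : E d) √v).indicator 1 x.1 := by
        refine ENNReal.tsum_le_tsum fun x => ?_
        by_cases hx : v ∈ Ioi (1 + ‖x.1‖ ^ 2)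
        · have : x.1 ∈ Metric.ball (0 : E d) √v := by
            rw [mem_ball_zero_iff]
            refine Real.lt_sqrt_of_sq_lt ?_
            have : 1 + ‖x.1‖ ^ 2 < v := hx
            linarith
          rw [indicator_of_mem hx, indicator_of_mem this]
          rfl
        · rw [indicator_of_notMem hx]
          exact bot_le
    _ = ptsMeasure L (Metric.ball 0 √v) := (ptsMeasure_apply L measurableSet_ball).symm
    _ ≤ volume (Metric.thickening r (Metric.ball (0 : E d) √v)) / volume (Metric.ball (0 : E d) r) :=
        ptsMeasure_le L measurableSet_ball
    _ ≤ volume (Metric.ball (0 : E d) ((1 + r) * √v)) / volume (Metric.ball (0 : E d) r) := by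
        gcongr
        intro z hz
        obtain ⟨y, hy, hzy⟩ := Metric.mem_thickening_iff.1 hz
        rw [Metric.mem_ball] at hy ⊢
        nlinarith [dist_triangle z y 0]
    _ = ENNReal.ofReal (((1 + r) / r) ^ d * v ^ ((d : ℝ) / 2)) := by
        rw [Measure.addHaar_ball_of_pos _ _ (by positivity), Measure.addHaar_ball_of_pos _ _ hr0,
          ENNReal.mul_div_mul_right _ _ hball hball', finrank_euclideanSpace_fin,
          ← ENNReal.ofReal_div_of_pos (by positivity)]
        congr 1
        rw [mul_pow, div_pow, Real.sqrt_eq_rpow, ← Real.rpow_natCast (v ^ (1 / 2 : ℝ)),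
          ← Real.rpow_mul hv0]
        ring_nf

omit hr in
/-- Convergence of the normalised summatory function of a pattern with a mean. -/
lemma HasMean.tendsto_summatory {L : Del d r R} {a : E d → ℂ} {τ : ℂ} (h : HasMean L a τ) :
    Tendsto (fun v : ℝ => ((v ^ ((d : ℝ) / 2) : ℝ) : ℂ)⁻¹ *
      summatory (fun x : L.1 => 1 + ‖x.1‖ ^ 2) (fun x => a x) v) atTop
      (𝓝 (τ * (volume.real (Metric.ball (0 : E d) 1) : ℂ))) := by
  -- `1 + |x|² < v` means `|x| < √(v - 1)`, so the mean over dilates of the open unit ball applies;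
  -- passing from `v - 1` to `v` in the normalisation costs a factor tending to `1`.
  have hs : Tendsto (fun v : ℝ => √(v - 1)) atTop atTop :=
    Real.tendsto_sqrt_atTop.comp (tendsto_atTop_add_const_right _ (-1) tendsto_id)
  have h1 := (h _ (convex_ball 0 1) Metric.isBounded_ball).comp hs
  have hq : Tendsto (fun v : ℝ => (v - 1) / v) atTop (𝓝 1) := by
    have : Tendsto (fun v : ℝ => 1 - v⁻¹) atTop (𝓝 (1 - 0)) :=
      tendsto_const_nhds.sub tendsto_inv_atTop_zero
    rw [sub_zero] at this
    refine this.congr' ?_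
    filter_upwards [eventually_gt_atTop 0] with v hv
    field_simp
  have hq2 : Tendsto (fun v : ℝ => ((((v - 1) / v) ^ ((d : ℝ) / 2) : ℝ) : ℂ)) atTop (𝓝 1) := by
    have := hq.rpow_const (p := (d : ℝ) / 2) (Or.inl one_ne_zero)
    rw [Real.one_rpow] at this
    exact_mod_cast (Complex.continuous_ofReal.tendsto _).comp this
  have h2 := hq2.mul h1
  rw [one_mul] at h2
  refine h2.congr' ?_
  filter_upwards [eventually_gt_atTop 1] with v hv
  have hv1 : 0 < v - 1 := by linarith
  have hv0 : 0 < v := by linarith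
  simp only [Function.comp]
  have e1 : ∑' x : L.1, (√(v - 1) • Metric.ball (0 : E d) 1).indicator a x
      = summatory (fun x : L.1 => 1 + ‖x.1‖ ^ 2) (fun x => a x) v := by
    refine tsum_congr fun x => ?_
    have hiff : x.1 ∈ √(v - 1) • Metric.ball (0 : E d) 1 ↔ v ∈ Ioi (1 + ‖x.1‖ ^ 2) := by
      rw [smul_unitBall_of_pos (Real.sqrt_pos.2 hv1), mem_ball_zero_iff, mem_Ioi,
        Real.lt_sqrt (norm_nonneg _), lt_sub_iff_add_lt']
    by_cases hx : v ∈ Ioi (1 + ‖x.1‖ ^ 2)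
    · rw [indicator_of_mem hx, indicator_of_mem (hiff.2 hx)]
    · rw [indicator_of_notMem hx, indicator_of_notMem fun hc => hx (hiff.1 hc)]
  have e2 : √(v - 1) ^ d = (v - 1) ^ ((d : ℝ) / 2) := by
    rw [Real.sqrt_eq_rpow, ← Real.rpow_natCast ((v - 1) ^ (1 / 2 : ℝ)), ← Real.rpow_mul hv1.le]
    ring_nf
  have hne : (((v - 1) ^ ((d : ℝ) / 2) : ℝ) : ℂ) ≠ 0 := by
    exact_mod_cast (Real.rpow_pos_of_pos hv1 _).ne'
  rw [e1, e2, Real.div_rpow hv1.le hv0.le, ← mul_assoc]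
  congr 1
  push_cast
  field_simp

omit hr in
lemma weight_apply_e (L : Del d r R) {s : ℂ} (hs : 0 ≤ s.re) (x : L.1) :
    weight L s (e x) = ((1 + ‖x.1‖ ^ 2 : ℝ) : ℂ) ^ (-s / 2) • e x := by
  classical
  have hw : ∀ x : L.1, ‖((1 + ‖x.1‖ ^ 2 : ℝ) : ℂ) ^ (-s / 2)‖ ≤ 1 := by
    intro x
    rw [Complex.norm_cpow_eq_rpow_re_of_pos (by positivity)]
    refine Real.rpow_le_one_of_one_le_of_nonpos (by nlinarith [sq_nonneg ‖x.1‖]) ?_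
    rw [show -s / 2 = ((-1 / 2 : ℝ) : ℂ) * s by push_cast; ring, Complex.re_ofReal_mul]
    linarith
  refine apply_e_of_diag (w := fun x : L.1 => ((1 + ‖x.1‖ ^ 2 : ℝ) : ℂ) ^ (-s / 2)) ?_ x
  have := isOpOfKernel_opOfKernel ((isFormBound_diag hw).exists_op zero_le_one)
  convert this
  rw [weight]

lemma summable_norm_weight (L : Del d r R) (hd : 0 < d) {s : ℂ} (hs : (d : ℝ) < s.re) :
    Summable fun x : L.1 => ‖((1 + ‖x.1‖ ^ 2 : ℝ) : ℂ) ^ (-s / 2)‖ := by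
  have hd' : (0 : ℝ) < d := by exact_mod_cast hd
  have hu := isGrowthBound_one_add_norm_sq L
  refine (hu.summable_rpow (σ := s.re / 2) (by linarith) (by linarith)).congr fun x => ?_
  rw [hu.norm_cpow x, show -s / 2 = ((-1 / 2 : ℝ) : ℂ) * s by push_cast; ring,
    Complex.re_ofReal_mul]
  ring_nf

/-- The residue of the zeta function of an operator whose diagonal has a mean. -/
lemma HasMean.hasResidueAt {L : Del d r R} {a : E d → ℂ} {τ : ℂ} (hd : 0 < d) {C : ℝ}
    (h : HasMean L a τ) (ha : ∀ x : L.1, ‖a x‖ ≤ C) {k : L.1 → L.1 → ℂ}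
    {T : ell2 L.1 →L[ℂ] ell2 L.1} (hT : IsOpOfKernel k T) (hk : ∀ x : L.1, k x x = a x) :
    HasResidueAt (fun s => opTrace (T * weight L s)) (d : ℝ)
      (d * (τ * (volume.real (Metric.ball (0 : E d) 1) : ℂ))) := by
  have hd' : (0 : ℝ) < d := by exact_mod_cast hd
  have h1 := (hasResidueAt_tsum (isGrowthBound_one_add_norm_sq L) (by positivity) ha
    h.tendsto_summatory).comp_div_two
  rw [mul_div_cancel₀ _ two_ne_zero, ← mul_assoc 2, show (2 : ℂ) * ((d / 2 : ℝ) : ℂ) = d by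
    push_cast; ring] at h1
  refine h1.congr fun s hs => ?_
  rw [opTrace_mul_of_diag hT fun x => weight_apply_e L (hd'.le.trans hs.le) x]
  refine tsum_congr fun x => ?_
  rw [hk, neg_div]

omit hr in
lemma repKernel_diag (B : Matrix (Fin d) (Fin d) ℝ) (f : Gpd L₀ → ℂ) (L : Del d r R) (x : L.1) :
    repKernel B f L x x = ev f (L.shift x.1) 0 := by
  rw [repKernel, sub_self, phase_zero_left, one_mul]

end Aperiodic
end

/-! ### The main theorem -/

open Aperiodic in
theorem mainTheorem5 {d : ℕ} (hd : 0 < d) {r R : ℝ} (hr : 0 < r) (hrR : r < R)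
    (L₀ : Del d r R) (μ : Measure (Del d r R)) (hμ : IsErgodicOnHull L₀ μ)
    (B : Matrix (Fin d) (Fin d) ℝ) (hB : B.transpose = -B)
    (f : Gpd L₀ → ℂ) (hf : IsSobolev B μ f) :
    Integrable (fun L => ev f L 0) (transverseMeasure μ) ∧
    ∀ᵐ L ∂(transverseMeasure μ),
      (∃ T, IsOpOfKernel (repKernel B f L) T) ∧
      HasTracePerVolume L (rep B f L) (trT μ f) ∧
      HasTracePerSite L (rep B f L) (trT μ f / ((transverseMeasure μ).real Set.univ : ℂ)) ∧
      (∀ s : ℂ, (d : ℝ) < s.re → IsTraceClass (rep B f L * weight L s)) ∧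
      ∃ c : ℂ, HasResidueAt (fun s => opTrace (rep B f L * weight L s)) (d : ℝ) c ∧
        trT μ f = 1 / (((volume : Measure (E d)).toSphere.real Set.univ : ℝ) : ℂ) * c := by
  have : Fact (0 < r) := ⟨hr⟩
  have : IsProbabilityMeasure μ := ⟨hμ.prob⟩
  obtain ⟨f₁, hf₁, hff₁, C, hC, hbound⟩ := hf.1.exists_isFormBound hμ.carried hμ.invariant hB
  have htr := ae_mem_transversal hμ.carried
  have hev := ae_ev_eq hμ.carried hff₁
  have hm₀ : Measurable fun L : Del d r R => ev f₁ L 0 :=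
    (measurable_ev hf₁).comp (measurable_id.prodMk measurable_const)
  have hS : MeasurableSet {L : Del d r R | ‖ev f₁ L 0‖ ≤ C} :=
    measurableSet_le hm₀.norm measurable_const
  -- Truncation makes the diagonal function bounded everywhere, as the averaging theorem requires.
  -- It changes nothing almost surely, since a form bound `C` bounds the diagonal by `C`.
  let g : Del d r R → ℂ := {L | ‖ev f₁ L 0‖ ≤ C}.indicator fun L => ev f₁ L 0
  have hgC : ∀ L, ‖g L‖ ≤ C := fun L => by
    by_cases hL : L ∈ {L : Del d r R | ‖ev f₁ L 0‖ ≤ C}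
    · simp only [g, indicator_of_mem hL]
      exact hL
    · simpa only [g, indicator_of_notMem hL, norm_zero] using hC
  have hg : IsBddMeas g := ⟨hm₀.indicator hS, C, hC, hgC⟩
  have hg1 : ∀ᵐ L ∂(transverseMeasure μ), ev f L 0 = g L := by
    filter_upwards [htr, hev, hbound] with L hL hLe hLb
    have hrow := hLb.row hC ⟨0, hL.2⟩ {⟨0, hL.2⟩}
    rw [Finset.sum_singleton, repKernel_diag, Del.shift_zero] at hrow
    have hmem : L ∈ {L : Del d r R | ‖ev f₁ L 0‖ ≤ C} := abs_le_of_sq_le_sq' hrow hC |>.2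
    rw [hLe 0 hL.2]
    exact (indicator_of_mem hmem fun L => ev f₁ L 0).symm
  have hint : Integrable (fun L => ev f L 0) (transverseMeasure μ) := (hg.integrable _).congr (by
    filter_upwards [hg1] with L hL
    exact hL.symm)
  have htrT : trT μ f = ∫ L, g L ∂(transverseMeasure μ) := integral_congr_ae hg1
  refine ⟨hint, ?_⟩
  have hone : IsBddMeas fun _ : Del d r R => (1 : ℂ) :=
    ⟨measurable_const, 1, zero_le_one, fun _ => by simp⟩
  -- For `𝐏 = 0` the almost sure claim is void; otherwise division by the total mass is legitimate.
  rcases eq_or_ne (transverseMeasure μ) 0 with h0 | h0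
  · rw [h0]
    simp
  have hP : (((transverseMeasure μ).real Set.univ : ℝ) : ℂ) ≠ 0 := by
    exact_mod_cast (ENNReal.toReal_pos (Measure.measure_univ_ne_zero.2 h0) (measure_ne_top _ _)).ne'
  -- The sphere has area `d Vol(B)`, which cancels the factor in the residue `d τ Vol(B)`.
  have hsph : (((volume : Measure (E d)).toSphere.real Set.univ : ℝ) : ℂ)
      = d * (volume.real (Metric.ball (0 : E d) 1) : ℂ) := by
    rw [Measure.toSphere_real_apply_univ, finrank_euclideanSpace_fin]
    push_cast
    rfl
  have hball : (volume.real (Metric.ball (0 : E d) 1) : ℂ) ≠ 0 := by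
    exact_mod_cast (volume_real_pos Metric.isBounded_ball
      (by rw [Metric.isOpen_ball.interior_eq]; exact ⟨0, by simp⟩)).ne'
  have hd0 : (d : ℂ) ≠ 0 := by exact_mod_cast hd.ne'
  -- The constant function `1` counts the points and has mean `𝐏(Ξ)`, which yields the trace per
  -- site. The identity with `g` is needed at every `L - x`, since these are where the diagonal of
  -- `π_L(f)` is evaluated.
  filter_upwards [ae_tendsto_tsum hμ.invariant hμ.ergodic hg,
    ae_tendsto_tsum hμ.invariant hμ.ergodic hone, hbound,
    ae_repKernel_eq hμ.carried hμ.invariant B hff₁, ae_forall_shift hμ.invariant hg1]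
    with L hLg hL1 hLb hLk hLs
  have hmean : HasMean L (fun x => g (L.shift x)) (trT μ f) := by
    rw [htrT]
    exact hLg
  have hmean1 : HasMean L (fun _ => 1) ((transverseMeasure μ).real Set.univ : ℂ) := by
    have : ∫ _ : Del d r R, (1 : ℂ) ∂(transverseMeasure μ)
        = ((transverseMeasure μ).real Set.univ : ℂ) := by simp
    rw [← this]
    exact hL1
  have hex : ∃ T, IsOpOfKernel (repKernel B f L) T := by
    rw [hLk]
    exact hLb.exists_op hC
  have hop : IsOpOfKernel (repKernel B f L) (rep B f L) := isOpOfKernel_opOfKernel hex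
  have hdiag : ∀ x : L.1, repKernel B f L x x = g (L.shift x.1) := fun x => by
    rw [repKernel_diag, hLs x.1 x.2]
  have hT : ∀ x : L.1, rep B f L (e x) x = g (L.shift x.1) := fun x => by
    rw [hop.apply_e, hdiag]
  refine ⟨hex, hmean.hasTracePerVolume hT, hmean.hasTracePerSite hmean1 hP hT, fun s hs => ?_, _,
    hmean.hasResidueAt hd (fun x => hgC _) hop hdiag, ?_⟩
  · exact isTraceClass_mul_of_diag
      (fun x => weight_apply_e L ((Nat.cast_nonneg d).trans hs.le) x) (summable_norm_weight L hd hs)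
  · rw [hsph]
    field_simp
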